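/- Let $n\ge 2$ and let $(M,g)$ be a connected smooth Riemannian manifold of dimension $n$ with Levi-Civita connection $\nabla$. Let $TM$ carry the Sasaki metric $\tilde g$, determined by $\tilde g(X^h,Y^h)=\tilde g(X^v,Y^v)=g(X,Y)$ and $\tilde g(X^h,Y^v)=0$, where $X^h$, $X^v$ are the horizontal (with respect to $\nabla$) and vertical lifts of vectors on $M$. Let $\pi:TM\to M$ be the projection and let $T_1M=\{(p,u)\in TM: g_p(u,u)=1\}$ be the unit tangent bundle, a hypersurface of $TM$ of dimension $2n-1$. Equip $T_1M$ with its canonical contact metric structure, whose metric $\bar g$ is $\tfrac14$ times the metric induced by $\tilde g$ and whose contact form is $\eta_{(p,u)}(A)=\tfrac12\,g_p(d\pi(A),u)$ for $A\in T_{(p,u)}T_1M$. Suppose that $T_1M$ is $\eta$-Einstein, i.e. that there are smooth functions $\alpha,\beta:T_1M\to\mathbb R$ such that the Ricci tensor $\bar\rho$ of $(T_1M,\bar g)$ satisfies $$\bar\rho(\bar X,\bar Y)=\alpha\,\bar g(\bar X,\bar Y)+\beta\,\eta(\bar X)\eta(\bar Y)$$ for all vectors $\bar X,\bar Y$ tangent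 to $T_1M$ at a common point. Then $\alpha$ and $\beta$ are both constant on $T_1M$. -/

import Mathlib

open scoped Manifold ContDiff Topology

noncomputable section

namespace UnitTangent

/-! ### Riemannian geometry in coordinates on (an open subset of) `ℝᵐ` -/

/-- The coordinate space `ℝᵐ`. -/
abbrev Coord (m : ℕ) := EuclideanSpace ℝ (Fin m)

/-- The coordinate vector `∂ᵢ`. -/
abbrev basisVec {m : ℕ} (i : Fin m) : Coord m := EuclideanSpace.single i (1 : ℝ)

/-- The partial derivative `∂ᵢ f` at `x`. -/
def partialDeriv {m : ℕ} (i : Fin m) (f : Coord m → ℝ) (x : Coord m) : ℝ :=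
  fderiv ℝ f x (basisVec i)

/-- The Christoffel symbol `Γᵏᵢⱼ = ½ ∑ₗ Gᵏˡ (∂ᵢ Gⱼₗ + ∂ⱼ Gᵢₗ - ∂ₗ Gᵢⱼ)` of the Levi-Civita connection
of a metric with components `G`. -/
def christoffel {m : ℕ} (G : Coord m → Matrix (Fin m) (Fin m) ℝ) (k i j : Fin m)
    (x : Coord m) : ℝ :=
  (1 / 2 : ℝ) * ∑ l, (G x)⁻¹ k l *
    (partialDeriv i (fun y => G y j l) x + partialDeriv j (fun y => G y i l) x
      - partialDeriv l (fun y => G y i j) x)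

/-- The component `l` of `R(∂ᵢ, ∂ⱼ)∂ₖ`, where
`R(X,Y)Z = ∇_X ∇_Y Z - ∇_Y ∇_X Z - ∇_[X,Y] Z`. -/
def riemann {m : ℕ} (G : Coord m → Matrix (Fin m) (Fin m) ℝ) (l i j k : Fin m)
    (x : Coord m) : ℝ :=
  partialDeriv i (christoffel G l j k) x - partialDeriv j (christoffel G l i k) x
    + ∑ s, (christoffel G s j k x * christoffel G l i s x
      - christoffel G s i k x * christoffel G l j s x)

/-- The Ricci tensor `ρ(∂ⱼ, ∂ₖ) = trace (Z ↦ R(Z, ∂ⱼ)∂ₖ)`. -/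
def ricci {m : ℕ} (G : Coord m → Matrix (Fin m) (Fin m) ℝ) (x : Coord m) (j k : Fin m) : ℝ :=
  ∑ i, riemann G i i j k x

/-! ### The base manifold, its tangent bundle and the Sasaki metric -/

section Manifold

variable {n : ℕ} {M : Type*} [TopologicalSpace M] [ChartedSpace (Coord n) M]
  [IsManifold (𝓡 n) ∞ M]

variable (n M) in
/-- Smooth Riemannian metrics on the `n`-dimensional smooth manifold `M`. -/
abbrev RiemMetric :=
  Bundle.ContMDiffRiemannianMetric (𝓡 n) ∞ (Coord n) (fun p : M => TangentSpace (𝓡 n) p)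

/-- The components `gᵢⱼ` of the Riemannian metric in the chart `e`, a function of the coordinates
(meaningful on `e.target`). -/
def chartMetric (g : RiemMetric n M) (e : OpenPartialHomeomorph M (Coord n)) (x : Coord n) :
    Matrix (Fin n) (Fin n) ℝ :=
  Matrix.of fun i j =>
    g.inner (e.symm x) (mfderiv (𝓡 n) (𝓡 n) e.symm x (basisVec i))
      (mfderiv (𝓡 n) (𝓡 n) e.symm x (basisVec j))

/-- The coordinates `(x, w)` on `TM` induced by a chart `e` of `M`: the coordinates of the
foot point and the components of the vector. -/
def bundleCoord (e : OpenPartialHomeomorph M (Coord n)) (v : TangentBundle (𝓡 n) M) :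
    Coord n × Coord n :=
  (e v.1, mfderiv (𝓡 n) (𝓡 n) e v.1 v.2)

/-- The components `(dx, dw)` of a tangent vector `A ∈ T_v TM` in the coordinates of `TM` induced by
the chart `e` of `M`. -/
def bundleComp (e : OpenPartialHomeomorph M (Coord n)) (v : TangentBundle (𝓡 n) M)
    (A : TangentSpace (𝓡 n).tangent v) : Coord n × Coord n :=
  mfderiv (𝓡 n).tangent 𝓘(ℝ, Coord n × Coord n) (bundleCoord e) v A

/-- The component `k` of `K A ∈ T_p M`, where `K : T_v TM → T_p M` is the connection map of the
Levi-Civita connection: `dwᵏ + ∑ᵢⱼ Γᵏᵢⱼ dxⁱ wʲ`. The horizontal vectors are those with `K A = 0`;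
for a vertical lift, `K Xᵛ = X`. -/
def connectionComp (g : RiemMetric n M) (e : OpenPartialHomeomorph M (Coord n))
    (v : TangentBundle (𝓡 n) M) (A : TangentSpace (𝓡 n).tangent v) (k : Fin n) : ℝ :=
  (bundleComp e v A).2 k
    + ∑ i, ∑ j, christoffel (chartMetric g e) k i j (e v.1)
        * (bundleComp e v A).1 i * (bundleCoord e v).2 j

/-- The Sasaki metric `g̃(A, B) = g(dπ A, dπ B) + g(K A, K B)` on `TM`, computed in a chart `e` of
`M` around the foot point of `v` (the value is the same for all such charts). Equivalently
`g̃(Xʰ, Yʰ) = g̃(Xᵛ, Yᵛ) = g(X, Y)` and `g̃(Xʰ, Yᵛ) = 0`. -/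
def sasaki (g : RiemMetric n M) (e : OpenPartialHomeomorph M (Coord n))
    (v : TangentBundle (𝓡 n) M) (A B : TangentSpace (𝓡 n).tangent v) : ℝ :=
  ∑ k, ∑ l, chartMetric g e (e v.1) k l *
    ((bundleComp e v A).1 k * (bundleComp e v B).1 l
      + connectionComp g e v A k * connectionComp g e v B l)

/-! ### The unit tangent bundle and its canonical contact metric structure -/

/-- The unit tangent bundle `T₁M`, a hypersurface of `TM`. -/
def UnitTangentBundle (g : RiemMetric n M) : Type _ :=
  {v : TangentBundle (𝓡 n) M // g.inner v.1 v.2 v.2 = 1}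

/-- The metric of the canonical contact metric structure: `ḡ = ¼ g̃` on vectors tangent to
`T₁M`. -/
def contactMetric (g : RiemMetric n M) (e : OpenPartialHomeomorph M (Coord n))
    (v : UnitTangentBundle g) (A B : TangentSpace (𝓡 n).tangent v.1) : ℝ :=
  (1 / 4 : ℝ) * sasaki g e v.1 A B

/-- The contact form of the canonical contact metric structure at `(p, u)`:
`η(A) = ½ g(dπ A, u)`, that is `η(Xʰ) = ½ g(X, u)` and `η(Xᵗ) = 0`. -/
def contactForm (g : RiemMetric n M) (v : UnitTangentBundle g)
    (A : TangentSpace (𝓡 n).tangent v.1) : ℝ :=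
  (1 / 2 : ℝ) * g.inner v.1.1
    (mfderiv (𝓡 n).tangent (𝓡 n) (fun z : TangentBundle (𝓡 n) M => z.1) v.1 A) v.1.2

/-- `ψ` is a local parametrization of the hypersurface `T₁M` on the open set `U ⊆ ℝ²ⁿ⁻¹`:
a smooth immersion of `U` into `TM` with values in `T₁M`. As `dim T₁M = 2n - 1`, this says that
`ψ` is a local diffeomorphism from `U` to `T₁M`. The values of `ψ` outside `U` are irrelevant. -/
structure IsLocalParam (g : RiemMetric n M) (U : Set (Coord (2 * n - 1)))
    (ψ : Coord (2 * n - 1) → UnitTangentBundle g) : Prop where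
  isOpen : IsOpen U
  smooth : ContMDiffOn (𝓡 (2 * n - 1)) (𝓡 n).tangent ∞ (fun y => (ψ y).1) U
  immersion : ∀ y ∈ U, Function.Injective
    (mfderiv (𝓡 (2 * n - 1)) (𝓡 n).tangent (fun y => (ψ y).1) y)

/-- The tangent vector `dψ(∂ᵢ)` at `ψ y`. -/
def paramVec (g : RiemMetric n M) (ψ : Coord (2 * n - 1) → UnitTangentBundle g)
    (y : Coord (2 * n - 1)) (i : Fin (2 * n - 1)) : TangentSpace (𝓡 n).tangent (ψ y).1 :=
  mfderiv (𝓡 (2 * n - 1)) (𝓡 n).tangent (fun z => (ψ z).1) y (basisVec i)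

/-- The components `ḡᵢⱼ` of the metric of `T₁M` in the local parametrization `ψ`. -/
def contactMetricComp (g : RiemMetric n M) (e : OpenPartialHomeomorph M (Coord n))
    (ψ : Coord (2 * n - 1) → UnitTangentBundle g) (y : Coord (2 * n - 1)) :
    Matrix (Fin (2 * n - 1)) (Fin (2 * n - 1)) ℝ :=
  Matrix.of fun i j => contactMetric g e (ψ y) (paramVec g ψ y i) (paramVec g ψ y j)

/-- The components `ηᵢ` of the contact form in the local parametrization `ψ`. -/
def contactFormComp (g : RiemMetric n M) (ψ : Coord (2 * n - 1) → UnitTangentBundle g)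
    (y : Coord (2 * n - 1)) (i : Fin (2 * n - 1)) : ℝ :=
  contactForm g (ψ y) (paramVec g ψ y i)

/-- A real function on `T₁M` is smooth: it is smooth in every local parametrization. -/
def IsSmooth (g : RiemMetric n M) (f : UnitTangentBundle g → ℝ) : Prop :=
  ∀ (U : Set (Coord (2 * n - 1))) (ψ : Coord (2 * n - 1) → UnitTangentBundle g),
    IsLocalParam g U ψ → ContDiffOn ℝ ∞ (fun y => f (ψ y)) U

/-- `T₁M` with its canonical contact metric structure is `η`-Einstein with the smooth functions
`α` and `β`: its Ricci tensor is `ρ̄ = α ḡ + β η ⊗ η`. The tensor identity is expressed through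
components, in all local parametrizations of `T₁M` lying over the domain of a chart of `M`. -/
structure IsEtaEinstein (g : RiemMetric n M) (α β : UnitTangentBundle g → ℝ) : Prop where
  smooth_alpha : IsSmooth g α
  smooth_beta : IsSmooth g β
  ricci_eq : ∀ e ∈ IsManifold.maximalAtlas (𝓡 n) ∞ M,
    ∀ (U : Set (Coord (2 * n - 1))) (ψ : Coord (2 * n - 1) → UnitTangentBundle g),
      IsLocalParam g U ψ → (∀ y ∈ U, (ψ y).1.1 ∈ e.source) →
        ∀ y ∈ U, ∀ i j : Fin (2 * n - 1),
          ricci (contactMetricComp g e ψ) y i j =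
            α (ψ y) * contactMetricComp g e ψ y i j
              + β (ψ y) * (contactFormComp g ψ y i * contactFormComp g ψ y j)

end Manifold

end UnitTangent

end

/-! Let `u` be a unit vector at `p` and write R(i,j)u for the curvature of `M` at `p` applied to
`u`. In coordinates of the unit tangent bundle adapted to a normal chart at `p`, the Ricci tensor
has two kinds of components that matter. In a unit vertical direction X ⊥ u it is n - 2 + ¼ ∑ᵢⱼ ⟨X,
R(i,j)u⟩² (`ricci_sphereMetric_inr`), and on horizontal vectors it is ρⱼₖ - ½ ∑ᵢ ⟨R(j,i)u, R(k,i)u⟩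
(`ricci_sphereMetric_inl`). The mixed components are never needed, and the constant factor ¼ of the
metric does not affect the Ricci tensor. The η-Einstein condition thus becomes two algebraic
identities for the curvature tensor at each point.

These identities are exploited in `eta_einstein_algebra`. The vertical sum is symmetric in X and u
because R(i,j) is skew, so `α` is constant on each fibre; a trace of the horizontal identity then
does the same for `β`. Both identities now say that certain quadratic forms in u are constant on the
unit sphere, so they can be polarised. One contraction of the polarised horizontal identity shows
that M is Einstein at p, say ρ = λ g. Another contraction, together with the first Bianchi identity,
gives a second scalar relation. The outcome is that (3n - 2)α + β and (n + 1)(α + β) are polynomials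
in λ with coefficients depending only on n. As n ≥ 2, they determine `α` and `β`, and it remains to
see that λ is constant.

For n ≥ 3 this is Schur's lemma (`IsNormalAt.schur`), a consequence of the contracted second Bianchi
identity. For n = 2 Schur's lemma says nothing, but the algebra also yields λ² = λ, and a
differentiable idempotent function has zero derivative. Connectedness of M concludes.

The factor λ is found at each point in a chart normal at that point, so differentiating it requires
the transformation law of the Ricci tensor (`ricci_pullbackMetric`). A normal chart means only that
the metric is the identity to first order at one point; it is produced by a quadratic change of
coordinates (`exists_normalizing_map`), without geodesics. Curvature is computed from the 2-jet of
the metric through `HasJet` and `ricci_of_jet`. -/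

noncomputable section

namespace UnitTangent

/-! ### Second order jets -/

section Jets

variable {E F : Type*} [NormedAddCommGroup E] [NormedSpace ℝ E]
  [NormedAddCommGroup F] [NormedSpace ℝ F]

/-- `f` is smooth at `x`, with value `c`, derivative `l` and second derivative `Q` there. -/
structure HasJet (f : E → ℝ) (x : E) (c : ℝ) (l : E → ℝ) (Q : E → E → ℝ) : Prop where
  smooth : ContDiffAt ℝ ∞ f x
  val : f x = c
  d1 : ∀ v, fderiv ℝ f x v = l v
  d2 : ∀ v w, fderiv ℝ (fun y => fderiv ℝ f y w) x v = Q v w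

theorem contDiffAt_fderiv_apply {f : E → ℝ} {x : E} (hf : ContDiffAt ℝ ∞ f x) (w : E) :
    ContDiffAt ℝ ∞ (fun y => fderiv ℝ f y w) x :=
  (hf.fderiv_right (m := ∞) (by simp)).clm_apply contDiffAt_const

theorem eventually_differentiableAt {f : E → ℝ} {x : E} (hf : ContDiffAt ℝ ∞ f x) :
    ∀ᶠ y in 𝓝 x, DifferentiableAt ℝ f y := by
  have h1 : ContDiffAt ℝ 1 f x := hf.of_le (by simp)
  filter_upwards [h1.eventually (by simp)] with y hy
  exact hy.differentiableAt (by simp)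

theorem two_le_infty : (2 : WithTop ℕ∞) ≤ ∞ :=
  show ((2 : ℕ∞) : WithTop ℕ∞) ≤ _ from WithTop.coe_le_coe.2 le_top

theorem fderiv_fderiv_symm {f : E → ℝ} {x : E} (hf : ContDiffAt ℝ 2 f x) (v w : E) :
    fderiv ℝ (fun y => fderiv ℝ f y w) x v = fderiv ℝ (fun y => fderiv ℝ f y v) x w := by
  have hd : DifferentiableAt ℝ (fderiv ℝ f) x :=
    (hf.fderiv_right (m := 1) (by norm_num)).differentiableAt (by simp)
  have key : ∀ u, fderiv ℝ (fun y => fderiv ℝ f y u) x = (fderiv ℝ (fderiv ℝ f) x).flip u := by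
    intro u
    have := (hd.hasFDerivAt.clm_apply (hasFDerivAt_const u x)).fderiv
    rw [this]; ext; simp
  rw [key, key]
  have hs : IsSymmSndFDerivAt ℝ f x :=
    hf.isSymmSndFDerivAt (by rw [minSmoothness_of_isRCLikeNormedField])
  exact hs v w

theorem hasJet_of_contDiffAt {f : E → ℝ} {x : E} (hf : ContDiffAt ℝ ∞ f x) :
    HasJet f x (f x) (fun v => fderiv ℝ f x v)
      (fun v w => fderiv ℝ (fun y => fderiv ℝ f y w) x v) :=
  ⟨hf, rfl, fun _ => rfl, fun _ _ => rfl⟩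

namespace HasJet

variable {f g : E → ℝ} {x : E} {c c' : ℝ} {l l' : E → ℝ} {Q Q' : E → E → ℝ}

theorem differentiableAt (h : HasJet f x c l Q) : DifferentiableAt ℝ f x :=
  h.smooth.differentiableAt (by simp)

theorem congr (h : HasJet f x c l Q) (hfg : g =ᶠ[𝓝 x] f) : HasJet g x c l Q where
  smooth := h.smooth.congr_of_eventuallyEq hfg
  val := by rw [hfg.eq_of_nhds, h.val]
  d1 v := by rw [hfg.fderiv_eq, h.d1]
  d2 v w := by
    have : (fun y : E => fderiv ℝ g y w) =ᶠ[𝓝 x] fun y : E => fderiv ℝ f y w := by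
      filter_upwards [hfg.fderiv (𝕜 := ℝ)] with y hy
      rw [hy]
    rw [this.fderiv_eq, h.d2]

theorem of_eq (h : HasJet f x c l Q) (hc : c = c') (hl : ∀ v, l v = l' v)
    (hQ : ∀ v w, Q v w = Q' v w) : HasJet f x c' l' Q' :=
  ⟨h.smooth, h.val.trans hc, fun v => (h.d1 v).trans (hl v), fun v w => (h.d2 v w).trans (hQ v w)⟩

theorem const (a : ℝ) : HasJet (fun _ => a) x a (fun _ => 0) (fun _ _ => 0) where
  smooth := contDiffAt_const
  val := rfl
  d1 v := by simp
  d2 v w := by simp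

theorem clm (L : E →L[ℝ] ℝ) : HasJet (fun y => L y) x (L x) (fun v => L v) (fun _ _ => 0) where
  smooth := L.contDiff.contDiffAt
  val := rfl
  d1 v := by rw [show (fun y => L y) = L from rfl, L.fderiv]
  d2 v w := by
    have : (fun y => fderiv ℝ (fun y => L y) y w) = fun _ => L w := by
      ext y; rw [show (fun y => L y) = L from rfl, L.fderiv]
    rw [this]; simp

theorem add (hf : HasJet f x c l Q) (hg : HasJet g x c' l' Q') :
    HasJet (fun y => f y + g y) x (c + c') (fun v => l v + l' v)
      (fun v w => Q v w + Q' v w) where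
  smooth := hf.smooth.add hg.smooth
  val := by rw [hf.val, hg.val]
  d1 v := by
    rw [fderiv_fun_add hf.differentiableAt hg.differentiableAt, add_apply,
      hf.d1, hg.d1]
  d2 v w := by
    have : (fun y => fderiv ℝ (fun y => f y + g y) y w)
        =ᶠ[𝓝 x] fun y => fderiv ℝ f y w + fderiv ℝ g y w := by
      filter_upwards [eventually_differentiableAt hf.smooth,
        eventually_differentiableAt hg.smooth] with y h1 h2
      rw [fderiv_fun_add h1 h2, add_apply]
    rw [this.fderiv_eq, fderiv_fun_add
      ((contDiffAt_fderiv_apply hf.smooth w).differentiableAt (by simp))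
      ((contDiffAt_fderiv_apply hg.smooth w).differentiableAt (by simp)),
      add_apply, hf.d2, hg.d2]

theorem mul (hf : HasJet f x c l Q) (hg : HasJet g x c' l' Q') :
    HasJet (fun y => f y * g y) x (c * c') (fun v => c * l' v + c' * l v)
      (fun v w => c * Q' v w + l v * l' w + l w * l' v + c' * Q v w) where
  smooth := hf.smooth.mul hg.smooth
  val := by rw [hf.val, hg.val]
  d1 v := by
    rw [fderiv_fun_mul hf.differentiableAt hg.differentiableAt]
    simp [hf.d1, hg.d1, hf.val, hg.val]
  d2 v w := by
    have : (fun y => fderiv ℝ (fun y => f y * g y) y w)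
        =ᶠ[𝓝 x] fun y => f y * fderiv ℝ g y w + g y * fderiv ℝ f y w := by
      filter_upwards [eventually_differentiableAt hf.smooth,
        eventually_differentiableAt hg.smooth] with y h1 h2
      rw [fderiv_fun_mul h1 h2]; simp
    have hf' := (contDiffAt_fderiv_apply hf.smooth w).differentiableAt (by simp)
    have hg' := (contDiffAt_fderiv_apply hg.smooth w).differentiableAt (by simp)
    rw [this.fderiv_eq, fderiv_fun_add (hf.differentiableAt.fun_mul hg')
      (hg.differentiableAt.fun_mul hf'), fderiv_fun_mul hf.differentiableAt hg',
      fderiv_fun_mul hg.differentiableAt hf']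
    simp [hf.d1, hg.d1, hf.val, hg.val, hf.d2, hg.d2]
    ring

theorem const_mul (a : ℝ) (hf : HasJet f x c l Q) :
    HasJet (fun y => a * f y) x (a * c) (fun v => a * l v) (fun v w => a * Q v w) :=
  ((HasJet.const a).mul hf).of_eq rfl (by simp) (by simp)

theorem neg (hf : HasJet f x c l Q) :
    HasJet (fun y => -f y) x (-c) (fun v => -l v) (fun v w => -Q v w) :=
  ((hf.const_mul (-1)).congr (by simp)).of_eq (by simp) (by simp) (by simp)

theorem sub (hf : HasJet f x c l Q) (hg : HasJet g x c' l' Q') :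
    HasJet (fun y => f y - g y) x (c - c') (fun v => l v - l' v) (fun v w => Q v w - Q' v w) :=
  ((hf.add hg.neg).congr (by simp [sub_eq_add_neg])).of_eq (by ring) (fun _ => by ring)
    (fun _ _ => by ring)

theorem sum {ι : Type*} (s : Finset ι) {f : ι → E → ℝ} {c : ι → ℝ} {l : ι → E → ℝ}
    {Q : ι → E → E → ℝ} (h : ∀ i ∈ s, HasJet (f i) x (c i) (l i) (Q i)) :
    HasJet (fun y => ∑ i ∈ s, f i y) x (∑ i ∈ s, c i) (fun v => ∑ i ∈ s, l i v)
      (fun v w => ∑ i ∈ s, Q i v w) := by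
  classical
  induction s using Finset.induction_on with
  | empty => simpa using HasJet.const (x := x) 0
  | insert a s ha ih =>
    simp only [Finset.sum_insert ha]
    exact (h a (Finset.mem_insert_self a s)).add
      (ih fun i hi => h i (Finset.mem_insert_of_mem hi))

/-- The inverse of a function which takes the value `1` to first order. -/
theorem inv_of_one (hf : HasJet f x 1 (fun _ => 0) Q) :
    HasJet (fun y => (f y)⁻¹) x 1 (fun _ => 0) (fun v w => -Q v w) := by
  have h0 : f x ≠ 0 := by rw [hf.val]; exact one_ne_zero
  have hs : ContDiffAt ℝ ∞ (fun y => (f y)⁻¹) x := hf.smooth.inv h0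
  have hj := hasJet_of_contDiffAt hs
  -- Both derivatives of the inverse are read off from the product rule applied to this identity.
  have hone : (fun y => f y * (f y)⁻¹) =ᶠ[𝓝 x] fun _ => (1 : ℝ) := by
    filter_upwards [hf.smooth.continuousAt.eventually_ne h0] with y hy
    exact mul_inv_cancel₀ hy
  have h1 := (HasJet.const (x := x) (1 : ℝ)).congr hone
  have h2 := hf.mul hj
  have hl : ∀ v, fderiv ℝ (fun y => (f y)⁻¹) x v = 0 := by
    intro v
    have := (h2.d1 v).symm.trans (h1.d1 v)
    simpa using this
  refine ⟨hs, by simp [hf.val], hl, fun v w => ?_⟩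
  have := (h2.d2 v w).symm.trans (h1.d2 v w)
  simp only [hl, hf.val] at this
  simp at this
  linarith

theorem comp_clm {f : F → ℝ} {l : F → ℝ} {Q : F → F → ℝ} (L : E →L[ℝ] F)
    (hf : HasJet f (L x) c l Q) :
    HasJet (fun y => f (L y)) x c (fun v => l (L v)) (fun v w => Q (L v) (L w)) where
  smooth := hf.smooth.comp x L.contDiff.contDiffAt
  val := hf.val
  d1 v := by
    have := fderiv_comp (𝕜 := ℝ) x hf.differentiableAt L.differentiableAt
    rw [show (fun y => f (L y)) = f ∘ L from rfl, this, L.fderiv]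
    simp [hf.d1]
  d2 v w := by
    have : (fun y => fderiv ℝ (fun y => f (L y)) y w)
        =ᶠ[𝓝 x] (fun z => fderiv ℝ f z (L w)) ∘ L := by
      filter_upwards [L.continuous.continuousAt.eventually
        (eventually_differentiableAt hf.smooth)] with y hy
      have := fderiv_comp (𝕜 := ℝ) y hy L.differentiableAt
      rw [show (fun y => f (L y)) = f ∘ L from rfl, this, L.fderiv]
      simp
    rw [this.fderiv_eq, fderiv_comp (𝕜 := ℝ) x
      ((contDiffAt_fderiv_apply hf.smooth (L w)).differentiableAt (by simp)) L.differentiableAt,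
      L.fderiv]
    simp [hf.d2]

theorem symm (h : HasJet f x c l Q) (v w : E) : Q v w = Q w v := by
  rw [← h.d2, ← h.d2, fderiv_fderiv_symm (h.smooth.of_le two_le_infty)]

end HasJet

end Jets

/-! ### Smoothness and locality of the curvature components -/

section Coordinates

variable {m : ℕ} {G G' : Coord m → Matrix (Fin m) (Fin m) ℝ} {x : Coord m}

theorem contDiffAt_det {E ι : Type*} [NormedAddCommGroup E] [NormedSpace ℝ E] [Fintype ι]
    [DecidableEq ι] {A : E → Matrix ι ι ℝ} {x : E}
    (hA : ∀ i j, ContDiffAt ℝ ∞ (fun y => A y i j) x) :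
    ContDiffAt ℝ ∞ (fun y => (A y).det) x := by
  simp only [Matrix.det_apply]
  exact ContDiffAt.sum fun s _ => (contDiffAt_prod fun i _ => hA _ _).const_smul _

theorem contDiffAt_inv_apply {E ι : Type*} [NormedAddCommGroup E] [NormedSpace ℝ E] [Fintype ι]
    [DecidableEq ι] {A : E → Matrix ι ι ℝ} {x : E}
    (hA : ∀ i j, ContDiffAt ℝ ∞ (fun y => A y i j) x) (hdet : (A x).det ≠ 0) (k l : ι) :
    ContDiffAt ℝ ∞ (fun y => (A y)⁻¹ k l) x := by
  have hadj : ContDiffAt ℝ ∞ (fun y => (A y).adjugate k l) x := by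
    simp only [Matrix.adjugate_apply]
    refine contDiffAt_det fun i j => ?_
    by_cases h : i = l
    · subst h; simpa [Matrix.updateRow_self] using contDiffAt_const
    · simpa [Matrix.updateRow_ne h] using hA i j
  have : (fun y => (A y)⁻¹ k l) = fun y => (A y).det⁻¹ * (A y).adjugate k l := by
    ext y; simp [Matrix.inv_def, Ring.inverse_eq_inv']
  rw [this]
  exact ((contDiffAt_det hA).inv hdet).mul hadj

theorem contDiffAt_christoffel (hG : ∀ i j, ContDiffAt ℝ ∞ (fun y => G y i j) x)
    (hdet : (G x).det ≠ 0) (k i j : Fin m) : ContDiffAt ℝ ∞ (christoffel G k i j) x := by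
  unfold christoffel partialDeriv
  refine contDiffAt_const.mul (ContDiffAt.sum fun l _ => ?_)
  exact (contDiffAt_inv_apply hG hdet k l).mul
    (((contDiffAt_fderiv_apply (hG j l) _).add (contDiffAt_fderiv_apply (hG i l) _)).sub
      (contDiffAt_fderiv_apply (hG i j) _))

theorem christoffel_symm (hsymm : ∀ᶠ y in 𝓝 x, ∀ i j, G y i j = G y j i) (k i j : Fin m) :
    christoffel G k i j x = christoffel G k j i x := by
  unfold christoffel partialDeriv
  congr 1
  refine Finset.sum_congr rfl fun l _ => ?_
  have : fderiv ℝ (fun y => G y i j) x = fderiv ℝ (fun y => G y j i) x :=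
    Filter.EventuallyEq.fderiv_eq (hsymm.mono fun y hy => hy i j)
  rw [this]; ring

theorem christoffel_eventuallyEq (h : G =ᶠ[𝓝 x] G') (k i j : Fin m) :
    christoffel G k i j =ᶠ[𝓝 x] christoffel G' k i j := by
  filter_upwards [h.eventuallyEq_nhds] with y hy
  have : ∀ a b, fderiv ℝ (fun z => G z a b) y = fderiv ℝ (fun z => G' z a b) y := fun a b =>
    Filter.EventuallyEq.fderiv_eq (hy.mono fun z hz => congrFun (congrFun hz a) b)
  simp only [christoffel, partialDeriv, this, hy.eq_of_nhds]

theorem ricci_congr (h : G =ᶠ[𝓝 x] G') (j k : Fin m) : ricci G x j k = ricci G' x j k := by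
  have h1 : ∀ k i j, fderiv ℝ (christoffel G k i j) x = fderiv ℝ (christoffel G' k i j) x :=
    fun k i j => (christoffel_eventuallyEq h k i j).fderiv_eq
  have h2 : ∀ k i j, christoffel G k i j x = christoffel G' k i j x :=
    fun k i j => (christoffel_eventuallyEq h k i j).eq_of_nhds
  simp only [ricci, riemann, partialDeriv, h1, h2]

theorem inv_const_smul {ι : Type*} [Fintype ι] [DecidableEq ι] {a : ℝ} (ha : a ≠ 0)
    (A : Matrix ι ι ℝ) : (a • A)⁻¹ = a⁻¹ • A⁻¹ := by
  by_cases h : IsUnit A.det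
  · exact Matrix.inv_eq_left_inv (by
      rw [Matrix.smul_mul, Matrix.mul_smul, smul_smul, Matrix.nonsing_inv_mul _ h,
        inv_mul_cancel₀ ha, one_smul])
  · have h' : ¬ IsUnit (a • A).det := by
      rw [isUnit_iff_ne_zero, Matrix.det_smul] at *
      simpa [ha] using h
    rw [Matrix.nonsing_inv_apply_not_isUnit _ h, Matrix.nonsing_inv_apply_not_isUnit _ h',
      smul_zero]

theorem christoffel_const_smul {a : ℝ} (ha : a ≠ 0) (k i j : Fin m) :
    christoffel (fun y => a • G y) k i j = christoffel G k i j := by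
  ext x
  have h : ∀ i j, fderiv ℝ (fun y => (a • G y) i j) x = a • fderiv ℝ (fun y => G y i j) x := by
    intro i j
    exact congrFun (fderiv_const_smul_field (𝕜 := ℝ) a (f := fun y => G y i j)) x
  simp only [christoffel, partialDeriv, h, inv_const_smul ha]
  congr 1
  refine Finset.sum_congr rfl fun l _ => ?_
  simp only [Matrix.smul_apply, smul_eq_mul, smul_apply]
  field_simp

/-- The factor cancels between the inverse metric and its derivatives, so the connection is
unchanged. This disposes of the ¼ in the contact metric. -/
theorem ricci_const_smul {a : ℝ} (ha : a ≠ 0) (j k : Fin m) :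
    ricci (fun y => a • G y) x j k = ricci G x j k := by
  simp only [ricci, riemann, christoffel_const_smul ha]

/-! ### Curvature at a point where the metric is the identity matrix -/

/-- The Christoffel symbols of the first kind `[ij, k]`, from the first derivatives
`d i j l = ∂ₗ Gᵢⱼ` of the metric. -/
def firstKind {ι : Type*} (d : ι → ι → ι → ℝ) (i j k : ι) : ℝ :=
  (1 / 2 : ℝ) * (d j k i + d i k j - d i j k)

variable {d1 : Fin m → Fin m → Coord m → ℝ} {d2 : Fin m → Fin m → Coord m → Coord m → ℝ}

/-- Differentiating G⁻¹ G = 1 at a point where G is the identity gives ∂G⁻¹ = -∂G. -/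
theorem hasJet_inv_apply
    (h : ∀ i j, HasJet (fun y => G y i j) x ((1 : Matrix (Fin m) (Fin m) ℝ) i j)
      (d1 i j) (d2 i j)) (k l : Fin m) :
    ContDiffAt ℝ ∞ (fun y => (G y)⁻¹ k l) x ∧ (G x)⁻¹ k l = (1 : Matrix (Fin m) (Fin m) ℝ) k l ∧
      ∀ v, fderiv ℝ (fun y => (G y)⁻¹ k l) x v = - d1 k l v := by
  have hx : G x = 1 := by ext i j; exact (h i j).val
  have hs := contDiffAt_inv_apply (fun i j => (h i j).smooth) (by rw [hx]; simp)
  refine ⟨hs k l, by rw [hx]; simp, fun v => ?_⟩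
  have hdet : ∀ᶠ y in 𝓝 x, (G y).det ≠ 0 :=
    (contDiffAt_det fun i j => (h i j).smooth).continuousAt.eventually_ne (by rw [hx]; simp)
  have h1 : (fun y => ∑ s, (G y)⁻¹ k s * G y s l) =ᶠ[𝓝 x]
      fun _ => (1 : Matrix (Fin m) (Fin m) ℝ) k l := by
    filter_upwards [hdet] with y hy
    rw [← Matrix.mul_apply, Matrix.nonsing_inv_mul _ (isUnit_iff_ne_zero.2 hy)]
  have h2 := HasJet.sum Finset.univ (fun s _ => (hasJet_of_contDiffAt (hs k s)).mul (h s l))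
  have h3 := (h2.d1 v).symm.trans (((HasJet.const _).congr h1).d1 v)
  simp only [hx, inv_one, Finset.sum_add_distrib, Matrix.one_apply, ite_mul, one_mul, zero_mul,
    Finset.sum_ite_eq, Finset.mem_univ, if_true] at h3
  simp at h3
  linarith

theorem christoffel_of_jet
    (h : ∀ i j, HasJet (fun y => G y i j) x ((1 : Matrix (Fin m) (Fin m) ℝ) i j)
      (d1 i j) (d2 i j)) (k i j : Fin m) :
    christoffel G k i j x = firstKind (fun i j l => d1 i j (basisVec l)) i j k := by
  simp [christoffel, firstKind, partialDeriv, (hasJet_inv_apply h _ _).2.1, (h _ _).d1,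
    Matrix.one_apply]

theorem partialDeriv_christoffel_of_jet
    (h : ∀ i j, HasJet (fun y => G y i j) x ((1 : Matrix (Fin m) (Fin m) ℝ) i j)
      (d1 i j) (d2 i j)) (l k i j : Fin m) :
    partialDeriv l (christoffel G k i j) x =
      (1 / 2 : ℝ) * (d2 j k (basisVec l) (basisVec i) + d2 i k (basisVec l) (basisVec j)
        - d2 i j (basisVec l) (basisVec k))
      - ∑ s, d1 k s (basisVec l) * firstKind (fun i j l => d1 i j (basisVec l)) i j s := by
  have hj : ∀ a b c, HasJet (fun y => partialDeriv a (fun z => G z b c) y) x _ _ _ :=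
    fun a b c => hasJet_of_contDiffAt (contDiffAt_fderiv_apply (h b c).smooth (basisVec a))
  have := (((HasJet.sum Finset.univ (fun s _ => (hasJet_of_contDiffAt
    (hasJet_inv_apply h k s).1).mul (((hj i j s).add (hj j i s)).sub (hj s i j)))).const_mul
      (1 / 2 : ℝ)).d1 (basisVec l))
  rw [partialDeriv]
  unfold christoffel
  refine this.trans ?_
  simp only [partialDeriv, (hasJet_inv_apply h _ _).2.1, (hasJet_inv_apply h _ _).2.2, (h _ _).d1,
    (h _ _).d2, Matrix.one_apply, firstKind, ite_mul, one_mul, zero_mul, Finset.sum_add_distrib,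
    Finset.sum_ite_eq, Finset.mem_univ, if_true, mul_add, Finset.mul_sum, mul_neg]
  rw [sub_eq_add_neg _ (∑ s, _), ← Finset.sum_neg_distrib]
  congr 1
  exact Finset.sum_congr rfl fun s _ => by ring

/-- Metric compatibility, ∂_c G_ab = [ca,b] + [cb,a], rewrites the terms coming from the derivative
of the inverse metric as products of first-kind symbols, and these combine with the quadratic terms
of the curvature. First derivatives must be kept: the coordinates used on the sphere bundle are not
normal. -/
theorem riemann_of_jet
    (h : ∀ i j, HasJet (fun y => G y i j) x ((1 : Matrix (Fin m) (Fin m) ℝ) i j)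
      (d1 i j) (d2 i j)) (hsymm : ∀ i j v, d1 i j v = d1 j i v) (l i j k : Fin m) :
    riemann G l i j k x =
      (1 / 2 : ℝ) * (d2 j l (basisVec i) (basisVec k) - d2 j k (basisVec i) (basisVec l)
        - d2 i l (basisVec j) (basisVec k) + d2 i k (basisVec j) (basisVec l))
      + ∑ s, (firstKind (fun i j l => d1 i j (basisVec l)) i k s
            * firstKind (fun i j l => d1 i j (basisVec l)) j l s
          - firstKind (fun i j l => d1 i j (basisVec l)) j k s
            * firstKind (fun i j l => d1 i j (basisVec l)) i l s) := by
  simp only [riemann, partialDeriv_christoffel_of_jet h, christoffel_of_jet h]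
  rw [(h k l).symm (basisVec j) (basisVec i)]
  obtain ⟨Γ, hΓ⟩ : ∃ Γ, Γ = firstKind (fun i j l => d1 i j (basisVec l)) := ⟨_, rfl⟩
  have key : ∀ a b c : Fin m, d1 a b (basisVec c) = Γ c a b + Γ c b a := by
    intro a b c
    simp only [hΓ, firstKind]; rw [hsymm c b, hsymm b a, hsymm c a]; ring
  rw [← hΓ]
  simp only [key]
  simp only [Finset.sum_sub_distrib, add_mul, Finset.sum_add_distrib]
  have comm : ∀ f g : Fin m → ℝ, ∑ s, f s * g s = ∑ s, g s * f s := fun f g =>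
    Finset.sum_congr rfl fun s _ => mul_comm _ _
  rw [comm (fun s => Γ j k s) (fun s => Γ i s l),
    comm (fun s => Γ i k s) (fun s => Γ j s l),
    comm (fun s => Γ i k s) (fun s => Γ j l s),
    comm (fun s => Γ j k s) (fun s => Γ i l s)]
  ring

theorem ricci_of_jet
    (h : ∀ i j, HasJet (fun y => G y i j) x ((1 : Matrix (Fin m) (Fin m) ℝ) i j)
      (d1 i j) (d2 i j)) (hsymm : ∀ i j v, d1 i j v = d1 j i v) (j k : Fin m) :
    ricci G x j k =
      ∑ i, ((1 / 2 : ℝ) * (d2 j i (basisVec i) (basisVec k) - d2 j k (basisVec i) (basisVec i)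
        - d2 i i (basisVec j) (basisVec k) + d2 i k (basisVec j) (basisVec i))
      + ∑ s, (firstKind (fun i j l => d1 i j (basisVec l)) i k s
            * firstKind (fun i j l => d1 i j (basisVec l)) j i s
          - firstKind (fun i j l => d1 i j (basisVec l)) j k s
            * firstKind (fun i j l => d1 i j (basisVec l)) i i s)) := by
  simp only [ricci, riemann_of_jet h hsymm]

end Coordinates

/-! ### The metric of the unit sphere bundle in coordinates -/

section Model

variable {m n : ℕ}

/-- The bilinear form with matrix `A`. -/
def pairing (A : Matrix (Fin n) (Fin n) ℝ) (a b : Fin n → ℝ) : ℝ :=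
  ∑ k, ∑ l, A k l * (a k * b l)

/-- The vertical part of the vector `(x, v)` at a point with fibre coordinate `w`, for the
connection with coefficients `Γ`. -/
def verticalPart (Γ : Fin n → Fin n → Fin n → ℝ) (x v w : Fin n → ℝ) (k : Fin n) : ℝ :=
  v k + ∑ i, ∑ j, Γ k i j * x i * w j

/-- The components of the metric `G(dπ, dπ) + G(K, K)` in the parametrization
`y ↦ (X y, W / |W|)`, `W = u + V y`, of the unit sphere bundle. -/
def sphereMetric (G : Coord n → Matrix (Fin n) (Fin n) ℝ) (X V : Coord m →L[ℝ] Coord n)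
    (u : Coord n) (y : Coord m) : Matrix (Fin m) (Fin m) ℝ :=
  Matrix.of fun I J =>
    let W : Fin n → ℝ := fun k => u k + V y k
    let θ : Fin m → Fin n → ℝ := fun I =>
      verticalPart (fun k i j => christoffel G k i j (X y)) (X (basisVec I)) (V (basisVec I)) W
    pairing (G (X y)) (X (basisVec I)) (X (basisVec J))
      + pairing (G (X y)) (θ I) (θ J) * (pairing (G (X y)) W W)⁻¹
      - pairing (G (X y)) (θ I) W * pairing (G (X y)) (θ J) W
        * ((pairing (G (X y)) W W)⁻¹ * (pairing (G (X y)) W W)⁻¹)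

/-- The derivative of the connection coefficients, as a trilinear map. -/
def connDeriv (Γ1 : Fin n → Fin n → Fin n → Coord n → ℝ) (x : Fin n → ℝ) (y : Coord n)
    (z : Fin n → ℝ) (k : Fin n) : ℝ :=
  ∑ i, ∑ j, Γ1 k i j y * x i * z j

variable {G : Coord n → Matrix (Fin n) (Fin n) ℝ} {X V : Coord m →L[ℝ] Coord n} {u : Coord n}
  {g2 : Fin n → Fin n → Coord n → Coord n → ℝ}
  {Γ1 : Fin n → Fin n → Fin n → Coord n → ℝ}
  {Γ2 : Fin n → Fin n → Fin n → Coord n → Coord n → ℝ}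

theorem pairing_one (a b : Fin n → ℝ) : pairing 1 a b = a ⬝ᵥ b := by
  simp [pairing, Matrix.one_apply, dotProduct]

/-- Since G is the identity to first order, it enters the 2-jet only through its own second
derivatives. -/
theorem hasJet_pairing
    (hG : ∀ k l, HasJet (fun x => G x k l) 0 ((1 : Matrix (Fin n) (Fin n) ℝ) k l)
      (fun _ => 0) (g2 k l))
    {a b : Fin n → Coord m → ℝ} {a0 b0 : Fin n → ℝ} {a1 b1 : Fin n → Coord m → ℝ}
    {a2 b2 : Fin n → Coord m → Coord m → ℝ}
    (ha : ∀ k, HasJet (a k) 0 (a0 k) (a1 k) (a2 k))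
    (hb : ∀ k, HasJet (b k) 0 (b0 k) (b1 k) (b2 k)) :
    HasJet (fun y => pairing (G (X y)) (fun k => a k y) (fun k => b k y)) 0 (a0 ⬝ᵥ b0)
      (fun v => a0 ⬝ᵥ (fun k => b1 k v) + (fun k => a1 k v) ⬝ᵥ b0)
      (fun v w => pairing (Matrix.of fun k l => g2 k l (X v) (X w)) a0 b0
        + (a0 ⬝ᵥ (fun k => b2 k v w) + (fun k => a1 k v) ⬝ᵥ (fun k => b1 k w)
        + (fun k => a1 k w) ⬝ᵥ (fun k => b1 k v) + (fun k => a2 k v w) ⬝ᵥ b0)) := by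
  have hGX : ∀ k l, HasJet (fun y => G (X y) k l) 0 ((1 : Matrix (Fin n) (Fin n) ℝ) k l)
      (fun _ => 0) (fun v w => g2 k l (X v) (X w)) := fun k l =>
    HasJet.comp_clm X (by rw [map_zero]; exact hG k l)
  have := HasJet.sum Finset.univ fun k _ => HasJet.sum Finset.univ fun l _ =>
    (hGX k l).mul ((ha k).mul (hb l))
  unfold pairing
  refine this.of_eq ?_ (fun v => ?_) (fun v w => ?_)
  · simp [Matrix.one_apply, dotProduct]
  · simp [Matrix.one_apply, dotProduct, Finset.sum_add_distrib, mul_comm]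
  · simp only [Matrix.one_apply, dotProduct, Finset.sum_add_distrib, ite_mul, one_mul, zero_mul,
      add_zero, Finset.sum_ite_eq, Finset.mem_univ, if_true, Matrix.of_apply]
    have hc : ∀ k l, (a0 k * b0 l) * g2 k l (X v) (X w) = g2 k l (X v) (X w) * (a0 k * b0 l) :=
      fun _ _ => mul_comm _ _
    simp only [hc]
    have hd : ∀ k, b0 k * a2 k v w = a2 k v w * b0 k := fun _ => mul_comm _ _
    simp only [hd]
    ring

variable (G X V u) in
theorem hasJet_coord_add (k : Fin n) :
    HasJet (fun y => u k + V y k) 0 (u k) (fun v => V v k) (fun _ _ => 0) :=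
  ((HasJet.const (x := (0 : Coord m)) (u k)).add
    (HasJet.clm ((EuclideanSpace.proj k).comp V))).of_eq (by simp) (by simp) (by simp)

theorem hasJet_verticalPart
    (hΓ : ∀ k i j, HasJet (christoffel G k i j) 0 0 (Γ1 k i j) (Γ2 k i j))
    (x v : Fin n → ℝ) (k : Fin n) :
    HasJet (fun y => verticalPart (fun k i j => christoffel G k i j (X y)) x v
      (fun k => u k + V y k) k) 0 (v k) (fun z => connDeriv Γ1 x (X z) u k)
      (fun z w => connDeriv (fun k i j a => Γ2 k i j a (X w)) x (X z) u k
        + connDeriv Γ1 x (X z) (V w) k + connDeriv Γ1 x (X w) (V z) k) := by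
  have hΓX : ∀ k i j, HasJet (fun y => christoffel G k i j (X y)) 0 0
      (fun v => Γ1 k i j (X v)) (fun v w => Γ2 k i j (X v) (X w)) := fun k i j =>
    HasJet.comp_clm X (by rw [map_zero]; exact hΓ k i j)
  have := (HasJet.const (x := (0 : Coord m)) (v k)).add (HasJet.sum Finset.univ fun i _ =>
    HasJet.sum Finset.univ fun j _ =>
      ((hΓX k i j).mul (HasJet.const (x i))).mul (hasJet_coord_add V u j))
  unfold verticalPart
  refine this.of_eq ?_ (fun v => ?_) (fun v w => ?_)
  · simp
  · simp only [connDeriv, zero_mul, mul_zero, zero_add]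
    exact Finset.sum_congr rfl fun i _ => Finset.sum_congr rfl fun j _ => by ring
  · simp only [connDeriv, zero_mul, mul_zero, zero_add, add_zero, ← Finset.sum_add_distrib]
    exact Finset.sum_congr rfl fun i _ => Finset.sum_congr rfl fun j _ => by ring

variable (X V u Γ1) in
/-- First derivatives of `sphereMetric` at the origin. -/
def sphereMetricD1 (I J : Fin m) (v : Coord m) : ℝ :=
  (V (basisVec I)).ofLp ⬝ᵥ connDeriv Γ1 (X (basisVec J)) (X v) u
    + connDeriv Γ1 (X (basisVec I)) (X v) u ⬝ᵥ (V (basisVec J)).ofLp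

variable (X V u g2 Γ1 Γ2) in
/-- Second derivatives of `sphereMetric` at the origin. -/
def sphereMetricD2 (I J : Fin m) (v w : Coord m) : ℝ :=
  let H : Matrix (Fin n) (Fin n) ℝ := Matrix.of fun k l => g2 k l (X v) (X w)
  let θ2 : Fin m → Fin n → ℝ := fun I =>
    connDeriv (fun k i j a => Γ2 k i j a (X w)) (X (basisVec I)) (X v) u
      + connDeriv Γ1 (X (basisVec I)) (X v) (V w) + connDeriv Γ1 (X (basisVec I)) (X w) (V v)
  let F1 : Fin m → Coord m → ℝ := fun I v =>
    (V (basisVec I)).ofLp ⬝ᵥ (V v).ofLp + connDeriv Γ1 (X (basisVec I)) (X v) u ⬝ᵥ u.ofLp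
  pairing H (X (basisVec I)) (X (basisVec J))
    + (pairing H (V (basisVec I)) (V (basisVec J))
      + ((V (basisVec I)).ofLp ⬝ᵥ θ2 J
        + connDeriv Γ1 (X (basisVec I)) (X v) u ⬝ᵥ connDeriv Γ1 (X (basisVec J)) (X w) u
        + connDeriv Γ1 (X (basisVec I)) (X w) u ⬝ᵥ connDeriv Γ1 (X (basisVec J)) (X v) u
        + θ2 I ⬝ᵥ (V (basisVec J)).ofLp))
    - ((V (basisVec I)).ofLp ⬝ᵥ (V (basisVec J)).ofLp)
      * (pairing H u u + 2 * ((V v).ofLp ⬝ᵥ (V w).ofLp))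
    - (F1 I v * F1 J w + F1 I w * F1 J v)

/-- As V y is orthogonal to u, the squared length of W equals 1 to first order, so
`HasJet.inv_of_one` applies. For the same reason ⟨θ_I, W⟩ vanishes at the origin, and the last term
of the metric contributes only products of first derivatives. -/
theorem hasJet_sphereMetric
    (hG : ∀ k l, HasJet (fun x => G x k l) 0 ((1 : Matrix (Fin n) (Fin n) ℝ) k l)
      (fun _ => 0) (g2 k l))
    (hΓ : ∀ k i j, HasJet (christoffel G k i j) 0 0 (Γ1 k i j) (Γ2 k i j))
    (hu : u.ofLp ⬝ᵥ u.ofLp = 1) (hV : ∀ v, (V v).ofLp ⬝ᵥ u.ofLp = 0)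
    (I J : Fin m) :
    HasJet (fun y => sphereMetric G X V u y I J) 0
      ((X (basisVec I)).ofLp ⬝ᵥ (X (basisVec J)).ofLp
        + (V (basisVec I)).ofLp ⬝ᵥ (V (basisVec J)).ofLp)
      (sphereMetricD1 X V u Γ1 I J) (sphereMetricD2 X V u g2 Γ1 Γ2 I J) := by
  have hV' : ∀ v, u.ofLp ⬝ᵥ (V v).ofLp = 0 := fun v => by rw [dotProduct_comm, hV]
  have hW := hasJet_coord_add V u
  have hθ := fun I => hasJet_verticalPart (X := X) (V := V) (u := u) hΓ (X (basisVec I))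
    (V (basisVec I))
  have hq := (hasJet_pairing (X := X) hG hW hW).of_eq (c' := 1) (l' := fun _ => 0) (by simp [hu])
    (fun v => by change u.ofLp ⬝ᵥ (V v).ofLp + (V v).ofLp ⬝ᵥ u.ofLp = 0; simp [hV, hV'])
    (fun v w => rfl)
  have hqi := hq.inv_of_one
  have hE := hasJet_pairing (X := X) hG (hθ I) (hθ J)
  have hF := fun I => hasJet_pairing (X := X) hG (hθ I) hW
  have hX := hasJet_pairing (X := X) hG
    (fun k => HasJet.const (x := (0 : Coord m)) ((X (basisVec I)).ofLp k))
    (fun k => HasJet.const (x := (0 : Coord m)) ((X (basisVec J)).ofLp k))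
  refine ((hX.add (hE.mul hqi)).sub (((hF I).mul (hF J)).mul (hqi.mul hqi))).of_eq ?_
    (fun v => ?_) (fun v w => ?_)
  · simp [hV]
  · have h0 : ∀ a : Fin n → ℝ, (a ⬝ᵥ fun _ => (0 : ℝ)) = 0 := fun a => dotProduct_zero a
    have h1 : ∀ a : Fin n → ℝ, ((fun _ => (0 : ℝ)) ⬝ᵥ a) = 0 := fun a => zero_dotProduct a
    simp only [hV, h0, h1]
    simp [sphereMetricD1]
  · have h0 : ∀ a : Fin n → ℝ, (a ⬝ᵥ fun _ => (0 : ℝ)) = 0 := fun a => dotProduct_zero a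
    have h1 : ∀ a : Fin n → ℝ, ((fun _ => (0 : ℝ)) ⬝ᵥ a) = 0 := fun a => zero_dotProduct a
    simp only [hV, h0, h1, sphereMetricD2]
    simp only [mul_zero, zero_mul, add_zero, zero_add, mul_one, one_mul]
    have e1 : ∀ a : Fin n → ℝ, (fun k => a k) = a := fun _ => rfl
    have e2 : ∀ a b c : Fin n → ℝ, (fun k => a k + b k + c k) = a + b + c := fun _ _ _ => rfl
    simp only [e1, e2]
    rw [dotProduct_comm (V w).ofLp (V v).ofLp]
    ring

end Model

/-! ### Ricci tensor of the unit sphere bundle over a normal point -/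

section ModelRicci

variable {m n : ℕ} {ν : Type*} [Fintype ν] [DecidableEq ν]

/-- The metric components `G` are smooth and symmetric near `x`, where they agree with the identity
matrix to first order. -/
structure IsNormalAt (G : Coord n → Matrix (Fin n) (Fin n) ℝ) (x : Coord n) : Prop where
  smooth : ∀ i j, ContDiffAt ℝ ∞ (fun y => G y i j) x
  symm : ∀ᶠ y in 𝓝 x, ∀ i j, G y i j = G y j i
  eq_one : G x = 1
  fderiv_eq_zero : ∀ i j, fderiv ℝ (fun y => G y i j) x = 0

/-- `X` and `V` split the coordinates of the unit sphere bundle into coordinates of the base and,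
in terms of an orthonormal basis `B` of the orthogonal complement of `u`, of the fibre. -/
structure IsSphereFrame (X V : Coord m →L[ℝ] Coord n) (u : Coord n) (σ : Fin n ⊕ ν ≃ Fin m)
    (B : ν → Coord n) : Prop where
  X_inl : ∀ i, X (basisVec (σ (Sum.inl i))) = basisVec i
  X_inr : ∀ a, X (basisVec (σ (Sum.inr a))) = 0
  V_inl : ∀ i, V (basisVec (σ (Sum.inl i))) = 0
  V_inr : ∀ a, V (basisVec (σ (Sum.inr a))) = B a
  V_orth : ∀ v, (V v).ofLp ⬝ᵥ u.ofLp = 0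
  unit : u.ofLp ⬝ᵥ u.ofLp = 1
  orthonormal : ∀ a b, (B a).ofLp ⬝ᵥ (B b).ofLp = if a = b then 1 else 0
  parseval : ∀ x y : Fin n → ℝ,
    (x ⬝ᵥ u.ofLp) * (y ⬝ᵥ u.ofLp) + ∑ a, ((B a).ofLp ⬝ᵥ x) * ((B a).ofLp ⬝ᵥ y) = x ⬝ᵥ y

/-- The curvature endomorphism `R(∂ᵢ, ∂ⱼ)` applied to `u`. -/
def curvatureApply (G : Coord n → Matrix (Fin n) (Fin n) ℝ) (x : Coord n) (i j : Fin n)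
    (u : Fin n → ℝ) (l : Fin n) : ℝ :=
  ∑ k, riemann G l i j k x * u k

/-- The second derivatives of the components of a metric. -/
def metricD2 (G : Coord n → Matrix (Fin n) (Fin n) ℝ) (x : Coord n) (k l : Fin n)
    (v w : Coord n) : ℝ :=
  fderiv ℝ (fun y => fderiv ℝ (fun z => G z k l) y w) x v

variable {G : Coord n → Matrix (Fin n) (Fin n) ℝ} {X V : Coord m →L[ℝ] Coord n} {u : Coord n}
  {σ : Fin n ⊕ ν ≃ Fin m} {B : ν → Coord n} {x : Coord n}

namespace IsNormalAt

theorem hasJet (hG : IsNormalAt G x) (k l : Fin n) :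
    HasJet (fun y => G y k l) x ((1 : Matrix (Fin n) (Fin n) ℝ) k l) (fun _ => 0)
      (metricD2 G x k l) :=
  (hasJet_of_contDiffAt (hG.smooth k l)).of_eq (by rw [hG.eq_one])
    (fun v => by simp [hG.fderiv_eq_zero]) (fun _ _ => rfl)

theorem christoffel_eq_zero (hG : IsNormalAt G x) (k i j : Fin n) : christoffel G k i j x = 0 := by
  rw [christoffel_of_jet hG.hasJet]; simp [firstKind]

theorem contDiffAt_christoffel (hG : IsNormalAt G x) (k i j : Fin n) :
    ContDiffAt ℝ ∞ (christoffel G k i j) x :=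
  UnitTangent.contDiffAt_christoffel hG.smooth (by rw [hG.eq_one]; simp) k i j

theorem hasJet_christoffel (hG : IsNormalAt G x) (k i j : Fin n) :
    HasJet (christoffel G k i j) x 0 (fun v => fderiv ℝ (christoffel G k i j) x v)
      (fun v w => fderiv ℝ (fun y => fderiv ℝ (christoffel G k i j) y w) x v) :=
  (hasJet_of_contDiffAt (hG.contDiffAt_christoffel k i j)).of_eq (hG.christoffel_eq_zero k i j)
    (fun _ => rfl) (fun _ _ => rfl)

theorem metricD2_swap (hG : IsNormalAt G x) (k l : Fin n) (v w : Coord n) :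
    metricD2 G x k l v w = metricD2 G x k l w v :=
  (hG.hasJet k l).symm v w

theorem metricD2_symm (hG : IsNormalAt G x) (k l : Fin n) (v w : Coord n) :
    metricD2 G x k l v w = metricD2 G x l k v w :=
  ((hG.hasJet k l).d2 v w).symm.trans
    (((hG.hasJet l k).congr (hG.symm.mono fun _ hy => hy k l)).d2 v w)

theorem fderiv_christoffel (hG : IsNormalAt G x) (k i j l : Fin n) :
    fderiv ℝ (christoffel G k i j) x (basisVec l) =
      (1 / 2 : ℝ) * (metricD2 G x j k (basisVec l) (basisVec i)
        + metricD2 G x i k (basisVec l) (basisVec j)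
        - metricD2 G x i j (basisVec l) (basisVec k)) := by
  have := partialDeriv_christoffel_of_jet hG.hasJet l k i j
  simpa [partialDeriv] using this

theorem riemann_eq_metricD2 (hG : IsNormalAt G x) (l i j k : Fin n) :
    riemann G l i j k x =
      (1 / 2 : ℝ) * (metricD2 G x j l (basisVec i) (basisVec k)
        - metricD2 G x j k (basisVec i) (basisVec l)
        - metricD2 G x i l (basisVec j) (basisVec k)
        + metricD2 G x i k (basisVec j) (basisVec l)) := by
  rw [riemann_of_jet hG.hasJet (fun _ _ _ => rfl)]
  simp [firstKind]

theorem riemann_eq (hG : IsNormalAt G x) (l i j k : Fin n) :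
    riemann G l i j k x = fderiv ℝ (christoffel G l j k) x (basisVec i)
      - fderiv ℝ (christoffel G l i k) x (basisVec j) := by
  simp [riemann, hG.christoffel_eq_zero, partialDeriv]

theorem ricci_eq (hG : IsNormalAt G x) (j k : Fin n) :
    ricci G x j k = ∑ i, (1 / 2 : ℝ) * (metricD2 G x j i (basisVec i) (basisVec k)
        - metricD2 G x j k (basisVec i) (basisVec i)
        - metricD2 G x i i (basisVec j) (basisVec k)
        + metricD2 G x i k (basisVec j) (basisVec i)) := by
  simp only [ricci, hG.riemann_eq_metricD2]

end IsNormalAt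

variable (G) in
/-- `(∂ₗ Γᵢ) z` at the origin. -/
def connDir (i l : Fin n) (z : Fin n → ℝ) : Fin n → ℝ :=
  connDeriv (fun k i j v => fderiv ℝ (christoffel G k i j) 0 v) (basisVec i) (basisVec l) z

theorem connDir_apply (i l : Fin n) (z : Fin n → ℝ) (k : Fin n) :
    connDir G i l z k = ∑ j, fderiv ℝ (christoffel G k i j) 0 (basisVec l) * z j := by
  simp [connDir, connDeriv]

/-- This is the derivative in direction l of metric compatibility ∂ᵢ⟨y,z⟩ = ⟨Γᵢ y, z⟩ + ⟨y, Γᵢ z⟩,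
at a point where Γ itself vanishes. -/
theorem connDir_dotProduct_add (hG : IsNormalAt G 0) (i l : Fin n) (y z : Fin n → ℝ) :
    connDir G i l y ⬝ᵥ z + y ⬝ᵥ connDir G i l z =
      pairing (Matrix.of fun p q => metricD2 G 0 p q (basisVec i) (basisVec l)) y z := by
  simp only [dotProduct, connDir_apply, pairing, Finset.sum_mul, Finset.mul_sum, Matrix.of_apply]
  rw [Finset.sum_comm, ← Finset.sum_add_distrib]
  refine Finset.sum_congr rfl fun p _ => ?_
  rw [← Finset.sum_add_distrib]
  refine Finset.sum_congr rfl fun q _ => ?_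
  rw [hG.fderiv_christoffel, hG.fderiv_christoffel, hG.metricD2_symm q p,
    hG.metricD2_swap p q (basisVec l)]
  ring

/-- Where Γ vanishes the quadratic terms drop out and R(i,j) = ∂ᵢΓⱼ - ∂ⱼΓᵢ. -/
theorem curvatureApply_eq (hG : IsNormalAt G 0) (i j : Fin n) (y : Fin n → ℝ) :
    curvatureApply G 0 i j y = connDir G j i y - connDir G i j y := by
  ext l
  simp only [curvatureApply, hG.riemann_eq, Pi.sub_apply, connDir_apply, sub_mul,
    Finset.sum_sub_distrib]

theorem pairing_metricD2_swap (hG : IsNormalAt G 0) (i l : Fin n) (y z : Fin n → ℝ) :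
    pairing (Matrix.of fun p q => metricD2 G 0 p q (basisVec i) (basisVec l)) y z =
      pairing (Matrix.of fun p q => metricD2 G 0 p q (basisVec l) (basisVec i)) y z := by
  simp only [hG.metricD2_swap _ _ (basisVec i)]

theorem curvatureApply_dotProduct_self (hG : IsNormalAt G 0) (i j : Fin n) (y : Fin n → ℝ) :
    curvatureApply G 0 i j y ⬝ᵥ y = 0 := by
  have h1 := connDir_dotProduct_add hG i j y y
  have h2 := connDir_dotProduct_add hG j i y y
  rw [pairing_metricD2_swap hG] at h2
  rw [dotProduct_comm y] at h1 h2
  rw [curvatureApply_eq hG, sub_dotProduct]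
  linarith

/-! #### The tables of derivatives -/

variable (G X V u) in
/-- The first derivatives of `sphereMetric G X V u` at the origin. -/
def sphereD1 (I J K : Fin m) : ℝ :=
  sphereMetricD1 X V u (fun k i j v => fderiv ℝ (christoffel G k i j) 0 v) I J (basisVec K)

variable (G X V u) in
/-- The second derivatives of `sphereMetric G X V u` at the origin. -/
def sphereD2 (I J K L : Fin m) : ℝ :=
  sphereMetricD2 X V u (metricD2 G 0) (fun k i j v => fderiv ℝ (christoffel G k i j) 0 v)
    (fun k i j v w => fderiv ℝ (fun y => fderiv ℝ (christoffel G k i j) y w) 0 v) I J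
    (basisVec K) (basisVec L)

theorem connDeriv_zero_left (Γ1 : Fin n → Fin n → Fin n → Coord n → ℝ) (y : Coord n)
    (z : Fin n → ℝ) : connDeriv Γ1 0 y z = 0 := by
  ext; simp [connDeriv]

theorem connDeriv_zero_mid (x z : Fin n → ℝ) :
    connDeriv (fun k i j v => fderiv ℝ (christoffel G k i j) 0 v) x 0 z = 0 := by
  ext; simp [connDeriv]

theorem connDeriv_second_zero_mid (x z : Fin n → ℝ) (w : Coord n) :
    connDeriv (fun k i j v => fderiv ℝ (fun y => fderiv ℝ (christoffel G k i j) y w) 0 v)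
      x 0 z = 0 := by
  ext; simp [connDeriv]

theorem connDeriv_second_zero_right (x z : Fin n → ℝ) (v : Coord n) :
    connDeriv (fun k i j v => fderiv ℝ (fun y => fderiv ℝ (christoffel G k i j) y 0) 0 v)
      x v z = 0 := by
  ext; simp [connDeriv]

theorem pairing_zero_left (A : Matrix (Fin n) (Fin n) ℝ) (b : Fin n → ℝ) : pairing A 0 b = 0 := by
  simp [pairing]

theorem pairing_zero_right (A : Matrix (Fin n) (Fin n) ℝ) (b : Fin n → ℝ) :
    pairing A b 0 = 0 := by
  simp [pairing]

theorem pairing_metricD2_zero (y z : Fin n → ℝ) (v : Coord n) :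
    pairing (Matrix.of fun k l => metricD2 G 0 k l v 0) y z = 0 := by
  simp [pairing, metricD2]

theorem pairing_metricD2_zero' (y z : Fin n → ℝ) (v : Coord n) :
    pairing (Matrix.of fun k l => metricD2 G 0 k l 0 v) y z = 0 := by
  simp [pairing, metricD2]

theorem pairing_basisVec (A : Matrix (Fin n) (Fin n) ℝ) (i j : Fin n) :
    pairing A (basisVec i) (basisVec j) = A i j := by
  simp [pairing]

section Tables

variable (hF : IsSphereFrame X V u σ B)
include hF

theorem sphereD1_inl_inl (i j : Fin n) (K : Fin m) :
    sphereD1 G X V u (σ (.inl i)) (σ (.inl j)) K = 0 := by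
  simp [sphereD1, sphereMetricD1, hF.V_inl]

theorem sphereD1_inr_inr (a b : ν) (K : Fin m) :
    sphereD1 G X V u (σ (.inr a)) (σ (.inr b)) K = 0 := by
  simp [sphereD1, sphereMetricD1, hF.X_inr, connDeriv_zero_left]

theorem sphereD1_inr (I J : Fin m) (a : ν) : sphereD1 G X V u I J (σ (.inr a)) = 0 := by
  simp [sphereD1, sphereMetricD1, hF.X_inr, connDeriv_zero_mid]

theorem sphereD1_inl_inr_inl (i k : Fin n) (a : ν) :
    sphereD1 G X V u (σ (.inl i)) (σ (.inr a)) (σ (.inl k))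
      = (B a).ofLp ⬝ᵥ connDir G i k u := by
  simp [sphereD1, sphereMetricD1, hF.V_inl, hF.X_inr, hF.X_inl, hF.V_inr, connDir,
    connDeriv_zero_left, dotProduct_comm]

theorem sphereD1_inr_inl_inl (i k : Fin n) (a : ν) :
    sphereD1 G X V u (σ (.inr a)) (σ (.inl i)) (σ (.inl k))
      = (B a).ofLp ⬝ᵥ connDir G i k u := by
  simp [sphereD1, sphereMetricD1, hF.V_inl, hF.X_inr, hF.X_inl, hF.V_inr, connDir,
    connDeriv_zero_left]

/-- The normalisation of W removes the u-components of the connection terms from their inner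
products; by `parseval` what is left is a sum over the frame `B` of u⊥. -/
theorem sphereD2_inl (i j k l : Fin n) :
    sphereD2 G X V u (σ (.inl i)) (σ (.inl j)) (σ (.inl k)) (σ (.inl l)) =
      metricD2 G 0 i j (basisVec k) (basisVec l)
        + ∑ a, (((B a).ofLp ⬝ᵥ connDir G i k u) * ((B a).ofLp ⬝ᵥ connDir G j l u)
          + ((B a).ofLp ⬝ᵥ connDir G i l u) * ((B a).ofLp ⬝ᵥ connDir G j k u)) := by
  rw [Finset.sum_add_distrib]
  have h1 := hF.parseval (connDir G i k u) (connDir G j l u)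
  have h2 := hF.parseval (connDir G i l u) (connDir G j k u)
  simp only [sphereD2, sphereMetricD2, hF.V_inl, hF.X_inl, pairing_basisVec, Matrix.of_apply,
    WithLp.ofLp_zero, zero_dotProduct, dotProduct_zero, zero_mul, pairing_zero_right, ← connDir.eq_def]
  linarith

theorem sphereD2_inl_inr_inr_inl (j k : Fin n) (a : ν) :
    sphereD2 G X V u (σ (.inl j)) (σ (.inr a)) (σ (.inr a)) (σ (.inl k)) =
      (B a).ofLp ⬝ᵥ connDir G j k (B a) - u.ofLp ⬝ᵥ connDir G j k u := by
  simp only [sphereD2, sphereMetricD2, hF.V_inl, hF.X_inl, hF.V_inr, hF.X_inr,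
    WithLp.ofLp_zero, zero_dotProduct, dotProduct_zero, zero_mul, pairing_zero_right,
    pairing_zero_left, connDeriv_zero_left, connDeriv_zero_mid, connDeriv_second_zero_mid,
    hF.orthonormal, ← connDir.eq_def, dotProduct_comm _ (B a).ofLp, dotProduct_comm _ u.ofLp,
    pairing_metricD2_zero']
  simp

theorem sphereD2_inr_inl_inl_inr (j k : Fin n) (a : ν) :
    sphereD2 G X V u (σ (.inr a)) (σ (.inl k)) (σ (.inl j)) (σ (.inr a)) =
      (B a).ofLp ⬝ᵥ connDir G k j (B a) - u.ofLp ⬝ᵥ connDir G k j u := by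
  simp only [sphereD2, sphereMetricD2, hF.V_inl, hF.X_inl, hF.V_inr, hF.X_inr,
    WithLp.ofLp_zero, zero_dotProduct, dotProduct_zero, zero_mul, pairing_zero_right,
    pairing_zero_left, connDeriv_zero_left, connDeriv_zero_mid, connDeriv_second_zero_right,
    hF.orthonormal, ← connDir.eq_def, dotProduct_comm _ (B a).ofLp, dotProduct_comm _ u.ofLp,
    pairing_metricD2_zero]
  simp

theorem sphereD2_inl_inl_inr_inr (j k : Fin n) (a b : ν) :
    sphereD2 G X V u (σ (.inl j)) (σ (.inl k)) (σ (.inr a)) (σ (.inr b)) = 0 := by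
  simp only [sphereD2, sphereMetricD2, hF.V_inl, hF.X_inl, hF.V_inr, hF.X_inr,
    WithLp.ofLp_zero, zero_dotProduct, dotProduct_zero, zero_mul, pairing_zero_right,
    connDeriv_zero_mid, pairing_metricD2_zero]
  simp

theorem sphereD2_inr_inr_inl_inl (j k : Fin n) (a : ν) :
    sphereD2 G X V u (σ (.inr a)) (σ (.inr a)) (σ (.inl j)) (σ (.inl k)) =
      pairing (Matrix.of fun p q => metricD2 G 0 p q (basisVec j) (basisVec k)) (B a) (B a)
      - pairing (Matrix.of fun p q => metricD2 G 0 p q (basisVec j) (basisVec k)) u u := by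
  simp only [sphereD2, sphereMetricD2, hF.V_inl, hF.X_inl, hF.V_inr, hF.X_inr,
    WithLp.ofLp_zero, zero_dotProduct, dotProduct_zero, pairing_zero_right,
    connDeriv_zero_left, hF.orthonormal]
  simp

/-- In the fibre the parametrization is central projection of the unit sphere, with metric δ_ab / (1
+ |y|²) - y_a y_b / (1 + |y|²)². These are its second derivatives at the origin. -/
theorem sphereD2_inr (a b c d : ν) :
    sphereD2 G X V u (σ (.inr a)) (σ (.inr b)) (σ (.inr c)) (σ (.inr d)) =
      - (if a = b then 1 else 0) * (2 * (if c = d then 1 else 0))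
      - ((if a = c then 1 else 0) * (if b = d then 1 else 0)
        + (if a = d then 1 else 0) * (if b = c then 1 else 0)) := by
  simp only [sphereD2, sphereMetricD2, hF.V_inr, hF.X_inr, pairing_metricD2_zero,
    WithLp.ofLp_zero, zero_dotProduct, dotProduct_zero,
    connDeriv_zero_left, hF.orthonormal]
  split_ifs <;> simp

end Tables

theorem sphereMetric_hasJet (hG : IsNormalAt G 0) (hF : IsSphereFrame X V u σ B) (I J : Fin m) :
    HasJet (fun y => sphereMetric G X V u y I J) 0 ((1 : Matrix (Fin m) (Fin m) ℝ) I J)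
      (sphereMetricD1 X V u (fun k i j v => fderiv ℝ (christoffel G k i j) 0 v) I J)
      (sphereMetricD2 X V u (metricD2 G 0) (fun k i j v => fderiv ℝ (christoffel G k i j) 0 v)
    (fun k i j v w => fderiv ℝ (fun y => fderiv ℝ (christoffel G k i j) y w) 0 v) I J) := by
  refine (hasJet_sphereMetric hG.hasJet hG.hasJet_christoffel hF.unit hF.V_orth I J).of_eq ?_
    (fun _ => rfl) (fun _ _ => rfl)
  obtain ⟨s, rfl⟩ := σ.surjective I
  obtain ⟨t, rfl⟩ := σ.surjective J
  rcases s with i | a <;> rcases t with j | b <;>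
    simp [hF.X_inl, hF.X_inr, hF.V_inl, hF.V_inr, hF.orthonormal, Matrix.one_apply,
      Pi.single_apply, eq_comm]

theorem ricci_sphereMetric (hG : IsNormalAt G 0) (hF : IsSphereFrame X V u σ B) (J K : Fin m) :
    ricci (sphereMetric G X V u) 0 J K = ∑ s : Fin n ⊕ ν,
      ((1 / 2 : ℝ) * (sphereD2 G X V u J (σ s) (σ s) K - sphereD2 G X V u J K (σ s) (σ s)
        - sphereD2 G X V u (σ s) (σ s) J K + sphereD2 G X V u (σ s) K J (σ s))
      + ∑ t : Fin n ⊕ ν, (firstKind (sphereD1 G X V u) (σ s) K (σ t)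
            * firstKind (sphereD1 G X V u) J (σ s) (σ t)
          - firstKind (sphereD1 G X V u) J K (σ t)
            * firstKind (sphereD1 G X V u) (σ s) (σ s) (σ t))) := by
  rw [ricci_of_jet (sphereMetric_hasJet hG hF)]
  · rw [← σ.sum_comp]
    refine Finset.sum_congr rfl fun s _ => ?_
    rw [← σ.sum_comp]
    rfl
  · intro I J v
    simp only [sphereMetricD1]
    rw [add_comm, dotProduct_comm, dotProduct_comm (connDeriv _ _ _ _)]

/-- The vertical components of the Ricci tensor of the unit sphere bundle. -/
theorem ricci_sphereMetric_inr (hG : IsNormalAt G 0) (hF : IsSphereFrame X V u σ B) (a : ν) :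
    ricci (sphereMetric G X V u) 0 (σ (.inr a)) (σ (.inr a)) =
      (Fintype.card ν - 1) + (1 / 4 : ℝ) *
        ∑ i, ∑ j, ((B a).ofLp ⬝ᵥ curvatureApply G 0 i j u) ^ 2 := by
  rw [ricci_sphereMetric hG hF]
  simp only [Fintype.sum_sum_type, firstKind, sphereD1_inl_inl hF, sphereD1_inr_inr hF,
    sphereD1_inr hF, sphereD1_inl_inr_inl hF, sphereD1_inr_inl_inl hF,
    sphereD2_inl_inr_inr_inl hF, sphereD2_inr_inl_inl_inr hF, sphereD2_inl_inl_inr_inr hF,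
    sphereD2_inr_inr_inl_inl hF, sphereD2_inr hF]
  -- With this the second-derivative terms carrying a horizontal index cancel, and only squares of
  -- first-kind symbols survive; these are the squares of the curvature components.
  have key : ∀ i, (B a).ofLp ⬝ᵥ connDir G i i (B a) - u.ofLp ⬝ᵥ connDir G i i u
      = (1 / 2 : ℝ) * (pairing (Matrix.of fun p q => metricD2 G 0 p q (basisVec i) (basisVec i))
        (B a) (B a) - pairing (Matrix.of fun p q => metricD2 G 0 p q (basisVec i) (basisVec i))
        u u) := by
    intro i
    rw [← connDir_dotProduct_add hG, ← connDir_dotProduct_add hG, dotProduct_comm (connDir _ _ _ _),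
      dotProduct_comm (connDir _ _ _ _)]
    ring
  simp only [key, curvatureApply_eq hG, dotProduct_sub]
  simp only [mul_zero, zero_mul, add_zero, sub_zero, zero_add, sub_self, Finset.sum_const_zero]
  rw [add_comm]
  congr 1
  -- The fibre directions contribute the Ricci curvature of the round unit sphere: one for each
  -- frame vector other than `a`.
  · trans ∑ b : ν, (1 - if a = b then (1 : ℝ) else 0)
    · refine Finset.sum_congr rfl fun b _ => ?_
      by_cases hab : a = b
      · subst hab; simp; norm_num
      · simp [hab, Ne.symm hab]; norm_num
    · simp
  · rw [Finset.mul_sum]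
    refine Finset.sum_congr rfl fun i _ => ?_
    rw [Finset.mul_sum, add_eq_right.2 (by ring)]
    exact Finset.sum_congr rfl fun j _ => by ring

/-- The horizontal components of the Ricci tensor of the unit sphere bundle. -/
theorem ricci_sphereMetric_inl (hG : IsNormalAt G 0) (hF : IsSphereFrame X V u σ B)
    (j k : Fin n) :
    ricci (sphereMetric G X V u) 0 (σ (.inl j)) (σ (.inl k)) =
      ricci G 0 j k - (1 / 2 : ℝ) *
        ∑ i, curvatureApply G 0 j i u ⬝ᵥ curvatureApply G 0 k i u := by
  rw [ricci_sphereMetric hG hF, hG.ricci_eq]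
  simp only [Fintype.sum_sum_type, firstKind, sphereD1_inl_inl hF, sphereD1_inr_inr hF,
    sphereD1_inr hF, sphereD1_inl_inr_inl hF, sphereD1_inr_inl_inl hF, sphereD2_inl hF,
    sphereD2_inl_inr_inr_inl hF, sphereD2_inr_inl_inl_inr hF, sphereD2_inl_inl_inr_inr hF,
    sphereD2_inr_inr_inl_inl hF]
  -- R(j,i)u is orthogonal to u, so its inner products are seen by the vertical frame `B` alone.
  have hpar : ∀ i, curvatureApply G 0 j i u ⬝ᵥ curvatureApply G 0 k i u =
      ∑ a, ((B a).ofLp ⬝ᵥ connDir G i j u - (B a).ofLp ⬝ᵥ connDir G j i u)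
        * ((B a).ofLp ⬝ᵥ connDir G i k u - (B a).ofLp ⬝ᵥ connDir G k i u) := by
    intro i
    rw [← hF.parseval, curvatureApply_dotProduct_self hG, zero_mul, zero_add]
    simp only [curvatureApply_eq hG, dotProduct_sub]
  have hz : ∀ y : Fin n → ℝ, y ⬝ᵥ connDir G j k y + y ⬝ᵥ connDir G k j y =
      pairing (Matrix.of fun p q => metricD2 G 0 p q (basisVec j) (basisVec k)) y y := by
    intro y
    have h1 := connDir_dotProduct_add hG j k y y
    have h2 := connDir_dotProduct_add hG k j y y
    rw [pairing_metricD2_swap hG k j] at h2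
    rw [dotProduct_comm (connDir _ _ _ _)] at h1 h2
    linarith
  simp only [hpar, ← hz]
  simp only [mul_zero, add_zero, sub_zero, zero_add, sub_self, Finset.sum_const_zero]
  -- Second-derivative terms with a fibre index sum to zero by `hz`; products of first-kind symbols
  -- with a fibre index are regrouped according to the base index.
  rw [Finset.sum_add_distrib (s := (Finset.univ : Finset ν)),
    Finset.sum_comm (s := (Finset.univ : Finset ν)),
    Finset.sum_eq_zero (s := (Finset.univ : Finset ν)) (fun a _ => by ring), zero_add,
    ← Finset.sum_add_distrib, Finset.mul_sum, ← Finset.sum_sub_distrib]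
  refine Finset.sum_congr rfl fun i _ => ?_
  simp only [Finset.sum_add_distrib, Finset.sum_sub_distrib, Finset.mul_sum, mul_add, mul_sub,
    sub_mul, add_mul]
  simp only [← Finset.sum_add_distrib, ← Finset.sum_sub_distrib]
  have aux : ∀ (a b c d : ℝ) (A B C D E F H : ν → ℝ),
      (∀ x, A x - B x - C x + D x + E x + F x = - H x) →
      a + ∑ x, A x - (b + ∑ x, B x) - (c + ∑ x, C x) + (d + ∑ x, D x) + ∑ x, E x + ∑ x, F x
        = a - b - c + d - ∑ x, H x := by
    intro a b c d A B C D E F H h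
    have := Finset.sum_congr (rfl : (Finset.univ : Finset ν) = _) fun x _ => h x
    simp only [Finset.sum_add_distrib, Finset.sum_sub_distrib, Finset.sum_neg_distrib] at this
    linarith
  exact aux _ _ _ _ _ _ _ _ _ _ _ fun x => by ring

end ModelRicci

/-! ### Algebraic consequences of the `η`-Einstein condition at a point -/

section Algebra

variable {n : ℕ}

/-- The symmetries of a curvature tensor `R l i j k = ⟨R(eᵢ, eⱼ)eₖ, eₗ⟩`. -/
structure IsCurvatureTensor (R : Fin n → Fin n → Fin n → Fin n → ℝ) : Prop where
  skew : ∀ l i j k, R l i j k = - R l j i k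
  skew' : ∀ l i j k, R l i j k = - R k i j l
  bianchi : ∀ l i j k, R l i j k + R l j k i + R l k i j = 0
  pair : ∀ l i j k, R l i j k = R j k l i

theorem IsNormalAt.isCurvatureTensor {G : Coord n → Matrix (Fin n) (Fin n) ℝ} {x : Coord n}
    (hG : IsNormalAt G x) : IsCurvatureTensor (fun l i j k => riemann G l i j k x) where
  skew l i j k := by
    simp only [hG.riemann_eq_metricD2]
    rw [hG.metricD2_swap j l, hG.metricD2_swap j k, hG.metricD2_swap i l, hG.metricD2_swap i k]
    rw [hG.metricD2_swap j l, hG.metricD2_swap j k, hG.metricD2_swap i l, hG.metricD2_swap i k]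
    ring
  skew' l i j k := by
    simp only [hG.riemann_eq_metricD2]
    ring
  bianchi l i j k := by
    simp only [hG.riemann_eq_metricD2]
    rw [hG.metricD2_symm k j, hG.metricD2_symm j i, hG.metricD2_symm k i,
      hG.metricD2_swap j l (basisVec k), hG.metricD2_swap k l (basisVec j),
      hG.metricD2_swap i l (basisVec k)]
    ring
  pair l i j k := by
    simp only [hG.riemann_eq_metricD2]
    rw [hG.metricD2_symm l j, hG.metricD2_symm l i, hG.metricD2_symm k j, hG.metricD2_symm k i,
      hG.metricD2_swap j l (basisVec i), hG.metricD2_swap j k (basisVec i),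
      hG.metricD2_swap i l (basisVec j), hG.metricD2_swap i k (basisVec j)]
    ring

theorem exists_unit_orthogonal {u v : Fin n → ℝ}
    (h : Module.finrank ℝ (Submodule.span ℝ {WithLp.toLp 2 u, WithLp.toLp 2 v} :
      Submodule ℝ (Coord n)) < n) :
    ∃ X : Fin n → ℝ, X ⬝ᵥ X = 1 ∧ X ⬝ᵥ u = 0 ∧ X ⬝ᵥ v = 0 := by
  set K : Submodule ℝ (Coord n) := Submodule.span ℝ {WithLp.toLp 2 u, WithLp.toLp 2 v} with hK
  have hne : Kᗮ ≠ ⊥ := by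
    intro h0
    have := K.finrank_add_finrank_orthogonal
    rw [h0, finrank_bot, finrank_euclideanSpace_fin] at this
    omega
  obtain ⟨x, hx, hx0⟩ := Submodule.exists_mem_ne_zero_of_ne_bot hne
  have hxn : ‖x‖ ≠ 0 := norm_ne_zero_iff.2 hx0
  have hnorm : x.ofLp ⬝ᵥ x.ofLp = ‖x‖ ^ 2 := by
    rw [EuclideanSpace.real_norm_sq_eq]; simp [dotProduct, sq]
  have horth : ∀ w : Fin n → ℝ, WithLp.toLp 2 w ∈ K → x.ofLp ⬝ᵥ w = 0 := by
    intro w hw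
    have := (Submodule.mem_orthogonal K x).1 hx _ hw
    simpa [PiLp.inner_apply, dotProduct] using this
  refine ⟨‖x‖⁻¹ • x.ofLp, ?_, ?_, ?_⟩
  · rw [smul_dotProduct, dotProduct_smul, hnorm, smul_eq_mul, smul_eq_mul]; field_simp
  · rw [smul_dotProduct, horth u (Submodule.subset_span (by simp)), smul_zero]
  · rw [smul_dotProduct, horth v (Submodule.subset_span (by simp)), smul_zero]

theorem exists_orthonormal_frame (hn : 2 ≤ n) {u X : Fin n → ℝ}
    (hu : u ⬝ᵥ u = 1) (hX : X ⬝ᵥ X = 1) (hXu : X ⬝ᵥ u = 0) :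
    ∃ B : Fin (n - 1) → Fin n → ℝ, (∃ a, B a = X) ∧ (∀ a, B a ⬝ᵥ u = 0) ∧
      (∀ a b, B a ⬝ᵥ B b = if a = b then 1 else 0) ∧
      ∀ x y, (x ⬝ᵥ u) * (y ⬝ᵥ u) + ∑ a, (B a ⬝ᵥ x) * (B a ⬝ᵥ y) = x ⬝ᵥ y := by
  classical
  have hin : ∀ x y : Coord n, inner ℝ x y = x.ofLp ⬝ᵥ y.ofLp := fun x y => by
    simp [PiLp.inner_apply, dotProduct, mul_comm]
  let a0 : Fin (n - 1) := ⟨0, by omega⟩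
  -- An orthonormal basis indexed by `Option (Fin (n - 1))`: `none` carries u, and `some a0` carries
  -- the prescribed vector X.
  let v : Option (Fin (n - 1)) → Coord n := fun o => o.elim (WithLp.toLp 2 u) fun _ =>
    WithLp.toLp 2 X
  have hv : Orthonormal ℝ (({none, some a0} : Set (Option (Fin (n - 1)))).domRestrict v) := by
    rw [orthonormal_iff_ite]
    rintro ⟨i, rfl | rfl⟩ ⟨j, rfl | rfl⟩ <;> rw [hin] <;>
      simp [Set.domRestrict, v, hu, hX, hXu, dotProduct_comm u, Subtype.ext_iff]
  obtain ⟨b, hb⟩ := hv.exists_orthonormalBasis_extension_of_card_eq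
    (by rw [finrank_euclideanSpace_fin]; simp; omega)
  have hb0 : b none = WithLp.toLp 2 u := hb none (by simp)
  have hb1 : b (some a0) = WithLp.toLp 2 X := hb (some a0) (by simp)
  have ho := fun i j => orthonormal_iff_ite.1 b.orthonormal i j
  refine ⟨fun a => (b (some a)).ofLp, ⟨a0, by simp [hb1]⟩, fun a => ?_, fun a c => ?_,
    fun x y => ?_⟩
  · have := ho (some a) none
    rw [hb0, hin] at this
    simpa using this
  · have := ho (some a) (some c)
    rw [hin] at this
    simpa using this
  · have := b.sum_inner_mul_inner (WithLp.toLp 2 x) (WithLp.toLp 2 y)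
    rw [Fintype.sum_option, hb0] at this
    simp only [hin] at this
    rw [← this, dotProduct_comm u y]
    congr 1
    exact Finset.sum_congr rfl fun a _ => by rw [dotProduct_comm x]

/-- Coefficients of a quadratic form which is constant on the unit sphere. -/
theorem quadratic_coeff {T : Fin n → Fin n → ℝ} {c : ℝ}
    (h : ∀ u : Fin n → ℝ, u ⬝ᵥ u = 1 → ∑ p, ∑ q, T p q * (u p * u q) = c) (p q : Fin n) :
    T p q + T q p = if p = q then 2 * c else 0 := by
  -- Homogeneity extends the identity from the sphere to all vectors; evaluation at e_p and at e_p +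
  -- e_q then gives the coefficients.
  have hom : ∀ u : Fin n → ℝ, ∑ p, ∑ q, T p q * (u p * u q) = c * (u ⬝ᵥ u) := by
    intro u
    by_cases hu : u ⬝ᵥ u = 0
    · rw [dotProduct_self_eq_zero.1 hu]; simp
    · have hpos : 0 < u ⬝ᵥ u := lt_of_le_of_ne
        (Finset.sum_nonneg fun i _ => mul_self_nonneg _) (Ne.symm hu)
      set s := √(u ⬝ᵥ u) with hs
      have hs2 : s * s = u ⬝ᵥ u := Real.mul_self_sqrt hpos.le
      have hs0 : s ≠ 0 := (Real.sqrt_pos.2 hpos).ne'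
      have := h (s⁻¹ • u) (by
        rw [smul_dotProduct, dotProduct_smul, ← hs2, smul_eq_mul, smul_eq_mul]; field_simp)
      rw [← hs2, ← this, Finset.sum_mul]
      refine Finset.sum_congr rfl fun p _ => ?_
      rw [Finset.sum_mul]
      refine Finset.sum_congr rfl fun q _ => ?_
      simp only [Pi.smul_apply, smul_eq_mul]
      field_simp
  have hd : ∀ p, T p p = c := fun p => by simpa [Pi.single_apply] using hom (Pi.single p 1)
  split_ifs with hpq
  · subst hpq; rw [hd]; ring
  · have := hom (Pi.single p 1 + Pi.single q 1)
    simp [Pi.single_apply, mul_add, Finset.sum_add_distrib, hd, hpq, Ne.symm hpq] at this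
    linarith

section Pointwise

variable {R : Fin n → Fin n → Fin n → Fin n → ℝ} {α β : (Fin n → ℝ) → ℝ}

/-- The endomorphism `R(eᵢ, eⱼ)` applied to `u`. -/
def tensorApply (R : Fin n → Fin n → Fin n → Fin n → ℝ) (i j : Fin n) (u : Fin n → ℝ)
    (l : Fin n) : ℝ :=
  ∑ k, R l i j k * u k

theorem tensorApply_dotProduct (hR : IsCurvatureTensor R) (i j : Fin n) (u v : Fin n → ℝ) :
    v ⬝ᵥ tensorApply R i j u = - (u ⬝ᵥ tensorApply R i j v) := by
  simp only [dotProduct, tensorApply, Finset.mul_sum]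
  rw [Finset.sum_comm, ← Finset.sum_neg_distrib]
  refine Finset.sum_congr rfl fun k _ => ?_
  rw [← Finset.sum_neg_distrib]
  refine Finset.sum_congr rfl fun l _ => ?_
  rw [hR.skew' l]; ring

/-- The sum in `h1` is symmetric in u and X, because R(i,j) is skew; hence `α` takes equal values at
orthogonal unit vectors. For n ≥ 3 any two unit vectors have a common unit normal. In the plane this
fails, and `α` is computed directly. -/
theorem alpha_const (hn : 2 ≤ n) (hR : IsCurvatureTensor R)
    (h1 : ∀ u X : Fin n → ℝ, u ⬝ᵥ u = 1 → X ⬝ᵥ X = 1 → X ⬝ᵥ u = 0 →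
      ∑ i, ∑ j, (X ⬝ᵥ tensorApply R i j u) ^ 2 = α u - 4 * (n - 2))
    (u v : Fin n → ℝ) (hu : u ⬝ᵥ u = 1) (hv : v ⬝ᵥ v = 1) : α u = α v := by
  rcases hn.lt_or_eq with hn | hn
  · obtain ⟨X, hX, hXu, hXv⟩ := exists_unit_orthogonal (u := u) (v := v)
      (lt_of_le_of_lt (by
        have := finrank_span_finset_le_card (R := ℝ)
          ({WithLp.toLp 2 u, WithLp.toLp 2 v} : Finset (Coord n))
        rw [Finset.coe_pair] at this
        exact this.trans Finset.card_le_two) hn)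
    have key : ∀ w, w ⬝ᵥ w = 1 → X ⬝ᵥ w = 0 → α w = α X := by
      intro w hw hXw
      have e1 := h1 w X hw hX hXw
      have e2 := h1 X w hX hw (by rw [dotProduct_comm, hXw])
      simp only [tensorApply_dotProduct hR _ _ w X, neg_sq] at e1
      linarith
    rw [key u hu hXu, key v hv hXv]
  · subst hn
    have key : ∀ w : Fin 2 → ℝ, w ⬝ᵥ w = 1 → α w = ∑ i, ∑ j, (R 0 i j 1) ^ 2 := by
      intro w hw
      -- The unit normal is `w` turned by a right angle; as R(i,j) is a skew 2 × 2 matrix, its entry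
      -- between the two does not depend on `w`.
      have e := h1 w ![- w 1, w 0] hw (by simp [dotProduct, Fin.sum_univ_two] at hw ⊢; linarith)
        (by simp [dotProduct, Fin.sum_univ_two]; ring)
      have h00 : ∀ i j, R 0 i j 0 = 0 := fun i j => by linarith [hR.skew' 0 i j 0]
      have h11 : ∀ i j, R 1 i j 1 = 0 := fun i j => by linarith [hR.skew' 1 i j 1]
      have h10 : ∀ i j, R 1 i j 0 = - R 0 i j 1 := fun i j => hR.skew' 1 i j 0
      have : ∀ i j, (![- w 1, w 0] ⬝ᵥ tensorApply R i j w) ^ 2 = (R 0 i j 1) ^ 2 := by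
        intro i j
        have : ![- w 1, w 0] ⬝ᵥ tensorApply R i j w = - R 0 i j 1 * (w ⬝ᵥ w) := by
          simp [dotProduct, tensorApply, Fin.sum_univ_two, h00, h11, h10]; ring
        rw [this, hw]; ring
      simp only [this] at e
      rw [e]; push_cast; ring
    rw [key u hu, key v hv]

/-- Add `h1` over an orthonormal basis of u⊥, which has n - 1 elements; R(i,j)u has no component
along u. -/
theorem sum_sq_of_trace (hn : 2 ≤ n) (hR : IsCurvatureTensor R) {c : ℝ}
    (h1 : ∀ u X : Fin n → ℝ, u ⬝ᵥ u = 1 → X ⬝ᵥ X = 1 → X ⬝ᵥ u = 0 →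
      ∑ i, ∑ j, (X ⬝ᵥ tensorApply R i j u) ^ 2 = c)
    (u : Fin n → ℝ) (hu : u ⬝ᵥ u = 1) :
    ∑ i, ∑ j, tensorApply R i j u ⬝ᵥ tensorApply R i j u = (n - 1) * c := by
  obtain ⟨X, hX, hXu, -⟩ := exists_unit_orthogonal (u := u) (v := u)
    (lt_of_le_of_lt (by
      have := finrank_span_finset_le_card (R := ℝ) ({WithLp.toLp 2 u} : Finset (Coord n))
      rw [Finset.coe_singleton] at this
      rw [Set.pair_eq_singleton]
      exact this.trans (by simp)) (show 1 < n by omega))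
  obtain ⟨B, -, hBu, hB, hpar⟩ := exists_orthonormal_frame hn hu hX hXu
  have h0 : ∀ i j, tensorApply R i j u ⬝ᵥ u = 0 := fun i j => by
    have := tensorApply_dotProduct hR i j u u
    rw [dotProduct_comm]; linarith
  have : ∀ i j, tensorApply R i j u ⬝ᵥ tensorApply R i j u
      = ∑ a, (B a ⬝ᵥ tensorApply R i j u) ^ 2 := fun i j => by
    rw [← hpar, h0]; simp [sq]
  simp only [this]
  have h3 : ∑ a : Fin (n - 1), ∑ i, ∑ j, (B a ⬝ᵥ tensorApply R i j u) ^ 2 = (n - 1) * c := by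
    rw [Finset.sum_congr rfl fun a _ => h1 u (B a) hu (by simp [hB]) (hBu a)]
    simp [Nat.cast_sub (show 1 ≤ n by omega)]
  rw [← h3, Finset.sum_comm]
  simp only [Finset.sum_comm (s := (Finset.univ : Finset (Fin (n - 1))))]
  rw [Finset.sum_comm]

theorem sum_rotate {ι κ μ : Type*} [Fintype ι] [Fintype κ] [Fintype μ] (f : ι → κ → μ → ℝ) :
    ∑ p, ∑ q, ∑ i, f p q i = ∑ i, ∑ p, ∑ q, f p q i := by
  rw [Finset.sum_congr rfl fun p _ => Finset.sum_comm, Finset.sum_comm]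

/-- The polarisation of `sum_sq_of_trace`. -/
theorem sum_sq_coeff (hn : 2 ≤ n) (hR : IsCurvatureTensor R) {c : ℝ}
    (h1 : ∀ u X : Fin n → ℝ, u ⬝ᵥ u = 1 → X ⬝ᵥ X = 1 → X ⬝ᵥ u = 0 →
      ∑ i, ∑ j, (X ⬝ᵥ tensorApply R i j u) ^ 2 = c) (p q : Fin n) :
    ∑ i, ∑ j, ∑ l, R l i j p * R l i j q = if p = q then (n - 1) * c else 0 := by
  have := quadratic_coeff (T := fun p q => ∑ i, ∑ j, ∑ l, R l i j p * R l i j q)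
    (c := (n - 1) * c) (fun u hu => ?_) p q
  · have hs : ∑ i, ∑ j, ∑ l, R l i j q * R l i j p = ∑ i, ∑ j, ∑ l, R l i j p * R l i j q := by
      simp only [mul_comm]
    simp only [hs] at this
    split_ifs at this ⊢ <;> linarith
  · rw [← sum_sq_of_trace hn hR h1 u hu]
    simp only [dotProduct, tensorApply, Finset.sum_mul, Finset.mul_sum]
    rw [sum_rotate]
    refine Finset.sum_congr rfl fun i _ => ?_
    rw [sum_rotate]
    refine Finset.sum_congr rfl fun j _ => ?_
    rw [sum_rotate]
    refine Finset.sum_congr rfl fun l _ => ?_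
    rw [Finset.sum_comm]
    exact Finset.sum_congr rfl fun p _ => Finset.sum_congr rfl fun q _ => by ring

/-- Multiply the first Bianchi identity by R l i j k and sum. It reduces the mixed quadratic
contraction to the full norm of the curvature. -/
theorem sum_sq_swap (hR : IsCurvatureTensor R) :
    ∑ l, ∑ i, ∑ j, ∑ k, R l i j k * R l i j k
      = 2 * ∑ l, ∑ i, ∑ j, ∑ k, R l j i k * R l k i j := by
  rw [Finset.mul_sum]
  refine Finset.sum_congr rfl fun l _ => ?_
  have h : ∀ i j k, R l i j k * R l i j k = R l i j k * R l k j i + R l j i k * R l k i j := by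
    intro i j k
    have h1 := hR.bianchi l i j k
    have h2 := hR.skew l j k i
    have h3 := hR.skew l i j k
    have : R l i j k = R l k j i - R l k i j := by linarith
    have h4 : R l j i k = - R l i j k := by linarith
    rw [h4]
    linear_combination R l i j k * this
  simp only [h, Finset.sum_add_distrib]
  rw [two_mul, Finset.sum_comm]

/-- Once `α` and `β` are constants a and b on the sphere, `h2` polarises to an identity with four
free indices. Its trace over p = q gives the Einstein condition and the first scalar relation; its
trace over j = p, k = q gives the second. Every quadratic curvature term that occurs is known, from
the Ricci tensor or from `sum_sq_coeff`. -/
theorem eta_einstein_algebra (hn : 2 ≤ n) (hR : IsCurvatureTensor R)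
    (h1 : ∀ u X : Fin n → ℝ, u ⬝ᵥ u = 1 → X ⬝ᵥ X = 1 → X ⬝ᵥ u = 0 →
      ∑ i, ∑ j, (X ⬝ᵥ tensorApply R i j u) ^ 2 = α u - 4 * (n - 2))
    (h2 : ∀ u : Fin n → ℝ, u ⬝ᵥ u = 1 → ∀ j k,
      ∑ i, R i i j k - (1 / 2 : ℝ) * ∑ i, tensorApply R j i u ⬝ᵥ tensorApply R k i u =
        α u / 4 * (if j = k then 1 else 0) + β u / 4 * (u j * u k)) :
    ∃ lam : ℝ, (∀ j k, ∑ i, R i i j k = if j = k then lam else 0) ∧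
      (n = 2 → lam ^ 2 = lam) ∧
      ∀ u : Fin n → ℝ, u ⬝ᵥ u = 1 →
        (3 * n - 2) * α u + β u = 4 * n * lam + 8 * (n - 1) * (n - 2) ∧
        (n + 1) * (α u + β u) = 8 * lam - 2 * lam ^ 2 + 4 * (n - 1) * (n - 2) := by
  have hn0 : (n : ℝ) ≠ 0 := by positivity
  obtain ⟨u0, hu0⟩ : ∃ u : Fin n → ℝ, u ⬝ᵥ u = 1 :=
    ⟨Pi.single ⟨0, by omega⟩ 1, by simp⟩
  obtain ⟨a, ha⟩ : ∃ a, ∀ u : Fin n → ℝ, u ⬝ᵥ u = 1 → α u = a :=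
    ⟨α u0, fun u hu => alpha_const hn hR h1 u u0 hu hu0⟩
  have h1' : ∀ u X : Fin n → ℝ, u ⬝ᵥ u = 1 → X ⬝ᵥ X = 1 → X ⬝ᵥ u = 0 →
      ∑ i, ∑ j, (X ⬝ᵥ tensorApply R i j u) ^ 2 = a - 4 * (n - 2) := fun u X hu hX hXu => by
    rw [← ha u hu]; exact h1 u X hu hX hXu
  have hT := sum_sq_coeff hn hR h1'
  set c : ℝ := (n - 1) * (a - 4 * (n - 2)) with hc
  -- Pair symmetry moves the free indices into the last slot, where `hT` evaluates the contraction.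
  have hpair : ∀ j k, ∑ i, ∑ l, ∑ m, R l j i m * R l k i m = if j = k then c else 0 := by
    intro j k
    rw [← hT j k, sum_rotate]
    refine Finset.sum_congr rfl fun m _ => ?_
    rw [Finset.sum_comm]
    refine Finset.sum_congr rfl fun l _ => Finset.sum_congr rfl fun i _ => ?_
    rw [hR.pair l j, hR.pair l k]
  obtain ⟨ρ, hρ⟩ : ∃ ρ : Fin n → Fin n → ℝ, ∀ j k, ∑ i, R i i j k = ρ j k := ⟨_, fun _ _ => rfl⟩
  simp only [hρ] at h2 ⊢
  -- `β` is determined by the trace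
  have hβ : ∀ u : Fin n → ℝ, u ⬝ᵥ u = 1 → β u = 4 * (∑ j, ρ j j) - 2 * c - n * a := by
    intro u hu
    have e := Finset.sum_congr (rfl : (Finset.univ : Finset (Fin n)) = _) fun j _ => h2 u hu j j
    have e2 := sum_sq_of_trace hn hR h1' u hu
    simp only [Finset.sum_sub_distrib, ← Finset.mul_sum, e2, if_true, Finset.sum_add_distrib] at e
    have e3 : ∑ i, u i * u i = 1 := hu
    simp [e3, ha u hu] at e
    rw [hc]; linarith
  obtain ⟨b, hb⟩ : ∃ b, ∀ u : Fin n → ℝ, u ⬝ᵥ u = 1 → β u = b := ⟨_, hβ⟩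
  -- The polarised horizontal identity; terms not symmetric in p and q appear with both orders.
  have hpol : ∀ j k p q, 2 * ρ j k * (if p = q then 1 else 0)
      - (1 / 2 : ℝ) * (∑ i, ∑ l, R l j i p * R l k i q + ∑ i, ∑ l, R l j i q * R l k i p)
      - b / 4 * ((if j = p then 1 else 0) * (if k = q then 1 else 0)
        + (if j = q then 1 else 0) * (if k = p then 1 else 0))
      = if p = q then a / 2 * (if j = k then 1 else 0) else 0 := by
    intro j k p q
    have := quadratic_coeff (T := fun p q => ρ j k * (if p = q then 1 else 0)
      - (1 / 2 : ℝ) * ∑ i, ∑ l, R l j i p * R l k i q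
      - b / 4 * ((if j = p then 1 else 0) * (if k = q then 1 else 0)))
      (c := a / 4 * (if j = k then 1 else 0)) (fun u hu => ?_) p q
    · simp only [eq_comm (a := q) (b := p)] at this
      split_ifs at this ⊢ <;> linarith
    · have e := h2 u hu j k
      rw [ha u hu, hb u hu] at e
      have e1 : ∑ i, tensorApply R j i u ⬝ᵥ tensorApply R k i u
          = ∑ p, ∑ q, (∑ i, ∑ l, R l j i p * R l k i q) * (u p * u q) := by
        simp only [dotProduct, tensorApply, Finset.sum_mul, Finset.mul_sum]
        symm
        rw [sum_rotate]
        refine Finset.sum_congr rfl fun i _ => ?_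
        rw [sum_rotate]
        refine Finset.sum_congr rfl fun l _ => ?_
        rw [Finset.sum_comm]
        exact Finset.sum_congr rfl fun p _ => Finset.sum_congr rfl fun q _ => by ring
      have e3 : ∑ i, u i * u i = 1 := hu
      simp only [sub_mul, Finset.sum_sub_distrib, mul_assoc, ← Finset.mul_sum]
      simp only [ite_mul, one_mul, zero_mul, Finset.sum_ite_eq, Finset.mem_univ, if_true, e3,
        mul_one, Finset.mul_sum, mul_ite, mul_zero]
      simp only [← Finset.mul_sum]
      rw [← e1]
      simp at e ⊢
      linarith
  -- trace over `p = q`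
  have hE : ∀ j k, 2 * n * ρ j k = if j = k then c + b / 2 + n * a / 2 else 0 := by
    intro j k
    have e := Finset.sum_congr (rfl : (Finset.univ : Finset (Fin n)) = _)
      fun p _ => hpol j k p p
    have e1 : ∑ p, ∑ i, ∑ l, R l j i p * R l k i p = if j = k then c else 0 := by
      rw [← hpair j k, ← sum_rotate]
    simp only [if_true, mul_one, Finset.sum_sub_distrib, Finset.sum_add_distrib,
      ← Finset.mul_sum, e1] at e
    simp at e
    by_cases hjk : j = k
    · subst hjk; simp at e ⊢; linarith
    · simp [hjk] at e ⊢
      exact e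
  obtain ⟨lam, hlam⟩ : ∃ lam, lam = (c + b / 2 + n * a / 2) / (2 * n) := ⟨_, rfl⟩
  have hE' : ∀ j k, ρ j k = if j = k then lam else 0 := by
    intro j k
    have := hE j k
    split_ifs at this ⊢
    · rw [hlam, ← this]; field_simp
    · simpa [hn0] using this
  -- the other contraction
  have hcon : 2 * n * lam - (1 / 2 : ℝ) * (n * lam ^ 2 + n * c / 2) - b / 4 * (n ^ 2 + n)
      = n * a / 2 := by
    have e := Finset.sum_congr (rfl : (Finset.univ : Finset (Fin n)) = _)
      fun j _ => Finset.sum_congr (rfl : (Finset.univ : Finset (Fin n)) = _)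
        fun k _ => hpol j k j k
    -- Each inner trace is minus the Ricci tensor, so this is the squared norm of lam times the
    -- identity.
    have e1 : ∑ j, ∑ k, ∑ i, ∑ l, R l j i j * R l k i k = n * lam ^ 2 := by
      have h : ∀ i l, ∑ j, R l j i j = - ρ i l := fun i l => by
        rw [← hρ, ← Finset.sum_neg_distrib]
        exact Finset.sum_congr rfl fun j _ => hR.skew' l j i j
      rw [sum_rotate]
      trans ∑ i, ∑ l, ρ i l * ρ i l
      · refine Finset.sum_congr rfl fun i _ => ?_
        rw [sum_rotate]
        refine Finset.sum_congr rfl fun l _ => ?_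
        rw [← Finset.sum_mul_sum, h]; ring
      · simp [hE', sq]
    -- Half the full norm n * c of the curvature, by the first Bianchi identity.
    have e2 : ∑ j, ∑ k, ∑ i, ∑ l, R l j i k * R l k i j = n * c / 2 := by
      have h := sum_sq_swap hR
      have h' : ∑ l, ∑ i, ∑ j, ∑ k, R l i j k * R l i j k = n * c := by
        trans ∑ k, ∑ i, ∑ j, ∑ l, R l i j k * R l i j k
        · rw [Finset.sum_congr rfl fun k _ => sum_rotate _, Finset.sum_comm]
          exact Finset.sum_congr rfl fun l _ => (sum_rotate _).symm
        · simp [hT]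
      rw [h'] at h
      rw [sum_rotate, Finset.sum_congr rfl fun i _ => sum_rotate _, Finset.sum_comm]
      linarith
    simp only [Finset.sum_sub_distrib, Finset.sum_add_distrib, ← Finset.mul_sum, e1, e2, hE'] at e
    simp at e
    linear_combination e
  have hscal : 2 * n * lam = c + b / 2 + n * a / 2 := by
    rw [hlam]; field_simp
  refine ⟨lam, hE', fun h2n => ?_, fun u hu => ?_⟩
  · subst h2n
    -- On the standard basis of the plane the vertical identity becomes a = 2 lam²; eliminating a
    -- and b from `hcon` and `hscal` leaves 8 lam² = 8 lam.
    have e := h1' (Pi.single 0 1) (Pi.single 1 1) (by simp) (by simp) (by simp)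
    have h01 : R 0 0 1 1 = lam := by
      have := (hρ 1 1).trans (hE' 1 1)
      have h11 := hR.skew 1 1 1 1
      simp [Fin.sum_univ_two] at this
      linarith
    have h11 : R 1 1 0 0 = lam := by rw [hR.pair]; exact h01
    have h10 : R 1 0 1 0 = - lam := by rw [hR.skew, h11]
    have h12 : R 1 0 0 0 = 0 := by linarith [hR.skew 1 0 0 0]
    have h13 : R 1 1 1 0 = 0 := by linarith [hR.skew 1 1 1 0]
    simp [Fin.sum_univ_two, tensorApply, Pi.single_apply, h10, h11, h12, h13] at e
    simp only [hc] at hcon hscal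
    norm_num at hcon hscal
    nlinarith
  · rw [ha u hu, hb u hu]
    constructor
    · rw [hc] at hscal; linarith
    · rw [hc] at hcon
      have : (n : ℝ) * ((n + 1) * (a + b)) = n * (8 * lam - 2 * lam ^ 2 + 4 * (n - 1) * (n - 2)) := by
        linear_combination (-4) * hcon
      exact mul_left_cancel₀ hn0 this

end Pointwise

end Algebra

/-! ### Transformation of the Ricci tensor under a change of coordinates -/

section Transformation

variable {n : ℕ}

theorem partialDeriv_mul {m : ℕ} {f g : Coord m → ℝ} {x : Coord m} (hf : DifferentiableAt ℝ f x)
    (hg : DifferentiableAt ℝ g x) (i : Fin m) :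
    partialDeriv i (fun y => f y * g y) x = f x * partialDeriv i g x + partialDeriv i f x * g x := by
  simp [partialDeriv, fderiv_fun_mul hf hg, mul_comm]

theorem partialDeriv_add {m : ℕ} {f g : Coord m → ℝ} {x : Coord m} (hf : DifferentiableAt ℝ f x)
    (hg : DifferentiableAt ℝ g x) (i : Fin m) :
    partialDeriv i (fun y => f y + g y) x = partialDeriv i f x + partialDeriv i g x := by
  simp [partialDeriv, fderiv_fun_add hf hg]

theorem partialDeriv_sum {m : ℕ} {ι : Type*} [Fintype ι] {f : ι → Coord m → ℝ} {x : Coord m}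
    (hf : ∀ k, DifferentiableAt ℝ (f k) x) (i : Fin m) :
    partialDeriv i (fun y => ∑ k, f k y) x = ∑ k, partialDeriv i (f k) x := by
  simp [partialDeriv, fderiv_fun_sum fun k _ => hf k]

theorem coord_eq_sum {m : ℕ} (v : Coord m) : v = ∑ i, v i • basisVec i := by
  ext j; simp [Pi.single_apply]

theorem partialDeriv_comp {m : ℕ} {f : Coord n → ℝ} {φ : Coord m → Coord n} {y : Coord m}
    (hf : DifferentiableAt ℝ f (φ y)) (hφ : DifferentiableAt ℝ φ y) (i : Fin m) :
    partialDeriv i (fun z => f (φ z)) y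
      = ∑ c, partialDeriv c f (φ y) * partialDeriv i (fun z => φ z c) y := by
  have h1 : ∀ c, partialDeriv i (fun z => φ z c) y = (fderiv ℝ φ y (basisVec i)) c := by
    intro c
    have := ((EuclideanSpace.proj c : Coord n →L[ℝ] ℝ).hasFDerivAt.comp y
      hφ.hasFDerivAt).fderiv
    rw [partialDeriv]
    change fderiv ℝ ((EuclideanSpace.proj c : Coord n →L[ℝ] ℝ) ∘ φ) y _ = _
    rw [this]; rfl
  rw [partialDeriv, show (fun z => f (φ z)) = f ∘ φ from rfl, fderiv_comp y hf hφ,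
    ContinuousLinearMap.comp_apply, coord_eq_sum (fderiv ℝ φ y (basisVec i)), map_sum]
  refine Finset.sum_congr rfl fun c _ => ?_
  rw [map_smul, smul_eq_mul, h1, mul_comm, partialDeriv]

theorem contDiffAt_partialDeriv {m : ℕ} {f : Coord m → ℝ} {x : Coord m}
    (hf : ContDiffAt ℝ ∞ f x) (i : Fin m) : ContDiffAt ℝ ∞ (partialDeriv i f) x :=
  contDiffAt_fderiv_apply hf _

theorem partialDeriv_comm {m : ℕ} {f : Coord m → ℝ} {x : Coord m}
    (hf : ContDiffAt ℝ 2 f x) (i j : Fin m) :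
    partialDeriv i (partialDeriv j f) x = partialDeriv j (partialDeriv i f) x :=
  fderiv_fderiv_symm hf _ _

theorem partialDeriv_congr {m : ℕ} {f g : Coord m → ℝ} {x : Coord m} (h : f =ᶠ[𝓝 x] g)
    (i : Fin m) : partialDeriv i f x = partialDeriv i g x := by
  rw [partialDeriv, h.fderiv_eq, partialDeriv]

/-- The Jacobian matrix of `φ`. -/
def jacobian {m : ℕ} (φ : Coord m → Coord n) (y : Coord m) : Matrix (Fin n) (Fin m) ℝ :=
  Matrix.of fun a j => partialDeriv j (fun z => φ z a) y

/-- The components of the pullback of a metric along `φ`. -/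
def pullbackMetric {m : ℕ} (φ : Coord m → Coord n) (G : Coord n → Matrix (Fin n) (Fin n) ℝ)
    (y : Coord m) : Matrix (Fin m) (Fin m) ℝ :=
  (jacobian φ y).transpose * G (φ y) * jacobian φ y

/-- Entrywise partial derivative of a matrix-valued function. -/
def matDeriv {m : ℕ} {ι κ : Type*} (i : Fin m) (A : Coord m → Matrix ι κ ℝ) (y : Coord m) :
    Matrix ι κ ℝ :=
  Matrix.of fun a b => partialDeriv i (fun z => A z a b) y

theorem matDeriv_mul {m : ℕ} {ι κ μ : Type*} [Fintype κ] {A : Coord m → Matrix ι κ ℝ}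
    {B : Coord m → Matrix κ μ ℝ} {y : Coord m}
    (hA : ∀ a b, DifferentiableAt ℝ (fun z => A z a b) y)
    (hB : ∀ a b, DifferentiableAt ℝ (fun z => B z a b) y) (i : Fin m) :
    matDeriv i (fun z => A z * B z) y = A y * matDeriv i B y + matDeriv i A y * B y := by
  ext a b
  simp only [matDeriv, Matrix.of_apply, Matrix.mul_apply, Matrix.add_apply]
  rw [partialDeriv_sum fun k => (hA a k).fun_mul (hB k b)]
  simp only [partialDeriv_mul (hA a _) (hB _ b), Finset.sum_add_distrib]

theorem contDiffAt_mul_apply {E ι κ μ : Type*} [NormedAddCommGroup E] [NormedSpace ℝ E]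
    [Fintype κ] {A : E → Matrix ι κ ℝ} {B : E → Matrix κ μ ℝ} {y : E}
    (hA : ∀ a b, ContDiffAt ℝ ∞ (fun z => A z a b) y)
    (hB : ∀ a b, ContDiffAt ℝ ∞ (fun z => B z a b) y) (a : ι) (b : μ) :
    ContDiffAt ℝ ∞ (fun z => (A z * B z) a b) y := by
  simp only [Matrix.mul_apply]
  exact ContDiffAt.sum fun k _ => (hA a k).mul (hB k b)

/-- The Christoffel symbols, lowered with the metric. -/
theorem sum_mul_christoffel {G : Coord n → Matrix (Fin n) (Fin n) ℝ} {x : Coord n}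
    (hdet : (G x).det ≠ 0) (l i j : Fin n) :
    ∑ k, G x l k * christoffel G k i j x = (1 / 2 : ℝ) *
      (partialDeriv i (fun y => G y j l) x + partialDeriv j (fun y => G y i l) x
      - partialDeriv l (fun y => G y i j) x) := by
  have h := Matrix.mul_nonsing_inv (G x) (isUnit_iff_ne_zero.2 hdet)
  have : ∀ s, ∑ k, G x l k * (G x)⁻¹ k s = (1 : Matrix (Fin n) (Fin n) ℝ) l s := fun s => by
    rw [← h, Matrix.mul_apply]
  simp only [christoffel, Finset.mul_sum]
  rw [Finset.sum_comm]
  trans ∑ s, (1 : Matrix (Fin n) (Fin n) ℝ) l s * ((1 / 2 : ℝ) *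
      (partialDeriv i (fun y => G y j s) x + partialDeriv j (fun y => G y i s) x
      - partialDeriv s (fun y => G y i j) x))
  · refine Finset.sum_congr rfl fun s _ => ?_
    rw [← this s, Finset.sum_mul]
    exact Finset.sum_congr rfl fun k _ => by ring
  · simp [Matrix.one_apply]

section

variable {φ : Coord n → Coord n} {G : Coord n → Matrix (Fin n) (Fin n) ℝ} {y : Coord n}

theorem contDiffAt_coord {m : ℕ} {E : Type*} [NormedAddCommGroup E] [NormedSpace ℝ E]
    {φ : E → Coord m} {y : E} (hφ : ContDiffAt ℝ ∞ φ y) (a : Fin m) :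
    ContDiffAt ℝ ∞ (fun z => φ z a) y :=
  contDiffAt_euclidean.1 hφ a

theorem contDiffAt_jacobian (hφ : ContDiffAt ℝ ∞ φ y) (a j : Fin n) :
    ContDiffAt ℝ ∞ (fun z => jacobian φ z a j) y :=
  contDiffAt_partialDeriv (contDiffAt_coord hφ a) j

theorem partialDeriv_jacobian (hφ : ContDiffAt ℝ 2 φ y) (a i j : Fin n) :
    partialDeriv i (fun z => jacobian φ z a j) y = partialDeriv j (fun z => jacobian φ z a i) y :=
  partialDeriv_comm (contDiffAt_euclidean.1 hφ a) i j

theorem pullbackMetric_apply (i j : Fin n) :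
    pullbackMetric φ G y i j
      = ∑ a, ∑ b, G (φ y) a b * (jacobian φ y a i * jacobian φ y b j) := by
  simp only [pullbackMetric, Matrix.mul_apply, Matrix.transpose_apply, Finset.sum_mul]
  rw [Finset.sum_comm]
  exact Finset.sum_congr rfl fun a _ => Finset.sum_congr rfl fun b _ => by ring

/-- The transformation law of the Christoffel symbols. -/
theorem jacobian_mul_christoffel (hφ : ContDiffAt ℝ 2 φ y)
    (hdG : ∀ a b, DifferentiableAt ℝ (fun x => G x a b) (φ y))
    (hsymm : ∀ a b, G (φ y) a b = G (φ y) b a) (hdet : (G (φ y)).det ≠ 0)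
    (hA : (jacobian φ y).det ≠ 0) (m j k : Fin n) :
    ∑ l, jacobian φ y m l * christoffel (pullbackMetric φ G) l j k y =
      partialDeriv j (fun z => jacobian φ z m k) y
        + ∑ a, ∑ b, christoffel G m a b (φ y) * (jacobian φ y a j * jacobian φ y b k) := by
  have hdφ : DifferentiableAt ℝ φ y := hφ.differentiableAt (by simp)
  have hdJ : ∀ a b, DifferentiableAt ℝ (fun z => jacobian φ z a b) y := fun a b =>
    ((contDiffAt_euclidean.1 hφ a).fderiv_right (m := 1) (by norm_num)).differentiableAt
      (by simp) |>.clm_apply (differentiableAt_const _)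
  have hdGφ : ∀ a b, DifferentiableAt ℝ (fun z => G (φ z) a b) y := fun a b =>
    DifferentiableAt.comp y (hdG a b) hdφ
  set A := jacobian φ y with hAdef
  -- A derivative of the pulled-back metric splits into terms `s` with derivatives of the Jacobian
  -- and terms `t` with derivatives of `G`. Symmetry of `s` in its first two indices leaves a single
  -- `s` in the lowered Christoffel symbol.
  set s : Fin n → Fin n → Fin n → ℝ := fun j k l =>
    ∑ a, ∑ b, G (φ y) a b * (partialDeriv j (fun z => jacobian φ z a k) y * A b l) with hs
  set t : Fin n → Fin n → Fin n → ℝ := fun p q r =>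
    ∑ a, ∑ b, ∑ c, A a p * A b q * A c r * partialDeriv c (fun x => G x a b) (φ y) with ht
  have hs_symm : ∀ j k l, s j k l = s k j l := fun j k l => by
    simp only [hs, partialDeriv_jacobian hφ]
  have hpd : ∀ j k l, partialDeriv j (fun z => pullbackMetric φ G z k l) y
      = s j k l + s j l k + t k l j := by
    intro j k l
    simp only [pullbackMetric_apply]
    rw [partialDeriv_sum fun a => DifferentiableAt.fun_sum fun b _ =>
      (hdGφ a b).fun_mul ((hdJ a k).fun_mul (hdJ b l))]
    have e1 : s j l k = ∑ a, ∑ b, G (φ y) a b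
        * (partialDeriv j (fun z => jacobian φ z b l) y * A a k) := by
      simp only [hs]; rw [Finset.sum_comm]; simp only [hsymm]
    rw [e1]
    simp only [hs, ht, ← Finset.sum_add_distrib]
    refine Finset.sum_congr rfl fun a _ => ?_
    rw [partialDeriv_sum fun b => (hdGφ a b).fun_mul ((hdJ a k).fun_mul (hdJ b l))]
    refine Finset.sum_congr rfl fun b _ => ?_
    rw [partialDeriv_mul (hdGφ a b) ((hdJ a k).fun_mul (hdJ b l)),
      partialDeriv_mul (hdJ a k) (hdJ b l), partialDeriv_comp (f := fun x => G x a b) (hdG a b) hdφ,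
      Finset.sum_mul, mul_add, add_comm (_ * (_ * _)) (_ * (_ * _))]
    congr 1
    · ring
    · refine Finset.sum_congr rfl fun c _ => ?_
      simp only [hAdef, jacobian, Matrix.of_apply]; ring
  have hdet' : (pullbackMetric φ G y).det ≠ 0 := by
    rw [pullbackMetric, Matrix.det_mul, Matrix.det_mul, Matrix.det_transpose]
    exact mul_ne_zero (mul_ne_zero hA hdet) hA
  -- it suffices to compare after multiplication by the invertible matrix `Aᵀ G`
  have hN : ((A.transpose * G (φ y)).det) ≠ 0 := by
    rw [Matrix.det_mul, Matrix.det_transpose]; exact mul_ne_zero hA hdet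
  suffices h : (A.transpose * G (φ y)).mulVec
      (fun m => ∑ l, A m l * christoffel (pullbackMetric φ G) l j k y) =
      (A.transpose * G (φ y)).mulVec (fun m => partialDeriv j (fun z => jacobian φ z m k) y
        + ∑ a, ∑ b, christoffel G m a b (φ y) * (A a j * A b k)) from
    congrFun (Matrix.mulVec_injective_of_isUnit
      ((Matrix.isUnit_iff_isUnit_det _).2 (isUnit_iff_ne_zero.2 hN)) h) m
  ext l
  have hL : (A.transpose * G (φ y)).mulVec
      (fun m => ∑ l, A m l * christoffel (pullbackMetric φ G) l j k y) l =
      s j k l + (1 / 2 : ℝ) * (t k l j + t j l k - t j k l) := by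
    have h1 := sum_mul_christoffel hdet' l j k
    rw [hpd, hpd, hpd, hs_symm k j l, hs_symm l j k, hs_symm l k j] at h1
    have h2 : (fun m => ∑ l, A m l * christoffel (pullbackMetric φ G) l j k y)
        = A.mulVec fun l => christoffel (pullbackMetric φ G) l j k y := rfl
    rw [h2, Matrix.mulVec_mulVec]
    change (pullbackMetric φ G y).mulVec _ l = _
    simp only [Matrix.mulVec, dotProduct]
    rw [h1]; ring
  rw [hL]
  simp only [Matrix.mulVec, dotProduct, mul_add, Finset.sum_add_distrib]
  congr 1
  · simp only [hs, Matrix.mul_apply, Matrix.transpose_apply, Finset.sum_mul]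
    refine Finset.sum_congr rfl fun a _ => Finset.sum_congr rfl fun b _ => ?_
    rw [hsymm a b]; ring
  · have h3 : ∀ c a b, ∑ m, G (φ y) c m * christoffel G m a b (φ y) = (1 / 2 : ℝ) *
      (partialDeriv a (fun y => G y b c) (φ y) + partialDeriv b (fun y => G y a c) (φ y)
      - partialDeriv c (fun y => G y a b) (φ y)) := fun c a b => sum_mul_christoffel hdet c a b
    trans ∑ c, ∑ a, ∑ b, A c l * (A a j * A b k) *
      ∑ m, G (φ y) c m * christoffel G m a b (φ y)
    · simp only [h3]
      have et1 : t k l j = ∑ c, ∑ a, ∑ b, A c l * (A a j * A b k)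
          * partialDeriv a (fun y => G y b c) (φ y) := by
        simp only [ht]
        rw [sum_rotate, sum_rotate]
        exact Finset.sum_congr rfl fun a _ => Finset.sum_congr rfl fun b _ =>
          Finset.sum_congr rfl fun c _ => by ring
      have et2 : t j l k = ∑ c, ∑ a, ∑ b, A c l * (A a j * A b k)
          * partialDeriv b (fun y => G y a c) (φ y) := by
        simp only [ht]
        rw [Finset.sum_comm]
        exact Finset.sum_congr rfl fun a _ => Finset.sum_congr rfl fun b _ =>
          Finset.sum_congr rfl fun c _ => by ring
      have et3 : t j k l = ∑ c, ∑ a, ∑ b, A c l * (A a j * A b k)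
          * partialDeriv c (fun y => G y a b) (φ y) := by
        simp only [ht]
        rw [sum_rotate]
        exact Finset.sum_congr rfl fun a _ => Finset.sum_congr rfl fun b _ =>
          Finset.sum_congr rfl fun c _ => by ring
      rw [et1, et2, et3]
      simp only [← Finset.sum_add_distrib, ← Finset.sum_sub_distrib, Finset.mul_sum]
      exact Finset.sum_congr rfl fun a _ => Finset.sum_congr rfl fun b _ =>
          Finset.sum_congr rfl fun c _ => by ring
    · simp only [Finset.mul_sum]
      rw [Finset.sum_congr rfl fun c _ => sum_rotate _, Finset.sum_comm]
      refine Finset.sum_congr rfl fun m _ => ?_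
      simp only [Matrix.mul_apply, Matrix.transpose_apply, Finset.sum_mul]
      rw [← sum_rotate]
      exact Finset.sum_congr rfl fun a _ => Finset.sum_congr rfl fun b _ =>
          Finset.sum_congr rfl fun c _ => by ring

/-- The transformation law of the Ricci tensor. -/
theorem ricci_pullbackMetric (hφ : ContDiffAt ℝ ∞ φ y)
    (hG : ∀ a b, ContDiffAt ℝ ∞ (fun x => G x a b) (φ y))
    (hsymm : ∀ᶠ x in 𝓝 (φ y), ∀ a b, G x a b = G x b a) (hdet : (G (φ y)).det ≠ 0)
    (hA : (jacobian φ y).det ≠ 0) (j k : Fin n) :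
    ricci (pullbackMetric φ G) y j k
      = ∑ a, ∑ b, ricci G (φ y) a b * (jacobian φ y a j * jacobian φ y b k) := by
  have hJ := fun a b => contDiffAt_jacobian (n := n) hφ a b
  have hGφ : ∀ a b, ContDiffAt ℝ ∞ (fun z => G (φ z) a b) y := fun a b =>
    ContDiffAt.comp y (hG a b) hφ
  have hG' : ∀ a b, ContDiffAt ℝ ∞ (fun z => pullbackMetric φ G z a b) y := fun a b =>
    contDiffAt_mul_apply (fun a b => contDiffAt_mul_apply (fun a b => hJ b a) hGφ a b) hJ a b
  have hdet' : (pullbackMetric φ G y).det ≠ 0 := by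
    rw [pullbackMetric, Matrix.det_mul, Matrix.det_mul, Matrix.det_transpose]
    exact mul_ne_zero (mul_ne_zero hA hdet) hA
  have hΓ : ∀ l i j, ContDiffAt ℝ ∞ (christoffel G l i j) (φ y) :=
    contDiffAt_christoffel hG hdet
  have hΓφ : ∀ l i j, ContDiffAt ℝ ∞ (fun z => christoffel G l i j (φ z)) y := fun l i j =>
    ContDiffAt.comp (g := christoffel G l i j) (f := φ) y (hΓ l i j) hφ
  have hΓ' : ∀ l i j, ContDiffAt ℝ ∞ (christoffel (pullbackMetric φ G) l i j) y :=
    contDiffAt_christoffel hG' hdet'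
  have diff : ∀ {f : Coord n → ℝ}, ContDiffAt ℝ ∞ f y → DifferentiableAt ℝ f y := fun h =>
    h.differentiableAt (by simp)
  -- the connection matrices
  let A := jacobian φ y
  let Γ' : Fin n → Coord n → Matrix (Fin n) (Fin n) ℝ := fun j z =>
    Matrix.of fun l k => christoffel (pullbackMetric φ G) l j k z
  let C : Fin n → Coord n → Matrix (Fin n) (Fin n) ℝ := fun j z =>
    Matrix.of fun m b => ∑ a, christoffel G m a b (φ z) * jacobian φ z a j
  have hC : ∀ j a b, ContDiffAt ℝ ∞ (fun z => C j z a b) y := fun j a b =>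
    show ContDiffAt ℝ ∞ (fun z => ∑ c, christoffel G a c b (φ z) * jacobian φ z c j) y from
      ContDiffAt.sum fun c _ => (hΓφ a c b).mul (hJ c j)
  -- The gauge transformation law A Γ'ⱼ = ∂ⱼA + Cⱼ A, with `C` the pulled-back connection matrices.
  -- It holds near `y`, so it may be differentiated.
  have hlaw : ∀ j, (fun z => jacobian φ z * Γ' j z) =ᶠ[𝓝 y]
      fun z => matDeriv j (jacobian φ) z + C j z * jacobian φ z := by
    intro j
    have hA' : ∀ᶠ z in 𝓝 y, (jacobian φ z).det ≠ 0 :=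
      (contDiffAt_det hJ).continuousAt.eventually_ne hA
    have hdet'' : ∀ᶠ x in 𝓝 (φ y), (G x).det ≠ 0 :=
      (contDiffAt_det hG).continuousAt.eventually_ne hdet
    have hφ2 : ∀ᶠ z in 𝓝 y, ContDiffAt ℝ 2 φ z := (hφ.of_le two_le_infty).eventually (by simp)
    have hGd : ∀ᶠ x in 𝓝 (φ y), ∀ a b, DifferentiableAt ℝ (fun x => G x a b) x :=
      Filter.eventually_all.2 fun a => Filter.eventually_all.2 fun b =>
        eventually_differentiableAt (hG a b)
    have hc := hφ.continuousAt
    filter_upwards [hA', hφ2, hc.eventually hdet'', hc.eventually hGd, hc.eventually hsymm]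
      with z h1 h2 h3 h4 h5
    ext m k
    rw [Matrix.mul_apply, Matrix.add_apply, Matrix.mul_apply]
    have := jacobian_mul_christoffel h2 h4 h5 h3 h1 m j k
    refine this.trans ?_
    congr 1
    rw [Finset.sum_comm]
    refine Finset.sum_congr rfl fun b _ => ?_
    change _ = (∑ a, christoffel G m a b (φ z) * jacobian φ z a j) * _
    rw [Finset.sum_mul]
    exact Finset.sum_congr rfl fun a _ => by ring
  have hcomm : ∀ i j, matDeriv i (matDeriv j (jacobian φ)) y
      = matDeriv j (matDeriv i (jacobian φ)) y := fun i j => by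
    ext a b; exact partialDeriv_comm ((hJ a b).of_le two_le_infty) i j
  have hd : ∀ i j, matDeriv i (fun z => jacobian φ z * Γ' j z) y =
      matDeriv i (fun z => matDeriv j (jacobian φ) z + C j z * jacobian φ z) y := fun i j => by
    ext a b
    exact partialDeriv_congr ((hlaw j).mono fun z hz => congrFun (congrFun hz a) b) i
  have hadd : ∀ i j, matDeriv i (fun z => matDeriv j (jacobian φ) z + C j z * jacobian φ z) y =
      matDeriv i (matDeriv j (jacobian φ)) y + matDeriv i (fun z => C j z * jacobian φ z) y :=
    fun i j => by
      ext a b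
      exact partialDeriv_add (diff (contDiffAt_partialDeriv (hJ a b) j))
        (diff (contDiffAt_mul_apply (hC j) hJ a b)) i
  have hlaw0 : ∀ j, A * Γ' j y = matDeriv j (jacobian φ) y + C j y * A := fun j =>
    (hlaw j).eq_of_nhds
  -- Differentiate the gauge law and antisymmetrise: second derivatives of the Jacobian cancel, and
  -- the two curvature matrices are conjugate by A.
  have hcurv : ∀ i j, A * (matDeriv i (Γ' j) y - matDeriv j (Γ' i) y
      + (Γ' i y * Γ' j y - Γ' j y * Γ' i y)) =
      (matDeriv i (C j) y - matDeriv j (C i) y + (C i y * C j y - C j y * C i y)) * A := by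
    intro i j
    have e : ∀ i j, A * (matDeriv i (Γ' j) y + Γ' i y * Γ' j y) =
        matDeriv i (matDeriv j (jacobian φ)) y + (matDeriv i (C j) y + C i y * C j y) * A
          + (C j y * matDeriv i (jacobian φ) y + C i y * matDeriv j (jacobian φ) y) := by
      intro i j
      have h1 := hd i j
      rw [hadd, matDeriv_mul (A := jacobian φ) (B := Γ' j) (fun a b => diff (hJ a b))
          (fun a b => diff (hΓ' a j b)),
        matDeriv_mul (A := C j) (B := jacobian φ) (fun a b => diff (hC j a b))
          (fun a b => diff (hJ a b))] at h1
      have h2 : A * (Γ' i y * Γ' j y) = matDeriv i (jacobian φ) y * Γ' j y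
          + C i y * (matDeriv j (jacobian φ) y + C j y * A) := by
        rw [← Matrix.mul_assoc, hlaw0, Matrix.add_mul, Matrix.mul_assoc, hlaw0]
      rw [Matrix.mul_add, h2, ← sub_eq_zero]
      rw [← sub_eq_zero] at h1
      rw [← h1]
      noncomm_ring
    have e1 := e i j
    have e2 := e j i
    rw [hcomm j i] at e2
    have e3 : A * (matDeriv i (Γ' j) y - matDeriv j (Γ' i) y
      + (Γ' i y * Γ' j y - Γ' j y * Γ' i y)) = A * (matDeriv i (Γ' j) y + Γ' i y * Γ' j y)
        - A * (matDeriv j (Γ' i) y + Γ' j y * Γ' i y) := by noncomm_ring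
    rw [e3, e1, e2]
    noncomm_ring
  -- the curvature endomorphism of the pulled back metric
  have hF : ∀ i j m b, (matDeriv i (C j) y - matDeriv j (C i) y
      + (C i y * C j y - C j y * C i y)) m b
      = ∑ c, ∑ a, riemann G m c a b (φ y) * (A c i * A a j) := by
    intro i j m b
    have hdφ := hφ.differentiableAt (by simp)
    have e : ∀ i j, matDeriv i (C j) y m b = ∑ c, ∑ a,
        partialDeriv c (christoffel G m a b) (φ y) * (A c i * A a j)
        + ∑ a, christoffel G m a b (φ y) * partialDeriv i (fun z => jacobian φ z a j) y := by
      intro i j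
      change partialDeriv i (fun z => ∑ a, christoffel G m a b (φ z) * jacobian φ z a j) y = _
      rw [partialDeriv_sum fun a => (diff (hΓφ m a b)).fun_mul (diff (hJ a j)), Finset.sum_comm,
        ← Finset.sum_add_distrib]
      refine Finset.sum_congr rfl fun a _ => ?_
      rw [partialDeriv_mul (diff (hΓφ m a b)) (diff (hJ a j)),
        partialDeriv_comp ((hΓ m a b).differentiableAt (by simp)) hdφ, add_comm, Finset.sum_mul]
      congr 1
      refine Finset.sum_congr rfl fun c _ => ?_
      change _ * A c i * A a j = _
      ring
    have e' : ∀ i j, (C i y * C j y) m b = ∑ c, ∑ a,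
        (∑ s, christoffel G s a b (φ y) * christoffel G m c s (φ y)) * (A c i * A a j) := by
      intro i j
      rw [Matrix.mul_apply]
      change ∑ s, (∑ c, christoffel G m c s (φ y) * A c i)
        * (∑ a, christoffel G s a b (φ y) * A a j) = _
      simp only [Finset.sum_mul_sum]
      rw [← sum_rotate]
      refine Finset.sum_congr rfl fun c _ => Finset.sum_congr rfl fun a _ => ?_
      rw [Finset.sum_mul]
      exact Finset.sum_congr rfl fun s _ => by ring
    -- Derivatives of the Jacobian are symmetric in i and j, so they disappear from the curvature of
    -- `C`.
    have e0 : ∀ a, partialDeriv j (fun z => jacobian φ z a i) y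
        = partialDeriv i (fun z => jacobian φ z a j) y := fun a =>
      partialDeriv_jacobian (hφ.of_le two_le_infty) a j i
    simp only [Matrix.add_apply, Matrix.sub_apply, e, e', e0]
    rw [Finset.sum_comm (f := fun c a => partialDeriv c (christoffel G m a b) (φ y)
      * (A c j * A a i)), Finset.sum_comm (f := fun c a =>
      (∑ s, christoffel G s a b (φ y) * christoffel G m c s (φ y)) * (A c j * A a i)),
      add_sub_add_right_eq_sub]
    simp only [← Finset.sum_add_distrib, ← Finset.sum_sub_distrib]
    refine Finset.sum_congr rfl fun c _ => Finset.sum_congr rfl fun a _ => ?_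
    rw [riemann, Finset.sum_sub_distrib]
    ring
  have hR : ∀ i j, matDeriv i (Γ' j) y - matDeriv j (Γ' i) y
      + (Γ' i y * Γ' j y - Γ' j y * Γ' i y)
      = A⁻¹ * ((matDeriv i (C j) y - matDeriv j (C i) y
        + (C i y * C j y - C j y * C i y)) * A) := fun i j => by
    rw [← hcurv, Matrix.nonsing_inv_mul_cancel_left _ _ (isUnit_iff_ne_zero.2 hA)]
  have hR' : ∀ i, riemann (pullbackMetric φ G) i i j k y = (matDeriv i (Γ' j) y - matDeriv j (Γ' i) y
      + (Γ' i y * Γ' j y - Γ' j y * Γ' i y)) i k := by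
    intro i
    rw [Matrix.add_apply, Matrix.sub_apply, Matrix.sub_apply, Matrix.mul_apply, Matrix.mul_apply,
      riemann, Finset.sum_sub_distrib]
    congr 2
    · exact Finset.sum_congr rfl fun s _ => mul_comm _ _
    · exact Finset.sum_congr rfl fun s _ => mul_comm _ _
  simp only [ricci, hR', hR]
  -- The Ricci trace over i pairs A⁻¹ with the Jacobian factor of the first curvature slot; only two
  -- Jacobian factors remain.
  have hAA : ∀ c m, ∑ i, A c i * A⁻¹ i m = (1 : Matrix (Fin n) (Fin n) ℝ) c m := fun c m => by
    rw [← Matrix.mul_nonsing_inv A (isUnit_iff_ne_zero.2 hA), Matrix.mul_apply]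
  trans ∑ b, ∑ m, ∑ c, ∑ a, (∑ i, A c i * A⁻¹ i m) *
    (riemann G m c a b (φ y) * (A a j * A b k))
  · trans ∑ i, ∑ m, ∑ b, ∑ c, ∑ a,
      A⁻¹ i m * (riemann G m c a b (φ y) * (A c i * A a j) * A b k)
    · refine Finset.sum_congr rfl fun i _ => ?_
      rw [Matrix.mul_apply]
      refine Finset.sum_congr rfl fun m _ => ?_
      rw [Matrix.mul_apply, Finset.mul_sum]
      refine Finset.sum_congr rfl fun b _ => ?_
      rw [hF, Finset.sum_mul, Finset.mul_sum]
      refine Finset.sum_congr rfl fun c _ => ?_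
      rw [Finset.sum_mul, Finset.mul_sum]
    · rw [← sum_rotate, Finset.sum_comm]
      refine Finset.sum_congr rfl fun b _ => Finset.sum_congr rfl fun m _ => ?_
      rw [← sum_rotate]
      refine Finset.sum_congr rfl fun c _ => Finset.sum_congr rfl fun a _ => ?_
      rw [Finset.sum_mul]
      exact Finset.sum_congr rfl fun i _ => by ring
  · simp only [hAA, Matrix.one_apply, ite_mul, one_mul, zero_mul]
    trans ∑ b, ∑ m, ∑ a, riemann G m m a b (φ y) * (A a j * A b k)
    · refine Finset.sum_congr rfl fun b _ => Finset.sum_congr rfl fun m _ => ?_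
      rw [Finset.sum_comm]
      simp
    · rw [sum_rotate]
      refine Finset.sum_congr rfl fun a _ => Finset.sum_congr rfl fun b _ => ?_
      rw [Finset.sum_mul]

end

end Transformation

/-! ### Schur's lemma -/

section Schur

variable {n : ℕ} {G : Coord n → Matrix (Fin n) (Fin n) ℝ} {x : Coord n}

/-- The third derivatives of the components of a metric. -/
def metricD3 (G : Coord n → Matrix (Fin n) (Fin n) ℝ) (x : Coord n) (k l p i j : Fin n) : ℝ :=
  partialDeriv p (partialDeriv i (partialDeriv j (fun y => G y k l))) x

theorem contDiffAt_riemann (hG : ∀ i j, ContDiffAt ℝ ∞ (fun y => G y i j) x)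
    (hdet : (G x).det ≠ 0) (l i j k : Fin n) : ContDiffAt ℝ ∞ (riemann G l i j k) x := by
  have h := contDiffAt_christoffel hG hdet
  unfold riemann
  exact ((contDiffAt_partialDeriv (h l j k) i).sub (contDiffAt_partialDeriv (h l i k) j)).add
    (ContDiffAt.sum fun s _ => ((h s j k).mul (h l i s)).sub ((h s i k).mul (h l j s)))

theorem contDiffAt_ricci (hG : ∀ i j, ContDiffAt ℝ ∞ (fun y => G y i j) x)
    (hdet : (G x).det ≠ 0) (j k : Fin n) : ContDiffAt ℝ ∞ (fun y => ricci G y j k) x :=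
  ContDiffAt.sum fun i _ => contDiffAt_riemann hG hdet i i j k

namespace IsNormalAt

theorem metricD3_swap_left (hG : IsNormalAt G x) (k l p i j : Fin n) :
    metricD3 G x k l p i j = metricD3 G x k l i p j :=
  partialDeriv_comm ((contDiffAt_partialDeriv (hG.smooth k l) j).of_le two_le_infty) p i

theorem metricD3_swap_right (hG : IsNormalAt G x) (k l p i j : Fin n) :
    metricD3 G x k l p i j = metricD3 G x k l p j i := by
  refine partialDeriv_congr ?_ p
  filter_upwards [((hG.smooth k l).of_le two_le_infty).eventually (by simp)] with y hy
  exact partialDeriv_comm hy i j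

/-- At `x` the first derivatives of the metric and of its inverse vanish, so both derivatives must
fall on the bracket of metric derivatives. -/
theorem partialDeriv_partialDeriv_christoffel (hG : IsNormalAt G x) (l j k p i : Fin n) :
    partialDeriv p (partialDeriv i (christoffel G l j k)) x = (1 / 2 : ℝ) *
      (metricD3 G x k l p i j + metricD3 G x j l p i k - metricD3 G x j k p i l) := by
  have hdet : (G x).det ≠ 0 := by rw [hG.eq_one]; simp
  have hinv : ∀ s, HasJet (fun y => (G y)⁻¹ l s) x _ _ _ := fun s =>
    hasJet_of_contDiffAt (contDiffAt_inv_apply hG.smooth hdet l s)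
  have hj : ∀ a b c, HasJet (partialDeriv a (fun z => G z b c)) x 0
      (fun v => fderiv ℝ (partialDeriv a (fun z => G z b c)) x v)
      (fun v w => fderiv ℝ (fun y => fderiv ℝ (partialDeriv a (fun z => G z b c)) y w) x v) :=
    fun a b c => (hasJet_of_contDiffAt (contDiffAt_partialDeriv (hG.smooth b c) a)).of_eq
      (by simp [partialDeriv, hG.fderiv_eq_zero]) (fun _ => rfl) (fun _ _ => rfl)
  have := (((HasJet.sum Finset.univ (fun s _ => (hinv s).mul
    (((hj j k s).add (hj k j s)).sub (hj s j k)))).const_mul (1 / 2 : ℝ)).d2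
      (basisVec p) (basisVec i))
  rw [partialDeriv]
  unfold partialDeriv
  unfold christoffel
  refine this.trans ?_
  simp only [(hasJet_inv_apply hG.hasJet _ _).2.1, (hasJet_inv_apply hG.hasJet _ _).2.2,
    neg_zero, zero_mul, add_zero, sub_zero, Matrix.one_apply, ite_mul, one_mul,
    Finset.sum_ite_eq, Finset.mem_univ, if_true]
  rfl

theorem partialDeriv_ricci (hG : IsNormalAt G x) (p j k : Fin n) :
    partialDeriv p (fun y => ricci G y j k) x = ∑ i, (1 / 2 : ℝ) *
      (metricD3 G x j i p i k - metricD3 G x j k p i i - metricD3 G x i i p j k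
        + metricD3 G x i k p j i) := by
  have hdet : (G x).det ≠ 0 := by rw [hG.eq_one]; simp
  have diff : ∀ {f : Coord n → ℝ}, ContDiffAt ℝ ∞ f x → DifferentiableAt ℝ f x := fun h =>
    h.differentiableAt (by simp)
  have hΓ := fun l i j => hG.contDiffAt_christoffel l i j
  change partialDeriv p (fun y => ∑ i, riemann G i i j k y) x = _
  rw [partialDeriv_sum fun i => diff (contDiffAt_riemann hG.smooth hdet i i j k)]
  refine Finset.sum_congr rfl fun i _ => ?_
  -- A product of two Christoffel symbols vanishes to second order at `x`.
  have hq : partialDeriv p (fun y => ∑ s, (christoffel G s j k y * christoffel G i i s y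
      - christoffel G s i k y * christoffel G i j s y)) x = 0 := by
    have := (HasJet.sum Finset.univ fun s _ => ((hG.hasJet_christoffel s j k).mul
      (hG.hasJet_christoffel i i s)).sub ((hG.hasJet_christoffel s i k).mul
      (hG.hasJet_christoffel i j s))).d1 (basisVec p)
    refine this.trans ?_
    simp
  have h1 : partialDeriv p (riemann G i i j k) x
      = partialDeriv p (partialDeriv i (christoffel G i j k)) x
        - partialDeriv p (partialDeriv j (christoffel G i i k)) x := by
    have h2 := ((hasJet_of_contDiffAt (contDiffAt_partialDeriv (hΓ i j k) i)).sub
      (hasJet_of_contDiffAt (contDiffAt_partialDeriv (hΓ i i k) j))).add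
      (hasJet_of_contDiffAt (f := fun y => ∑ s, (christoffel G s j k y * christoffel G i i s y
      - christoffel G s i k y * christoffel G i j s y)) (ContDiffAt.sum fun s _ =>
        ((hΓ s j k).mul (hΓ i i s)).sub ((hΓ s i k).mul (hΓ i j s))))
    have h3 := h2.d1 (basisVec p)
    refine h3.trans ?_
    change _ - _ + partialDeriv p _ x = _
    rw [hq, add_zero]
    rfl
  rw [h1, hG.partialDeriv_partialDeriv_christoffel, hG.partialDeriv_partialDeriv_christoffel,
    hG.metricD3_swap_right k i p i j]
  ring

/-- The contracted second Bianchi identity. -/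
theorem sum_partialDeriv_ricci (hG : IsNormalAt G x) (k : Fin n) :
    2 * ∑ j, partialDeriv j (fun y => ricci G y j k) x
      = ∑ j, partialDeriv k (fun y => ricci G y j j) x := by
  simp only [hG.partialDeriv_ricci, ← Finset.mul_sum]
  -- Third derivatives are symmetric in the derivative slots and the summation indices can be
  -- exchanged. Only three distinct sums remain, and the one in `e1` cancels.
  have e1 : ∑ j, ∑ i, metricD3 G x i k j j i = ∑ j, ∑ i, metricD3 G x j k j i i := by
    rw [Finset.sum_comm]
    refine Finset.sum_congr rfl fun j _ => Finset.sum_congr rfl fun i _ => ?_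
    rw [hG.metricD3_swap_right, hG.metricD3_swap_left]
  have e2 : ∑ j, ∑ i, metricD3 G x j j k i i = ∑ j, ∑ i, metricD3 G x i i j j k := by
    rw [Finset.sum_comm]
    refine Finset.sum_congr rfl fun j _ => Finset.sum_congr rfl fun i _ => ?_
    rw [hG.metricD3_swap_left, hG.metricD3_swap_right]
  have e3 : ∑ j, ∑ i, metricD3 G x i i k j j = ∑ j, ∑ i, metricD3 G x i i j j k := by
    refine Finset.sum_congr rfl fun j _ => Finset.sum_congr rfl fun i _ => ?_
    rw [hG.metricD3_swap_left, hG.metricD3_swap_right]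
  have e4 : ∑ j, ∑ i, metricD3 G x j i k i j = ∑ j, ∑ i, metricD3 G x j i j i k := by
    refine Finset.sum_congr rfl fun j _ => Finset.sum_congr rfl fun i _ => ?_
    rw [hG.metricD3_swap_right, hG.metricD3_swap_left, hG.metricD3_swap_right]
  have e5 : ∑ j, ∑ i, metricD3 G x i j k j i = ∑ j, ∑ i, metricD3 G x j i j i k := by
    rw [Finset.sum_comm]; exact e4
  simp only [Finset.sum_add_distrib, Finset.sum_sub_distrib, e1, e2, e3, e4, e5]
  ring

/-- The factor of an Einstein metric is smooth. -/
theorem contDiffAt_einsteinFactor (hG : IsNormalAt G x) (hn : 0 < n) {lam : Coord n → ℝ}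
    (h : ∀ᶠ y in 𝓝 x, ∀ j k, ricci G y j k = lam y * G y j k) : ContDiffAt ℝ ∞ lam x := by
  have hdet : (G x).det ≠ 0 := by rw [hG.eq_one]; simp
  let i0 : Fin n := ⟨0, hn⟩
  have h0 : G x i0 i0 ≠ 0 := by rw [hG.eq_one]; simp
  have hlam : lam =ᶠ[𝓝 x] fun y => ricci G y i0 i0 / G y i0 i0 := by
    filter_upwards [h, (hG.smooth i0 i0).continuousAt.eventually_ne h0] with y hy hy0
    rw [hy, mul_div_cancel_right₀ _ hy0]
  exact ((contDiffAt_ricci hG.smooth hdet i0 i0).div (hG.smooth i0 i0) h0).congr_of_eventuallyEq hlam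

/-- Schur's lemma at a point where the metric is the identity matrix to first order. -/
theorem schur (hG : IsNormalAt G x) (hn : 3 ≤ n) {lam : Coord n → ℝ}
    (h : ∀ᶠ y in 𝓝 x, ∀ j k, ricci G y j k = lam y * G y j k) :
    HasFDerivAt lam (0 : Coord n →L[ℝ] ℝ) x := by
  have hs : ContDiffAt ℝ ∞ lam x := hG.contDiffAt_einsteinFactor (by omega) h
  have hd : DifferentiableAt ℝ lam x := hs.differentiableAt (by simp)
  have hp : ∀ p j k, partialDeriv p (fun y => ricci G y j k) x
      = partialDeriv p lam x * (1 : Matrix (Fin n) (Fin n) ℝ) j k := by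
    intro p j k
    rw [partialDeriv_congr (h.mono fun y hy => hy j k),
      partialDeriv_mul hd ((hG.smooth j k).differentiableAt (by simp)), hG.eq_one]
    simp [partialDeriv, hG.fderiv_eq_zero]
  -- The contracted Bianchi identity reads 2 ∂ₖλ = n ∂ₖλ, which is where n ≠ 2 enters.
  have hz : ∀ k, partialDeriv k lam x = 0 := by
    intro k
    have := hG.sum_partialDeriv_ricci k
    simp only [hp, Matrix.one_apply] at this
    simp at this
    have hn' : (2 : ℝ) - n ≠ 0 := by
      have : (3 : ℝ) ≤ n := by exact_mod_cast hn
      linarith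
    exact this.resolve_left fun h => hn' (by linarith)
  have : fderiv ℝ lam x = 0 := by
    ext v
    rw [coord_eq_sum v, map_sum]
    simp only [map_smul]
    exact Finset.sum_eq_zero fun i _ => by
      rw [show fderiv ℝ lam x (basisVec i) = 0 from hz i, smul_zero]
  rw [← this]
  exact hd.hasFDerivAt

end IsNormalAt

end Schur

/-! ### Charts of `M` and of `TM`, and the metric under a change of chart -/

section Charts

variable {n : ℕ} {M : Type*} [TopologicalSpace M] [ChartedSpace (Coord n) M]

/-- The tangent vector with coordinates `(x, w)` in the chart of `TM` induced by `e`. -/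
def bundlePoint (e : OpenPartialHomeomorph M (Coord n)) (z : Coord n × Coord n) :
    TangentBundle (𝓡 n) M :=
  ⟨e.symm z.1, mfderiv (𝓡 n) (𝓡 n) e.symm z.1 z.2⟩

variable {e e' : OpenPartialHomeomorph M (Coord n)}

theorem mdifferentiable_of_mem_maximalAtlas (he : e ∈ IsManifold.maximalAtlas (𝓡 n) ∞ M) :
    e.MDifferentiable (𝓡 n) (𝓡 n) :=
  ⟨(contMDiffOn_of_mem_maximalAtlas he).mdifferentiableOn (by simp),
    (contMDiffOn_symm_of_mem_maximalAtlas he).mdifferentiableOn (by simp)⟩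

theorem mfderiv_mfderiv_symm (he : e ∈ IsManifold.maximalAtlas (𝓡 n) ∞ M) {x : Coord n}
    (hx : x ∈ e.target) (w : Coord n) :
    mfderiv (𝓡 n) (𝓡 n) e (e.symm x) (mfderiv (𝓡 n) (𝓡 n) e.symm x w) = w := by
  have := (mdifferentiable_of_mem_maximalAtlas he).comp_symm_deriv hx
  exact congrArg (fun L => L w) this

theorem mfderiv_symm_mfderiv (he : e ∈ IsManifold.maximalAtlas (𝓡 n) ∞ M) {p : M}
    (hp : p ∈ e.source) (w : TangentSpace (𝓡 n) p) :
    (mfderiv (𝓡 n) (𝓡 n) e.symm (e p) (mfderiv (𝓡 n) (𝓡 n) e p w) : Coord n) = w := by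
  have := (mdifferentiable_of_mem_maximalAtlas he).symm_comp_deriv hp
  exact congrArg (fun L => L w) this

theorem contMDiff_tangentBundle_mk :
    ContMDiff 𝓘(ℝ, Coord n × Coord n) (𝓡 n).tangent ∞
      (fun z : Coord n × Coord n => (⟨z.1, z.2⟩ : TangentBundle (𝓡 n) (Coord n))) := by
  intro z
  rw [Bundle.contMDiffAt_totalSpace]
  refine ⟨contDiffAt_fst.contMDiffAt, ?_⟩
  simpa using contDiffAt_snd.contMDiffAt

theorem bundleCoord_bundlePoint (he : e ∈ IsManifold.maximalAtlas (𝓡 n) ∞ M)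
    {z : Coord n × Coord n} (hz : z.1 ∈ e.target) : bundleCoord e (bundlePoint e z) = z := by
  refine Prod.ext ?_ ?_
  · exact e.right_inv hz
  · exact mfderiv_mfderiv_symm he hz z.2

theorem contDiffAt_transition (he : e ∈ IsManifold.maximalAtlas (𝓡 n) ∞ M)
    (he' : e' ∈ IsManifold.maximalAtlas (𝓡 n) ∞ M) {y : Coord n} (hy : y ∈ e'.target)
    (hye : e'.symm y ∈ e.source) : ContDiffAt ℝ ∞ (fun z => e (e'.symm z)) y :=
  ((contMDiffAt_of_mem_maximalAtlas he hye).comp y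
    (contMDiffAt_symm_of_mem_maximalAtlas he' hy)).contDiffAt

omit [ChartedSpace (Coord n) M] in
theorem eventually_mem_source {y : Coord n} (hy : y ∈ e'.target) (hye : e'.symm y ∈ e.source) :
    ∀ᶠ z in 𝓝 y, z ∈ e'.target ∧ e'.symm z ∈ e.source :=
  (e'.open_target.eventually_mem hy).and
    ((e'.continuousAt_symm hy).preimage_mem_nhds (e.open_source.mem_nhds hye))

variable [IsManifold (𝓡 n) ∞ M]

/-- On the domain of the chart, `bundlePoint e` is the tangent map of `e.symm` after the
identification of the tangent bundle of ℝⁿ with a product. -/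
theorem contMDiffOn_bundlePoint (he : e ∈ IsManifold.maximalAtlas (𝓡 n) ∞ M) :
    ContMDiffOn 𝓘(ℝ, Coord n × Coord n) (𝓡 n).tangent ∞ (bundlePoint e)
      (Prod.fst ⁻¹' e.target) := by
  have h := (contMDiffOn_symm_of_mem_maximalAtlas he).contMDiffOn_tangentMapWithin
    (m := ∞) le_rfl e.open_target.uniqueMDiffOn
  refine (h.comp contMDiff_tangentBundle_mk.contMDiffOn (s := Prod.fst ⁻¹' e.target)
    (fun z hz => hz)).congr fun z hz => ?_
  symm
  refine tangentMapWithin_eq_tangentMap (e.open_target.uniqueMDiffWithinAt hz) ?_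
  exact (mdifferentiable_of_mem_maximalAtlas he).mdifferentiableAt_symm hz

theorem contMDiffOn_bundleCoord (he : e ∈ IsManifold.maximalAtlas (𝓡 n) ∞ M) :
    ContMDiffOn (𝓡 n).tangent 𝓘(ℝ, Coord n × Coord n) ∞ (bundleCoord e)
      (Bundle.TotalSpace.proj ⁻¹' e.source) := by
  have h1 := contMDiffOn_of_mem_maximalAtlas he
  have h := h1.contMDiffOn_tangentMapWithin (m := ∞) le_rfl e.open_source.uniqueMDiffOn
  refine ((h1.comp (Bundle.contMDiff_proj _).contMDiffOn fun z hz => hz).prodMk_space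
    ((contMDiff_snd_tangentBundle_modelSpace (Coord n) (𝓡 n)).comp_contMDiffOn h)).congr
    fun z hz => ?_
  have := tangentMapWithin_eq_tangentMap (e.open_source.uniqueMDiffWithinAt hz)
    ((mdifferentiable_of_mem_maximalAtlas he).mdifferentiableAt hz)
  exact Prod.ext rfl (congrArg (fun v : TangentBundle (𝓡 n) (Coord n) => (v.2 : Coord n)) this.symm)

/-- The components of the metric as a bilinear form. -/
theorem chartMetric_inner (g : RiemMetric n M) (x a b : Coord n) :
    g.inner (e.symm x) (mfderiv (𝓡 n) (𝓡 n) e.symm x a) (mfderiv (𝓡 n) (𝓡 n) e.symm x b)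
      = pairing (chartMetric g e x) a b := by
  let L : Coord n →L[ℝ] TangentSpace (𝓡 n) (e.symm x) := mfderiv (𝓡 n) (𝓡 n) e.symm x
  change g.inner (e.symm x) (L a) (L b) = ∑ i, ∑ j, g.inner (e.symm x) (L (basisVec i))
    (L (basisVec j)) * (a i * b j)
  have h1 : L a = ∑ i, a i • L (basisVec i) := by
    conv_lhs => rw [coord_eq_sum a]
    rw [map_sum]; simp only [map_smul]
  have h2 : L b = ∑ i, b i • L (basisVec i) := by
    conv_lhs => rw [coord_eq_sum b]
    rw [map_sum]; simp only [map_smul]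
  rw [h1, h2]
  simp only [map_sum, map_smul, sum_apply, smul_apply, smul_eq_mul, Finset.mul_sum]
  rw [Finset.sum_comm]
  refine Finset.sum_congr rfl fun i _ => Finset.sum_congr rfl fun j _ => ?_
  ring

theorem chartMetric_symm (g : RiemMetric n M) (x : Coord n) (i j : Fin n) :
    chartMetric g e x i j = chartMetric g e x j i := g.symm _ _ _

theorem chartMetric_pos (g : RiemMetric n M) (he : e ∈ IsManifold.maximalAtlas (𝓡 n) ∞ M)
    {x : Coord n} (hx : x ∈ e.target) {a : Coord n} (ha : a ≠ 0) :
    0 < pairing (chartMetric g e x) a a := by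
  rw [← chartMetric_inner]
  refine g.pos _ _ fun h => ha ?_
  have := mfderiv_mfderiv_symm he hx a
  rw [h, map_zero] at this
  exact this.symm

theorem chartMetric_posDef (g : RiemMetric n M) (he : e ∈ IsManifold.maximalAtlas (𝓡 n) ∞ M)
    {x : Coord n} (hx : x ∈ e.target) : (chartMetric g e x).PosDef := by
  refine Matrix.PosDef.of_dotProduct_mulVec_pos ?_ fun a ha => ?_
  · ext i j
    exact chartMetric_symm g x j i
  · have := chartMetric_pos g he hx (a := WithLp.toLp 2 a) (fun h => ha (by simpa using h))
    simp only [pairing] at this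
    simp only [dotProduct, Matrix.mulVec, Finset.mul_sum, star_trivial]
    refine this.trans_eq (Finset.sum_congr rfl fun i _ => Finset.sum_congr rfl fun j _ => ?_)
    ring

theorem chartMetric_det_ne_zero (g : RiemMetric n M)
    (he : e ∈ IsManifold.maximalAtlas (𝓡 n) ∞ M)
    {x : Coord n} (hx : x ∈ e.target) : (chartMetric g e x).det ≠ 0 :=
  (chartMetric_posDef g he hx).det_pos.ne'

theorem contDiffAt_chartMetric (g : RiemMetric n M)
    (he : e ∈ IsManifold.maximalAtlas (𝓡 n) ∞ M) {x : Coord n} (hx : x ∈ e.target) (i j : Fin n) :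
    ContDiffAt ℝ ∞ (fun y => chartMetric g e y i j) x := by
  have hs : ∀ i : Fin n, ContMDiffAt (𝓡 n) (𝓡 n).tangent ∞
      (fun y => bundlePoint e (y, basisVec i)) x := fun i =>
    ((contMDiffOn_bundlePoint he).contMDiffAt
      ((e.open_target.preimage continuous_fst).mem_nhds (by exact hx))).comp x
      (contMDiffAt_id.prodMk_space contMDiffAt_const)
  have hg := (g.contMDiff (e.symm x)).comp x (contMDiffAt_symm_of_mem_maximalAtlas he hx)
  have := ContMDiffAt.clm_bundle_apply₂ (F₁ := Coord n) (F₂ := Coord n) (F₃ := ℝ)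
    (E₃ := fun _ : M => ℝ) hg (hs i) (hs j)
  rw [Bundle.contMDiffAt_totalSpace] at this
  exact this.2.contDiffAt

theorem inner_congr (g : RiemMetric n M) {p q : M} (h : p = q) {a b : TangentSpace (𝓡 n) p}
    {a' b' : TangentSpace (𝓡 n) q} (ha : (a : Coord n) = a') (hb : (b : Coord n) = b') :
    g.inner p a b = g.inner q a' b' := by
  subst h
  change a = a' at ha
  change b = b' at hb
  rw [ha, hb]

theorem jacobian_apply {φ : Coord n → Coord n} {y : Coord n} (hφ : DifferentiableAt ℝ φ y)
    (a j : Fin n) : jacobian φ y a j = fderiv ℝ φ y (basisVec j) a := by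
  have := (EuclideanSpace.proj a : Coord n →L[ℝ] ℝ).hasFDerivAt.comp y hφ.hasFDerivAt
  exact congrArg (fun L => L (basisVec j)) this.fderiv

/-- Chain rule for `e'.symm` factored locally as `e.symm` after the transition map. -/
theorem chartMetric_transition (g : RiemMetric n M)
    (he : e ∈ IsManifold.maximalAtlas (𝓡 n) ∞ M)
    (he' : e' ∈ IsManifold.maximalAtlas (𝓡 n) ∞ M) {y : Coord n} (hy : y ∈ e'.target)
    (hye : e'.symm y ∈ e.source) :
    chartMetric g e' y = pullbackMetric (fun z => e (e'.symm z)) (chartMetric g e) y := by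
  have hφ := (contDiffAt_transition he he' hy hye).differentiableAt (by simp)
  have hev : e'.symm =ᶠ[𝓝 y] e.symm ∘ fun z => e (e'.symm z) := by
    have := (e'.continuousAt_symm hy).preimage_mem_nhds (e.open_source.mem_nhds hye)
    filter_upwards [this] with z hz
    exact (e.left_inv hz).symm
  have hL : ∀ w : Coord n, (mfderiv (𝓡 n) (𝓡 n) e'.symm y w : Coord n)
      = mfderiv (𝓡 n) (𝓡 n) e.symm (e (e'.symm y)) (fderiv ℝ (fun z => e (e'.symm z)) y w) := by
    intro w
    have h1 := hev.mfderiv_eq (I := 𝓡 n) (I' := 𝓡 n)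
    have h2 := mfderiv_comp (I := 𝓡 n) (I' := 𝓡 n) (I'' := 𝓡 n) y
      ((mdifferentiable_of_mem_maximalAtlas he).mdifferentiableAt_symm (e.map_source hye))
      hφ.mdifferentiableAt
    rw [mfderiv_eq_fderiv] at h2
    exact (congrArg (fun L : Coord n →L[ℝ] Coord n => L w) h1).trans
      (congrArg (fun L : Coord n →L[ℝ] Coord n => L w) h2)
  ext j k
  rw [pullbackMetric_apply]
  simp only [jacobian_apply hφ]
  rw [← pairing, ← chartMetric_inner]
  exact inner_congr g (e.left_inv hye).symm (hL _) (hL _)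

/-- The Jacobian determinant is a factor of the determinant of the metric matrix, which is positive
definite. -/
theorem det_jacobian_transition_ne_zero (g : RiemMetric n M)
    (he : e ∈ IsManifold.maximalAtlas (𝓡 n) ∞ M)
    (he' : e' ∈ IsManifold.maximalAtlas (𝓡 n) ∞ M) {y : Coord n} (hy : y ∈ e'.target)
    (hye : e'.symm y ∈ e.source) : (jacobian (fun z => e (e'.symm z)) y).det ≠ 0 := by
  have h := chartMetric_det_ne_zero g he' hy
  rw [chartMetric_transition g he he' hy hye, pullbackMetric, Matrix.det_mul] at h
  exact right_ne_zero_of_mul h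

theorem ricci_chartMetric_transition (g : RiemMetric n M)
    (he : e ∈ IsManifold.maximalAtlas (𝓡 n) ∞ M)
    (he' : e' ∈ IsManifold.maximalAtlas (𝓡 n) ∞ M) {y : Coord n} (hy : y ∈ e'.target)
    (hye : e'.symm y ∈ e.source) (j k : Fin n) :
    ricci (chartMetric g e') y j k
      = ∑ a, ∑ b, ricci (chartMetric g e) (e (e'.symm y)) a b
        * (jacobian (fun z => e (e'.symm z)) y a j * jacobian (fun z => e (e'.symm z)) y b k) := by
  have hev : chartMetric g e' =ᶠ[𝓝 y]
      pullbackMetric (fun z => e (e'.symm z)) (chartMetric g e) := by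
    filter_upwards [eventually_mem_source hy hye] with z hz
    exact chartMetric_transition g he he' hz.1 hz.2
  rw [ricci_congr hev]
  have ht := e.map_source hye
  exact ricci_pullbackMetric (contDiffAt_transition he he' hy hye)
    (contDiffAt_chartMetric g he ht) (Filter.Eventually.of_forall fun x => chartMetric_symm g x)
    (chartMetric_det_ne_zero g he ht) (det_jacobian_transition_ne_zero g he he' hy hye) j k

end Charts

/-! ### Coordinates in which the metric is the identity to first order -/

section NormalCoordinates

variable {n : ℕ} {G : Coord n → Matrix (Fin n) (Fin n) ℝ} {x : Coord n}

/-- A metric is normal at a point where it is the identity and its Christoffel symbols vanish. -/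
theorem IsNormalAt.of_christoffel_eq_zero (smooth : ∀ i j, ContDiffAt ℝ ∞ (fun y => G y i j) x)
    (symm : ∀ᶠ y in 𝓝 x, ∀ i j, G y i j = G y j i) (eq_one : G x = 1)
    (h : ∀ k i j, christoffel G k i j x = 0) : IsNormalAt G x := by
  refine ⟨smooth, symm, eq_one, fun i j => ?_⟩
  have hs : ∀ k i j, partialDeriv k (fun y => G y i j) x = partialDeriv k (fun y => G y j i) x :=
    fun k i j => partialDeriv_congr (symm.mono fun y hy => hy i j) k
  have hd : (G x).det ≠ 0 := by rw [eq_one]; simp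
  have hl : ∀ l i j, partialDeriv i (fun y => G y j l) x + partialDeriv j (fun y => G y i l) x
      - partialDeriv l (fun y => G y i j) x = 0 := by
    -- Lowering an index turns the vanishing Christoffel symbols into linear relations among first
    -- derivatives of `G`; adding two of them isolates a single derivative.
    intro l i j
    have := sum_mul_christoffel hd l i j
    simp only [h, mul_zero, Finset.sum_const_zero] at this
    linarith
  have hp : ∀ k, partialDeriv k (fun y => G y i j) x = 0 := by
    intro k
    have h1 := hl i k j
    have h2 := hl j k i
    have := hs k i j
    have := hs i k j
    have := hs j k i
    have := hs i j k
    have := hs j i k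
    linarith
  ext v
  rw [coord_eq_sum v, map_sum]
  simp only [map_smul]
  exact Finset.sum_eq_zero fun k _ => by
    rw [show fderiv ℝ (fun y => G y i j) x (basisVec k) = 0 from hp k, smul_zero]

theorem IsNormalAt.congr {G' : Coord n → Matrix (Fin n) (Fin n) ℝ} (h : IsNormalAt G x)
    (hG : G' =ᶠ[𝓝 x] G) : IsNormalAt G' x where
  smooth i j := (h.smooth i j).congr_of_eventuallyEq (hG.mono fun y hy => congrFun₂ hy i j)
  symm := by filter_upwards [h.symm, hG] with y hy hy'; rw [hy']; exact hy
  eq_one := by rw [hG.eq_of_nhds, h.eq_one]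
  fderiv_eq_zero i j := by
    have : (fun y => G' y i j) =ᶠ[𝓝 x] fun y => G y i j := hG.mono fun y hy => congrFun₂ hy i j
    rw [this.fderiv_eq, h.fderiv_eq_zero]

/-- Take φ(y) = x + T y - ½ Γ(T y, T y). The linear part makes the metric the identity at the
origin; the quadratic part cancels Γ in the transformation law. -/
theorem exists_normalizing_map (smooth : ∀ i j, ContDiffAt ℝ ∞ (fun y => G y i j) x)
    (symm : ∀ᶠ y in 𝓝 x, ∀ i j, G y i j = G y j i) (pos : (G x).PosDef) :
    ∃ φ : Coord n → Coord n, ContDiff ℝ ∞ φ ∧ φ 0 = x ∧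
      (∃ L : Coord n ≃L[ℝ] Coord n, HasFDerivAt φ (L : Coord n →L[ℝ] Coord n) 0) ∧
      IsNormalAt (pullbackMetric φ G) 0 := by
  classical
  -- Positivity gives G x = Bᵀ B with B invertible; take A = B⁻¹.
  obtain ⟨A, hA⟩ : ∃ A : Matrix (Fin n) (Fin n) ℝ, A.transpose * G x * A = 1 := by
    open scoped MatrixOrder in
    obtain ⟨B, hB⟩ := CStarAlgebra.nonneg_iff_eq_star_mul_self.mp pos.posSemidef.nonneg
    rw [Matrix.star_eq_conjTranspose, Matrix.conjTranspose_eq_transpose_of_trivial] at hB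
    have hBu : IsUnit B.det := by
      have := pos.det_pos.ne'
      rw [hB, Matrix.det_mul] at this
      exact isUnit_iff_ne_zero.2 (right_ne_zero_of_mul this)
    refine ⟨B⁻¹, ?_⟩
    rw [hB, Matrix.mul_assoc, Matrix.mul_assoc, Matrix.mul_nonsing_inv _ hBu, Matrix.mul_one,
      ← Matrix.transpose_mul, Matrix.mul_nonsing_inv _ hBu, Matrix.transpose_one]
  have hAdet : A.det ≠ 0 := by
    intro h
    have := congrArg Matrix.det hA
    simp [Matrix.det_mul, h] at this
  set T : Coord n →L[ℝ] Coord n := Matrix.toEuclideanCLM (n := Fin n) (𝕜 := ℝ) A with hT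
  have hTb : ∀ i j, (T (basisVec j)) i = A i j := by
    intro i j
    rw [hT, Matrix.ofLp_toEuclideanCLM]
    simp
  obtain ⟨L, hL⟩ : ∃ L : Coord n ≃L[ℝ] Coord n, (L : Coord n →L[ℝ] Coord n) = T := by
    have : IsUnit T := ((Matrix.isUnit_iff_isUnit_det A).2 (isUnit_iff_ne_zero.2 hAdet)).map
      (Matrix.toEuclideanCLM (n := Fin n) (𝕜 := ℝ))
    obtain ⟨U, hU⟩ := this
    refine ⟨ContinuousLinearEquiv.unitsEquiv ℝ _ U, ?_⟩
    ext v
    rw [← hU]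
    rfl
  let P : Fin n → (Coord n →L[ℝ] ℝ) := fun a => (EuclideanSpace.proj a).comp T
  let f : Fin n → Coord n → ℝ := fun a y => x a + P a y
    + (-1 / 2) * ∑ i, ∑ j, christoffel G a i j x * (P i y * P j y)
  let φ : Coord n → Coord n := fun y => WithLp.toLp 2 fun a => f a y
  have hsym := christoffel_symm symm
  have hf : ∀ a, HasJet (f a) 0 (x a) (fun v => P a v)
      (fun v w => -∑ i, ∑ j, christoffel G a i j x * (P i v * P j w)) := by
    intro a
    refine (((HasJet.const (x a)).add (HasJet.clm (P a))).add (HasJet.const_mul (-1 / 2)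
      (HasJet.sum _ fun i _ => HasJet.sum _ fun j _ => HasJet.const_mul (christoffel G a i j x)
        ((HasJet.clm (P i)).mul (HasJet.clm (P j)))))).of_eq ?_ ?_ ?_
    · simp
    · intro v; simp
    · intro v w
      have hswap : ∑ i, ∑ j, christoffel G a i j x * (P i w * P j v)
          = ∑ i, ∑ j, christoffel G a i j x * (P i v * P j w) := by
        rw [Finset.sum_comm]
        refine Finset.sum_congr rfl fun i _ => Finset.sum_congr rfl fun j _ => ?_
        rw [hsym a j i]; ring
      simp only [map_zero, mul_zero, add_zero, zero_add, mul_add,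
        Finset.sum_add_distrib, hswap]
      ring
  have hφ : ContDiff ℝ ∞ φ := by
    refine contDiff_euclidean.2 fun a => ?_
    have hP : ∀ i, ContDiff ℝ ∞ (P i) := fun i => (P i).contDiff
    change ContDiff ℝ ∞ fun y => x a + P a y
      + (-1 / 2) * ∑ i, ∑ j, christoffel G a i j x * (P i y * P j y)
    exact (contDiff_const.add (hP a)).add (contDiff_const.mul (ContDiff.sum fun i _ =>
      ContDiff.sum fun j _ => contDiff_const.mul ((hP i).mul (hP j))))
  have hφ0 : φ 0 = x := by ext a; exact (hf a).val
  have hJ : jacobian φ 0 = A := by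
    ext a j
    exact ((hf a).d1 (basisVec j)).trans (hTb a j)
  have hdet := pos.det_pos.ne'
  have hcomp : ∀ i j, ContDiffAt ℝ ∞ (fun y => pullbackMetric φ G y i j) 0 := by
    intro i j
    have hGφ : ∀ a b, ContDiffAt ℝ ∞ (fun z => G (φ z) a b) 0 := fun a b =>
      ContDiffAt.comp (g := fun x => G x a b) (f := φ) 0 (by rw [hφ0]; exact smooth a b)
        hφ.contDiffAt
    simp only [pullbackMetric_apply]
    exact ContDiffAt.sum fun a _ => ContDiffAt.sum fun b _ => (hGφ a b).mul
      ((contDiffAt_jacobian hφ.contDiffAt a i).mul (contDiffAt_jacobian hφ.contDiffAt b j))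
  refine ⟨φ, hφ, hφ0, ⟨L, ?_⟩, IsNormalAt.of_christoffel_eq_zero hcomp ?_ ?_ ?_⟩
  · rw [hL]
    rw [← hasFDerivWithinAt_univ]
    refine hasFDerivWithinAt_euclidean.2 fun a => ?_
    rw [hasFDerivWithinAt_univ]
    have := (hf a).differentiableAt.hasFDerivAt
    rwa [show fderiv ℝ (f a) 0 = P a from ContinuousLinearMap.ext (hf a).d1] at this
  · have := hφ.continuous.continuousAt (x := 0)
    rw [ContinuousAt, hφ0] at this
    filter_upwards [this.eventually symm] with y hy i j
    rw [pullbackMetric_apply, pullbackMetric_apply, Finset.sum_comm]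
    refine Finset.sum_congr rfl fun a _ => Finset.sum_congr rfl fun b _ => ?_
    rw [hy b a]; ring
  · rw [pullbackMetric, hJ, hφ0, hA]
  · intro l j k
    -- The transformed symbols equal the Hessian of φ plus the old symbols applied to A, and these
    -- two are opposite by the choice of φ.
    have h0 : A.mulVec (fun l => christoffel (pullbackMetric φ G) l j k 0) = 0 := by
      ext m
      have h1 := jacobian_mul_christoffel (G := G) (φ := φ) (y := 0)
        (hφ.contDiffAt.of_le two_le_infty)
        (fun a b => by rw [hφ0]; exact (smooth a b).differentiableAt (by simp))
        (by rw [hφ0]; exact symm.self_of_nhds) (by rw [hφ0]; exact hdet)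
        (by rw [hJ]; exact hAdet) m j k
      have h2 : partialDeriv j (fun z => jacobian φ z m k) 0
          = -∑ a, ∑ b, christoffel G m a b x * (A a j * A b k) := by
        refine ((hf m).d2 (basisVec j) (basisVec k)).trans ?_
        have hP : ∀ a j, P a (basisVec j) = A a j := hTb
        simp only [hP]
      rw [h2, hJ, hφ0, neg_add_cancel] at h1
      exact h1
    exact congrFun (Matrix.eq_zero_of_mulVec_eq_zero hAdet h0) l

end NormalCoordinates

/-! ### Existence of normal charts on the manifold -/

section NormalChart

variable {n : ℕ} {M : Type*} [TopologicalSpace M] [ChartedSpace (Coord n) M]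
  [IsManifold (𝓡 n) ∞ M]

theorem exists_normal_chart (g : RiemMetric n M) (p : M) :
    ∃ e ∈ IsManifold.maximalAtlas (𝓡 n) ∞ M, p ∈ e.source ∧ e p = 0 ∧
      IsNormalAt (chartMetric g e) 0 := by
  set e₀ := chartAt (Coord n) p
  have he₀ : e₀ ∈ IsManifold.maximalAtlas (𝓡 n) ∞ M := IsManifold.chart_mem_maximalAtlas p
  have hp : p ∈ e₀.source := mem_chart_source _ p
  have ht : e₀ p ∈ e₀.target := e₀.map_source hp
  obtain ⟨φ, hφ, hφ0, ⟨L, hL⟩, hN⟩ := exists_normalizing_map (contDiffAt_chartMetric g he₀ ht)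
    (Filter.Eventually.of_forall fun x => chartMetric_symm g x) (chartMetric_posDef g he₀ ht)
  have hi : (∞ : WithTop ℕ∞) ≠ 0 := by simp
  let χ₀ := hφ.contDiffAt.toOpenPartialHomeomorph φ hL hi
  -- Restricting to the open set where the derivative of φ is invertible makes the local inverse
  -- smooth on its whole domain, as membership in the maximal atlas requires.
  let s : Set (Coord n) :=
    fderiv ℝ φ ⁻¹' Set.range ((↑) : (Coord n ≃L[ℝ] Coord n) → Coord n →L[ℝ] Coord n)
  have hs : IsOpen s := ContinuousLinearEquiv.isOpen.preimage (hφ.continuous_fderiv hi)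
  let χ := χ₀.restrOpen s hs
  have h0 : (0 : Coord n) ∈ χ.source :=
    ⟨hφ.contDiffAt.mem_toOpenPartialHomeomorph_source hL hi, L, hL.fderiv.symm⟩
  have hχs : ContDiffOn ℝ ∞ χ.symm χ.target := by
    intro y hy
    obtain ⟨L', hL'⟩ : χ.symm y ∈ s := (χ.map_target hy).2
    refine (χ.contDiffAt_symm (f₀' := L') hy ?_ hφ.contDiffAt).contDiffWithinAt
    rw [hL']
    exact (hφ.differentiable hi _).hasFDerivAt
  let e := e₀.trans χ.symm
  have he : e ∈ IsManifold.maximalAtlas (𝓡 n) ∞ M := by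
    refine e.mem_maximalAtlas_of_contMDiffOn ?_ ?_
    · exact hχs.contMDiffOn.comp ((contMDiffOn_of_mem_maximalAtlas he₀).mono fun q hq => hq.1)
        fun q hq => hq.2
    · exact (contMDiffOn_symm_of_mem_maximalAtlas he₀).comp (hφ.contMDiff.contMDiffOn)
        fun q hq => hq.2
  have hχ0 : χ 0 = e₀ p := hφ0
  have hpe : p ∈ e.source := ⟨hp, by
    change e₀ p ∈ χ.target
    rw [← hχ0]; exact χ.map_source h0⟩
  have hep : e p = 0 := by
    change χ.symm (e₀ p) = 0
    rw [← hχ0]; exact χ.left_inv h0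
  refine ⟨e, he, hpe, hep, ?_⟩
  have h0t : (0 : Coord n) ∈ e.target := hep ▸ e.map_source hpe
  have h0s : e.symm 0 = p := by rw [← hep]; exact e.left_inv hpe
  have hev : ∀ᶠ z in 𝓝 (0 : Coord n), e₀ (e.symm z) = φ z := by
    filter_upwards [e.open_target.mem_nhds h0t] with z hz
    exact e₀.right_inv hz.2
  have hG : chartMetric g e =ᶠ[𝓝 0] pullbackMetric φ (chartMetric g e₀) := by
    filter_upwards [eventually_mem_source (e := e₀) h0t (by rw [h0s]; exact hp),
      hev.eventually_nhds] with z hz hz'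
    rw [chartMetric_transition g he₀ he hz.1 hz.2, pullbackMetric, pullbackMetric,
      hz'.self_of_nhds]
    have : jacobian (fun z => e₀ (e.symm z)) z = jacobian φ z := by
      ext a j
      exact partialDeriv_congr (hz'.mono fun y hy => congrArg (fun v : Coord n => v a) hy) j
    rw [this]
  exact hN.congr hG

end NormalChart

/-! ### Normalised vectors and their covariant derivative -/

section UnitFibre

variable {m n : ℕ}

theorem pairing_add_left (A : Matrix (Fin n) (Fin n) ℝ) (a b c : Fin n → ℝ) :
    pairing A (a + b) c = pairing A a c + pairing A b c := by
  simp only [pairing, ← Finset.sum_add_distrib, Pi.add_apply]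
  exact Finset.sum_congr rfl fun k _ => Finset.sum_congr rfl fun l _ => by ring

theorem pairing_smul_left (A : Matrix (Fin n) (Fin n) ℝ) (r : ℝ) (a c : Fin n → ℝ) :
    pairing A (r • a) c = r * pairing A a c := by
  simp only [pairing, Finset.mul_sum, Pi.smul_apply, smul_eq_mul]
  exact Finset.sum_congr rfl fun k _ => Finset.sum_congr rfl fun l _ => by ring

theorem pairing_comm {A : Matrix (Fin n) (Fin n) ℝ} (hA : ∀ i j, A i j = A j i)
    (a c : Fin n → ℝ) : pairing A a c = pairing A c a := by
  rw [pairing, Finset.sum_comm, pairing]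
  exact Finset.sum_congr rfl fun k _ => Finset.sum_congr rfl fun l _ => by rw [hA l k]; ring

variable {G : Coord n → Matrix (Fin n) (Fin n) ℝ} {X V : Coord m →L[ℝ] Coord n} {u : Coord n}
  {y : Coord m}

/-- The squared length of `u + V y`. -/
def fibreNormSq (G : Coord n → Matrix (Fin n) (Fin n) ℝ) (X V : Coord m →L[ℝ] Coord n)
    (u : Coord n) (y : Coord m) : ℝ :=
  pairing (G (X y)) (u + V y).ofLp (u + V y).ofLp

/-- The unit vector in the direction of `u + V y`. -/
def unitFibre (G : Coord n → Matrix (Fin n) (Fin n) ℝ) (X V : Coord m →L[ℝ] Coord n)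
    (u : Coord n) (y : Coord m) : Coord n :=
  (Real.sqrt (fibreNormSq G X V u y))⁻¹ • (u + V y)

/-- The vertical part of the derivative of `y ↦ (X y, u + V y)`. -/
def fibreVertical (G : Coord n → Matrix (Fin n) (Fin n) ℝ) (X V : Coord m →L[ℝ] Coord n)
    (u : Coord n) (y v : Coord m) : Fin n → ℝ :=
  verticalPart (fun k i j => christoffel G k i j (X y)) (X v).ofLp (V v).ofLp (u + V y).ofLp

theorem contDiffAt_fibreNormSq (hG : ∀ k l, ContDiffAt ℝ ∞ (fun x => G x k l) (X y)) :
    ContDiffAt ℝ ∞ (fibreNormSq G X V u) y := by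
  unfold fibreNormSq pairing
  have hW : ∀ k, ContDiffAt ℝ ∞ (fun y => (u + V y) k) y := fun k =>
    contDiffAt_coord (contDiffAt_const.add V.contDiff.contDiffAt) k
  refine ContDiffAt.sum fun k _ => ContDiffAt.sum fun l _ => ?_
  exact (ContDiffAt.comp (g := fun x => G x k l) (f := X) y (hG k l) X.contDiff.contDiffAt).mul
    ((hW k).mul (hW l))

theorem contDiffAt_unitFibre (hG : ∀ k l, ContDiffAt ℝ ∞ (fun x => G x k l) (X y))
    (hq : 0 < fibreNormSq G X V u y) : ContDiffAt ℝ ∞ (unitFibre G X V u) y :=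
  (((contDiffAt_fibreNormSq hG).sqrt hq.ne').inv (Real.sqrt_pos.2 hq).ne').smul
    (contDiffAt_const.add V.contDiff.contDiffAt)

/-- Compatibility of the connection with the metric, along a curve of vectors. -/
theorem fderiv_fibreNormSq (hG : ∀ k l, ContDiffAt ℝ ∞ (fun x => G x k l) (X y))
    (hsymm : ∀ᶠ x in 𝓝 (X y), ∀ i j, G x i j = G x j i) (hdet : (G (X y)).det ≠ 0)
    (v : Coord m) :
    fderiv ℝ (fibreNormSq G X V u) y v
      = 2 * pairing (G (X y)) (fibreVertical G X V u y v) (u + V y).ofLp := by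
  have hd : ∀ k l, DifferentiableAt ℝ (fun x => G x k l) (X y) := fun k l =>
    (hG k l).differentiableAt (by simp)
  set W : Fin n → ℝ := (u + V y).ofLp with hWdef
  have hW : ∀ k, HasFDerivAt (fun y => (u + V y) k)
      ((EuclideanSpace.proj k : Coord n →L[ℝ] ℝ).comp V) y := fun k => by
    have := ((EuclideanSpace.proj k : Coord n →L[ℝ] ℝ).comp V).hasFDerivAt (x := y)
    exact this.const_add (u k)
  have hGX : ∀ k l, HasFDerivAt (fun y => G (X y) k l)
      ((fderiv ℝ (fun x => G x k l) (X y)).comp X) y := fun k l =>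
    HasFDerivAt.comp (g := fun x => G x k l) y (hd k l).hasFDerivAt X.hasFDerivAt
  have hq := HasFDerivAt.fun_sum (u := Finset.univ) fun k _ =>
    HasFDerivAt.fun_sum (u := Finset.univ) fun l _ => (hGX k l).mul ((hW k).mul (hW l))
  have h1 : fderiv ℝ (fibreNormSq G X V u) y v = ∑ k, ∑ l,
      (G (X y) k l * (W k * V v l + W l * V v k)
        + W k * W l * fderiv ℝ (fun x => G x k l) (X y) (X v)) := by
    have := congrArg (fun L => L v) hq.fderiv
    refine Eq.trans this ?_
    simp only [sum_apply, add_apply, smul_apply, ContinuousLinearMap.comp_apply, smul_eq_mul,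
      Pi.mul_apply]
    rfl
  set D : Fin n → Fin n → Fin n → ℝ := fun i k l => partialDeriv i (fun x => G x k l) (X y)
  have h2 : ∀ k l, fderiv ℝ (fun x => G x k l) (X y) (X v) = ∑ i, X v i * D i k l := by
    intro k l
    conv_lhs => rw [coord_eq_sum (X v), map_sum]
    simp only [map_smul, smul_eq_mul, partialDeriv, D]
  have hD : ∀ i k l, D i k l = D i l k := fun i k l =>
    partialDeriv_congr (hsymm.mono fun x hx => hx k l) i
  have h3 : pairing (G (X y)) (fun k => ∑ i, ∑ j, christoffel G k i j (X y) * X v i * W j) W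
      = ∑ l, ∑ i, ∑ j, W l * X v i * W j * ((1 / 2) * (D i j l + D j i l - D l i j)) := by
    rw [pairing, Finset.sum_comm]
    refine Finset.sum_congr rfl fun l _ => ?_
    simp only [Finset.mul_sum, Finset.sum_mul]
    rw [Finset.sum_comm]
    refine Finset.sum_congr rfl fun i _ => ?_
    rw [Finset.sum_comm]
    refine Finset.sum_congr rfl fun j _ => ?_
    rw [← sum_mul_christoffel hdet l i j, Finset.mul_sum]
    refine Finset.sum_congr rfl fun k _ => ?_
    rw [hsymm.self_of_nhds k l]
    ring
  -- W occurs twice, so the last two terms of the Christoffel formula cancel after contraction.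
  have h4 : ∑ l, ∑ i, ∑ j, W l * X v i * W j * D j i l
      = ∑ l, ∑ i, ∑ j, W l * X v i * W j * D l i j := by
    rw [sum_rotate]
    refine Finset.sum_congr rfl fun j _ => ?_
    rw [Finset.sum_comm]
    exact Finset.sum_congr rfl fun i _ => Finset.sum_congr rfl fun l _ => by ring
  have h5 : ∑ k, ∑ l, W k * W l * ∑ i, X v i * D i k l
      = ∑ l, ∑ i, ∑ j, W l * X v i * W j * D i j l := by
    refine Finset.sum_congr rfl fun l _ => ?_
    simp only [Finset.mul_sum]
    rw [Finset.sum_comm]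
    refine Finset.sum_congr rfl fun i _ => Finset.sum_congr rfl fun j _ => ?_
    rw [hD i j l]
    ring
  have h6 : fibreVertical G X V u y v
      = (V v).ofLp + fun k => ∑ i, ∑ j, christoffel G k i j (X y) * X v i * W j := rfl
  have h7 : ∑ k, ∑ l, G (X y) k l * (W k * V v l) = pairing (G (X y)) (V v).ofLp W := by
    rw [pairing_comm hsymm.self_of_nhds, pairing]
  have h8 : ∑ k, ∑ l, G (X y) k l * (W l * V v k) = pairing (G (X y)) (V v).ofLp W := by
    simp only [pairing, mul_comm (W _)]
  rw [h1, h6, pairing_add_left, h3]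
  simp only [h2, mul_add, mul_sub, Finset.sum_add_distrib, Finset.sum_sub_distrib, h5, h7, h8]
  have h9 : ∀ E : Fin n → Fin n → Fin n → ℝ, ∑ l, ∑ i, ∑ j, W l * X v i * W j * ((1 / 2) * E l i j)
      = (1 / 2) * ∑ l, ∑ i, ∑ j, W l * X v i * W j * E l i j := fun E => by
    simp only [Finset.mul_sum]
    exact Finset.sum_congr rfl fun l _ => Finset.sum_congr rfl fun i _ =>
      Finset.sum_congr rfl fun j _ => by ring
  rw [h9 fun l i j => D i j l, h9 fun l i j => D j i l, h9 fun l i j => D l i j, h4]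
  ring

/-- The power of the inverse length is q^(-3/2) from differentiating q^(-1/2); the ½ cancels the 2
in `fderiv_fibreNormSq`. -/
theorem fderiv_unitFibre (hG : ∀ k l, ContDiffAt ℝ ∞ (fun x => G x k l) (X y))
    (hsymm : ∀ᶠ x in 𝓝 (X y), ∀ i j, G x i j = G x j i) (hdet : (G (X y)).det ≠ 0)
    (hq : 0 < fibreNormSq G X V u y) (v : Coord m) :
    fderiv ℝ (unitFibre G X V u) y v = (Real.sqrt (fibreNormSq G X V u y))⁻¹ • V v
      - ((Real.sqrt (fibreNormSq G X V u y))⁻¹ ^ 3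
        * pairing (G (X y)) (fibreVertical G X V u y v) (u + V y).ofLp) • (u + V y) := by
  have hs := Real.sqrt_pos.2 hq
  have h1 := ((contDiffAt_fibreNormSq (u := u) (V := V) hG).differentiableAt (by simp)).hasFDerivAt
  have h2 := HasDerivAt.comp_hasFDerivAt y (Real.hasDerivAt_sqrt hq.ne') h1
  have h3 := HasDerivAt.comp_hasFDerivAt y (hasDerivAt_inv hs.ne') h2
  have h4 := h3.smul ((V.hasFDerivAt (x := y)).const_add u)
  have h5 := congrArg (fun L => L v) h4.fderiv
  refine Eq.trans h5 ?_
  simp only [add_apply, smul_apply, ContinuousLinearMap.smulRight_apply, Function.comp_apply,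
    fderiv_fibreNormSq hG hsymm hdet v, smul_eq_mul]
  rw [sub_eq_add_neg, ← neg_smul]
  congr 2
  field_simp

/-- The metric `G(dπ, dπ) + G(K, K)` of the parametrization by `(X y, unitFibre y)`. -/
theorem pairing_unitFibre (hG : ∀ k l, ContDiffAt ℝ ∞ (fun x => G x k l) (X y))
    (hsymm : ∀ᶠ x in 𝓝 (X y), ∀ i j, G x i j = G x j i) (hdet : (G (X y)).det ≠ 0)
    (hq : 0 < fibreNormSq G X V u y) (I J : Fin m) :
    pairing (G (X y)) (X (basisVec I)).ofLp (X (basisVec J)).ofLp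
      + pairing (G (X y))
        (verticalPart (fun k i j => christoffel G k i j (X y)) (X (basisVec I)).ofLp
          (fderiv ℝ (unitFibre G X V u) y (basisVec I)).ofLp (unitFibre G X V u y).ofLp)
        (verticalPart (fun k i j => christoffel G k i j (X y)) (X (basisVec J)).ofLp
          (fderiv ℝ (unitFibre G X V u) y (basisVec J)).ofLp (unitFibre G X V u y).ofLp)
      = sphereMetric G X V u y I J := by
  set s := (Real.sqrt (fibreNormSq G X V u y))⁻¹ with hs
  have hs2 : s * s = (fibreNormSq G X V u y)⁻¹ := by
    rw [hs, ← mul_inv, Real.mul_self_sqrt hq.le]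
  have hsq : s * s * fibreNormSq G X V u y = 1 := by rw [hs2, inv_mul_cancel₀ hq.ne']
  set F : Coord m → ℝ := fun v => pairing (G (X y)) (fibreVertical G X V u y v) (u + V y).ofLp
    with hF
  -- The covariant derivative of W / |W| is that of W, divided by |W|, with its component along W
  -- projected out.
  have hv : ∀ v : Coord m, verticalPart (fun k i j => christoffel G k i j (X y)) (X v).ofLp
      (fderiv ℝ (unitFibre G X V u) y v).ofLp (unitFibre G X V u y).ofLp
      = s • fibreVertical G X V u y v + (-(s ^ 3 * F v)) • (u + V y).ofLp := by
    intro v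
    rw [fderiv_unitFibre hG hsymm hdet hq, ← hs]
    ext k
    simp only [verticalPart, fibreVertical, unitFibre, ← hs, hF, Pi.add_apply, Pi.smul_apply,
      smul_eq_mul, PiLp.sub_apply, PiLp.smul_apply, mul_add, Finset.mul_sum]
    have : ∀ i j, christoffel G k i j (X y) * X v i * (s * (u + V y) j)
        = s * (christoffel G k i j (X y) * X v i * (u + V y) j) := fun i j => by ring
    simp only [this]
    ring
  have hc := pairing_comm hsymm.self_of_nhds
  rw [hv, hv]
  simp only [pairing_add_left, pairing_smul_left]
  simp only [hc _ (s • _ + _), pairing_add_left, pairing_smul_left]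
  have hq' : pairing (G (X y)) (u + V y).ofLp (u + V y).ofLp = fibreNormSq G X V u y := rfl
  have hF' : ∀ v, pairing (G (X y)) (fibreVertical G X V u y v) (u + V y).ofLp = F v := fun v => rfl
  rw [hq', hF', hc (u + V y).ofLp, hF', hc (fibreVertical G X V u y _) (fibreVertical G X V u y _)]
  have hR : sphereMetric G X V u y I J
      = pairing (G (X y)) (X (basisVec I)).ofLp (X (basisVec J)).ofLp
        + pairing (G (X y)) (fibreVertical G X V u y (basisVec I))
          (fibreVertical G X V u y (basisVec J)) * (fibreNormSq G X V u y)⁻¹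
        - F (basisVec I) * F (basisVec J)
          * ((fibreNormSq G X V u y)⁻¹ * (fibreNormSq G X V u y)⁻¹) := rfl
  rw [hR, ← hs2]
  linear_combination (exp := 1) (s ^ 4 * F (basisVec I) * F (basisVec J)) * hsq

end UnitFibre

/-! ### The sphere parametrization as a local parametrization of the unit tangent bundle -/

section SphereParam

variable {n : ℕ} {M : Type*} [TopologicalSpace M] [ChartedSpace (Coord n) M]
  [IsManifold (𝓡 n) ∞ M] {g : RiemMetric n M} {e : OpenPartialHomeomorph M (Coord n)}
  {X V : Coord (2 * n - 1) →L[ℝ] Coord n} {u : Coord n} {v₀ : UnitTangentBundle g}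
  {y : Coord (2 * n - 1)}

open Classical in
/-- The tangent vector `v` if it is a unit vector, and `v₀` otherwise. -/
def unitOr (v₀ : UnitTangentBundle g) (v : TangentBundle (𝓡 n) M) : UnitTangentBundle g :=
  if h : g.inner v.1 v.2 v.2 = 1 then ⟨v, h⟩ else v₀

/-- The parametrization of the unit tangent bundle by the point with coordinates `X y` and the
unit vector in the direction of `u + V y`; the value is `v₀` where this makes no sense. -/
def sphereParam (g : RiemMetric n M) (e : OpenPartialHomeomorph M (Coord n))
    (X V : Coord (2 * n - 1) →L[ℝ] Coord n) (u : Coord n) (v₀ : UnitTangentBundle g)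
    (y : Coord (2 * n - 1)) : UnitTangentBundle g :=
  unitOr v₀ (bundlePoint e (X y, unitFibre (chartMetric g e) X V u y))

theorem add_ne_zero_of_orth (hu : u.ofLp ⬝ᵥ u.ofLp = 1) {v : Coord n}
    (hv : v.ofLp ⬝ᵥ u.ofLp = 0) : u + v ≠ 0 := by
  intro h
  have : (u + v).ofLp ⬝ᵥ u.ofLp = 0 := by rw [h]; simp
  rw [WithLp.ofLp_add, add_dotProduct] at this
  simp [hu, hv] at this

theorem fibreNormSq_pos (he : e ∈ IsManifold.maximalAtlas (𝓡 n) ∞ M)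
    (hu : u.ofLp ⬝ᵥ u.ofLp = 1) (hV : ∀ v, (V v).ofLp ⬝ᵥ u.ofLp = 0) (hy : X y ∈ e.target) :
    0 < fibreNormSq (chartMetric g e) X V u y :=
  chartMetric_pos g he hy (add_ne_zero_of_orth hu (hV y))

theorem pairing_unitFibre_self {G : Coord n → Matrix (Fin n) (Fin n) ℝ}
    (hq : 0 < fibreNormSq G X V u y) :
    pairing (G (X y)) (unitFibre G X V u y).ofLp (unitFibre G X V u y).ofLp = 1 := by
  have hs := Real.mul_self_sqrt hq.le
  have hs' := (Real.sqrt_pos.2 hq).ne'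
  have : pairing (G (X y)) (unitFibre G X V u y).ofLp (unitFibre G X V u y).ofLp
      = (Real.sqrt (fibreNormSq G X V u y))⁻¹ * ((Real.sqrt (fibreNormSq G X V u y))⁻¹
        * fibreNormSq G X V u y) := by
    simp only [pairing, unitFibre, fibreNormSq, Finset.mul_sum, PiLp.smul_apply, smul_eq_mul]
    exact Finset.sum_congr rfl fun k _ => Finset.sum_congr rfl fun l _ => by ring
  rw [this]
  field_simp
  rw [sq, hs]

section

variable (he : e ∈ IsManifold.maximalAtlas (𝓡 n) ∞ M) (hu : u.ofLp ⬝ᵥ u.ofLp = 1)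
  (hV : ∀ v, (V v).ofLp ⬝ᵥ u.ofLp = 0)

include he hu hV

theorem sphereParam_coe (hy : X y ∈ e.target) : (sphereParam g e X V u v₀ y).1
    = bundlePoint e (X y, unitFibre (chartMetric g e) X V u y) := by
  have : g.inner (bundlePoint e (X y, unitFibre (chartMetric g e) X V u y)).1
      (bundlePoint e (X y, unitFibre (chartMetric g e) X V u y)).2
      (bundlePoint e (X y, unitFibre (chartMetric g e) X V u y)).2 = 1 :=
    (chartMetric_inner g _ _ _).trans (pairing_unitFibre_self (fibreNormSq_pos he hu hV hy))
  exact congrArg Subtype.val (dif_pos (α := UnitTangentBundle g) this)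

theorem contDiffAt_sphereParam_coord (hy : X y ∈ e.target) :
    ContDiffAt ℝ ∞ (fun z => (X z, unitFibre (chartMetric g e) X V u z)) y :=
  X.contDiff.contDiffAt.prodMk
    (contDiffAt_unitFibre (contDiffAt_chartMetric g he hy) (fibreNormSq_pos he hu hV hy))

theorem contMDiffAt_sphereParam (hy : X y ∈ e.target) :
    ContMDiffAt (𝓡 (2 * n - 1)) (𝓡 n).tangent ∞ (fun z => (sphereParam g e X V u v₀ z).1) y := by
  have h := ((contMDiffOn_bundlePoint he).contMDiffAt
    ((e.open_target.preimage continuous_fst).mem_nhds (by exact hy))).comp y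
    (contDiffAt_sphereParam_coord (g := g) he hu hV hy).contMDiffAt
  refine h.congr_of_eventuallyEq ?_
  filter_upwards [(e.open_target.preimage X.continuous).mem_nhds hy] with z hz
  exact sphereParam_coe he hu hV hz

theorem bundleComp_sphereParam (hy : X y ∈ e.target) (v : Coord (2 * n - 1)) :
    bundleComp e (sphereParam g e X V u v₀ y).1
      (mfderiv (𝓡 (2 * n - 1)) (𝓡 n).tangent (fun z => (sphereParam g e X V u v₀ z).1) y v)
      = (X v, fderiv ℝ (unitFibre (chartMetric g e) X V u) y v) := by
  have hs : (sphereParam g e X V u v₀ y).1 ∈ Bundle.TotalSpace.proj ⁻¹' e.source := by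
    rw [sphereParam_coe he hu hV hy]
    exact e.map_target hy
  have h1 : MDifferentiableAt (𝓡 n).tangent 𝓘(ℝ, Coord n × Coord n) (bundleCoord e)
      (sphereParam g e X V u v₀ y).1 :=
    ((contMDiffOn_bundleCoord he).contMDiffAt ((e.open_source.preimage
      (FiberBundle.continuous_proj (Coord n) _)).mem_nhds hs)).mdifferentiableAt (by simp)
  have h2 := mfderiv_comp y h1
    ((contMDiffAt_sphereParam (g := g) (v₀ := v₀) he hu hV hy).mdifferentiableAt (by simp))
  have h3 : bundleCoord e ∘ (fun z => (sphereParam g e X V u v₀ z).1)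
      =ᶠ[𝓝 y] fun z => (X z, unitFibre (chartMetric g e) X V u z) := by
    filter_upwards [(e.open_target.preimage X.continuous).mem_nhds hy] with z hz
    rw [Function.comp_apply, sphereParam_coe he hu hV hz, bundleCoord_bundlePoint he (by exact hz)]
  have h4 : HasFDerivAt (fun z => (X z, unitFibre (chartMetric g e) X V u z))
      (X.prod (fderiv ℝ (unitFibre (chartMetric g e) X V u) y)) y :=
    X.hasFDerivAt.prodMk ((contDiffAt_unitFibre (contDiffAt_chartMetric g he hy)
      (fibreNormSq_pos he hu hV hy)).differentiableAt (by simp)).hasFDerivAt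
  rw [h3.mfderiv_eq, mfderiv_eq_fderiv, h4.fderiv] at h2
  exact (congrArg (fun L : Coord (2 * n - 1) →L[ℝ] Coord n × Coord n => L v) h2).symm

theorem isLocalParam_sphereParam (hinj : ∀ v, X v = 0 → V v = 0 → v = 0) :
    IsLocalParam g (X ⁻¹' e.target) (sphereParam g e X V u v₀) where
  isOpen := e.open_target.preimage X.continuous
  smooth y hy := (contMDiffAt_sphereParam he hu hV hy).contMDiffWithinAt
  immersion y hy := by
    rw [injective_iff_map_eq_zero]
    intro (v : Coord (2 * n - 1)) hv
    have h := bundleComp_sphereParam (g := g) (v₀ := v₀) he hu hV hy v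
    rw [hv, bundleComp, map_zero] at h
    have hX : X v = 0 := (congrArg Prod.fst h).symm
    have hw : fderiv ℝ (unitFibre (chartMetric g e) X V u) y v = 0 := (congrArg Prod.snd h).symm
    have hq := fibreNormSq_pos (g := g) he hu hV hy
    rw [fderiv_unitFibre (contDiffAt_chartMetric g he hy)
      (Filter.Eventually.of_forall fun x => chartMetric_symm g x)
      (chartMetric_det_ne_zero g he hy) hq] at hw
    set s := (Real.sqrt (fibreNormSq (chartMetric g e) X V u y))⁻¹
    have hs : s ≠ 0 := inv_ne_zero (Real.sqrt_pos.2 hq).ne'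
    generalize s ^ 3 * _ = c at hw
    -- Pairing with u kills every value of V, while u pairs to 1 with itself, so only the
    -- coefficient c survives.
    have hc : c = 0 := by
      have := congrArg (fun w : Coord n => w.ofLp ⬝ᵥ u.ofLp) hw
      simpa [hu, hV, sub_dotProduct, add_dotProduct] using this
    rw [hc, zero_smul, sub_zero] at hw
    exact hinj v hX ((smul_eq_zero.1 hw).resolve_left hs)

theorem contactMetricComp_sphereParam (hy : X y ∈ e.target) :
    contactMetricComp g e (sphereParam g e X V u v₀) y
      = (1 / 4 : ℝ) • sphereMetric (chartMetric g e) X V u y := by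
  ext I J
  rw [Matrix.smul_apply, ← pairing_unitFibre (contDiffAt_chartMetric g he hy)
      (Filter.Eventually.of_forall fun x => chartMetric_symm g x)
      (chartMetric_det_ne_zero g he hy) (fibreNormSq_pos he hu hV hy)]
  have hb := sphereParam_coe (g := g) (v₀ := v₀) he hu hV hy
  have hp : e (sphereParam g e X V u v₀ y).1.1 = X y := by
    rw [hb]; exact e.right_inv hy
  have hw : (bundleCoord e (sphereParam g e X V u v₀ y).1).2
      = unitFibre (chartMetric g e) X V u y := by
    rw [hb, bundleCoord_bundlePoint he hy]
  have hI : ∀ I, bundleComp e (sphereParam g e X V u v₀ y).1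
      (paramVec g (sphereParam g e X V u v₀) y I)
      = (X (basisVec I), fderiv ℝ (unitFibre (chartMetric g e) X V u) y (basisVec I)) := fun I =>
    bundleComp_sphereParam he hu hV hy (basisVec I)
  simp only [contactMetricComp, Matrix.of_apply, contactMetric, sasaki, connectionComp, hp, hw, hI,
    smul_eq_mul, pairing, verticalPart, mul_add, Finset.sum_add_distrib]

theorem contactFormComp_sphereParam (hy : X y ∈ e.target) (I : Fin (2 * n - 1)) :
    contactFormComp g (sphereParam g e X V u v₀) y I
      = (1 / 2 : ℝ) * pairing (chartMetric g e (X y)) (X (basisVec I)).ofLp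
        (unitFibre (chartMetric g e) X V u y).ofLp := by
  have hb := sphereParam_coe (g := g) (v₀ := v₀) he hu hV hy
  have hproj : (mfderiv (𝓡 n).tangent (𝓡 n) (fun z : TangentBundle (𝓡 n) M => z.1)
      (sphereParam g e X V u v₀ y).1 (paramVec g (sphereParam g e X V u v₀) y I) : Coord n)
      = mfderiv (𝓡 n) (𝓡 n) e.symm (X y) (X (basisVec I)) := by
    have h1 : MDifferentiableAt (𝓡 n).tangent (𝓡 n) (fun z : TangentBundle (𝓡 n) M => z.1)
      (sphereParam g e X V u v₀ y).1 :=
      ((Bundle.contMDiff_proj (n := ∞) (TangentSpace (𝓡 n) (M := M))).contMDiffAt).mdifferentiableAt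
        (by simp)
    have h2 := mfderiv_comp y h1
      ((contMDiffAt_sphereParam (g := g) (v₀ := v₀) he hu hV hy).mdifferentiableAt (by simp))
    have h3 : (fun z : TangentBundle (𝓡 n) M => z.1) ∘
        (fun z => (sphereParam g e X V u v₀ z).1) =ᶠ[𝓝 y] e.symm ∘ X := by
      filter_upwards [(e.open_target.preimage X.continuous).mem_nhds hy] with z hz
      rw [Function.comp_apply, sphereParam_coe he hu hV hz]
      rfl
    have h4 := mfderiv_comp (I := 𝓡 (2 * n - 1)) (I' := 𝓡 n) (I'' := 𝓡 n) y
      ((mdifferentiable_of_mem_maximalAtlas he).mdifferentiableAt_symm hy)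
      X.differentiableAt.mdifferentiableAt
    rw [mfderiv_eq_fderiv, X.fderiv] at h4
    have h5 := h2.symm.trans (h3.mfderiv_eq.trans h4)
    exact congrArg (fun L : Coord (2 * n - 1) →L[ℝ] Coord n => L (basisVec I)) h5
  rw [contactFormComp, contactForm, ← chartMetric_inner]
  congr 1
  refine inner_congr g (congrArg (fun v : TangentBundle (𝓡 n) M => v.1) hb) hproj ?_
  exact congrArg (fun v : TangentBundle (𝓡 n) M => (v.2 : Coord n)) hb

end

end SphereParam

/-! ### Coordinate splittings adapted to an orthonormal frame -/

section Frames

variable {n : ℕ}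

/-- The splitting of the `2n - 1` coordinates into `n` horizontal and `n - 1` vertical ones. -/
def splitIndex (hn : 2 ≤ n) : Fin n ⊕ Fin (n - 1) ≃ Fin (2 * n - 1) :=
  finSumFinEquiv.trans (finCongr (by omega))

theorem exists_isSphereFrame (hn : 2 ≤ n) {u : Coord n} {B : Fin (n - 1) → Fin n → ℝ}
    (hu : u.ofLp ⬝ᵥ u.ofLp = 1) (hBu : ∀ a, B a ⬝ᵥ u.ofLp = 0)
    (hB : ∀ a b, B a ⬝ᵥ B b = if a = b then 1 else 0)
    (hpar : ∀ x y, (x ⬝ᵥ u.ofLp) * (y ⬝ᵥ u.ofLp) + ∑ a, (B a ⬝ᵥ x) * (B a ⬝ᵥ y) = x ⬝ᵥ y) :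
    ∃ X V : Coord (2 * n - 1) →L[ℝ] Coord n,
      IsSphereFrame X V u (splitIndex hn) (fun a => WithLp.toLp 2 (B a)) ∧
      ∀ v, X v = 0 → V v = 0 → v = 0 := by
  set σ := splitIndex hn
  let X : Coord (2 * n - 1) →L[ℝ] Coord n :=
    ∑ i, (EuclideanSpace.proj (σ (.inl i)) : Coord (2 * n - 1) →L[ℝ] ℝ).smulRight (basisVec i)
  let V : Coord (2 * n - 1) →L[ℝ] Coord n :=
    ∑ a, (EuclideanSpace.proj (σ (.inr a)) : Coord (2 * n - 1) →L[ℝ] ℝ).smulRight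
      (WithLp.toLp 2 (B a))
  have hX : ∀ v, X v = ∑ i, v (σ (.inl i)) • basisVec i := fun v => by
    simp only [X, sum_apply, ContinuousLinearMap.smulRight_apply]; rfl
  have hV : ∀ v, V v = ∑ a, v (σ (.inr a)) • WithLp.toLp 2 (B a) := fun v => by
    simp only [V, sum_apply, ContinuousLinearMap.smulRight_apply]; rfl
  have hVc : ∀ v (c : Fin n → ℝ), (V v).ofLp ⬝ᵥ c = ∑ a, v (σ (.inr a)) * (B a ⬝ᵥ c) := by
    intro v c
    rw [hV, WithLp.ofLp_sum, sum_dotProduct]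
    simp
  have hσ : ∀ s t, (basisVec (σ s) : Coord (2 * n - 1)) (σ t) = if t = s then 1 else 0 := by
    intro s t
    simp [EmbeddingLike.apply_eq_iff_eq]
  refine ⟨X, V, ⟨?_, ?_, ?_, ?_, ?_, hu, hB, hpar⟩, ?_⟩
  · intro i; simp only [hX, hσ]; simp
  · intro i; simp only [hX, hσ]; simp
  · intro i; simp only [hV, hσ]; simp
  · intro i; simp only [hV, hσ]; simp
  · intro v; rw [hVc]; simp [hBu]
  · intro v h1 h2
    have h3 : ∀ i, v (σ (.inl i)) = 0 := fun i => by
      have := congrArg (fun w : Coord n => w i) h1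
      rw [hX] at this
      simpa [Pi.single_apply] using this
    have h4 : ∀ a, v (σ (.inr a)) = 0 := fun a => by
      have := hVc v (B a)
      rw [h2] at this
      simpa [hB] using this.symm
    ext I
    obtain ⟨s, rfl⟩ := σ.surjective I
    rcases s with i | a
    · exact h3 i
    · exact h4 a

theorem exists_unit_orthogonal_single (hn : 2 ≤ n) (u : Fin n → ℝ) :
    ∃ X : Fin n → ℝ, X ⬝ᵥ X = 1 ∧ X ⬝ᵥ u = 0 := by
  obtain ⟨X, h1, h2, -⟩ := exists_unit_orthogonal (u := u) (v := u) (by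
    rw [Set.pair_eq_singleton]
    exact (finrank_span_le_card _).trans_lt (by simp; omega))
  exact ⟨X, h1, h2⟩

end Frames

/-! ### The η-Einstein condition at a point, and the Einstein factor -/

section Pointwise

variable {n : ℕ} {M : Type*} [TopologicalSpace M] [ChartedSpace (Coord n) M]
  [IsManifold (𝓡 n) ∞ M] {g : RiemMetric n M} {e : OpenPartialHomeomorph M (Coord n)}
  {α β : UnitTangentBundle g → ℝ} {v₀ : UnitTangentBundle g}

/-- The unit vector with components `u` at the origin of the chart `e`. -/
def unitVector (e : OpenPartialHomeomorph M (Coord n)) (v₀ : UnitTangentBundle g)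
    (u : Fin n → ℝ) : UnitTangentBundle g :=
  sphereParam g e 0 0 (WithLp.toLp 2 u) v₀ 0

/-- The point over the origin depends on u alone. Parametrizations built from different frames of u⊥
therefore give equations for the same values of `α` and `β`. -/
theorem sphereParam_zero (X V : Coord (2 * n - 1) →L[ℝ] Coord n) (u : Coord n) :
    sphereParam g e X V u v₀ 0 = unitVector e v₀ u.ofLp := by
  have hu : unitFibre (chartMetric g e) X V u 0
      = unitFibre (chartMetric g e) 0 0 (WithLp.toLp 2 u.ofLp) (0 : Coord (2 * n - 1)) := by
    simp only [unitFibre, fibreNormSq, map_zero]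
  rw [unitVector, sphereParam, sphereParam, hu, map_zero, map_zero]

theorem unitFibre_zero {G : Coord n → Matrix (Fin n) (Fin n) ℝ} (hG : G 0 = 1)
    (X V : Coord (2 * n - 1) →L[ℝ] Coord n) {u : Coord n} (hu : u.ofLp ⬝ᵥ u.ofLp = 1) :
    unitFibre G X V u 0 = u := by
  simp only [unitFibre, fibreNormSq, map_zero, add_zero, hG, pairing_one, hu, Real.sqrt_one,
    inv_one, one_smul]

theorem unitVector_bundleCoord (he : e ∈ IsManifold.maximalAtlas (𝓡 n) ∞ M)
    (hN : IsNormalAt (chartMetric g e) 0) {v : UnitTangentBundle g} (hv : v.1.1 ∈ e.source)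
    (hv0 : e v.1.1 = 0) :
    (bundleCoord e v.1).2.ofLp ⬝ᵥ (bundleCoord e v.1).2.ofLp = 1 ∧
      unitVector e v₀ (bundleCoord e v.1).2.ofLp = v := by
  set u := (bundleCoord e v.1).2 with hu
  have h0 : (0 : Coord n) ∈ e.target := hv0 ▸ e.map_source hv
  have h1 : bundlePoint e (0, u) = v.1 := by
    have := mfderiv_symm_mfderiv he hv v.1.2
    rw [hv0] at this
    refine Bundle.TotalSpace.ext ?_ (heq_of_eq this)
    change e.symm 0 = _
    rw [← hv0]
    exact e.left_inv hv
  have hu1 : u.ofLp ⬝ᵥ u.ofLp = 1 := by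
    have h2 := v.2
    rw [← h1] at h2
    have h3 := chartMetric_inner (e := e) g 0 u u
    rw [hN.eq_one, pairing_one] at h3
    exact h3.symm.trans h2
  refine ⟨hu1, Subtype.ext ?_⟩
  have h4 := sphereParam_coe (g := g) (v₀ := v₀) (X := 0) (V := 0) (u := u) (y := 0) he hu1
    (by simp) (by simpa using h0)
  rw [unitFibre_zero hN.eq_one _ _ hu1, map_zero] at h4
  exact h4.trans h1

theorem IsEtaEinstein.ricci_sphereMetric (h : IsEtaEinstein g α β)
    (he : e ∈ IsManifold.maximalAtlas (𝓡 n) ∞ M) (h0 : (0 : Coord n) ∈ e.target)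
    (hN : IsNormalAt (chartMetric g e) 0) (hn : 2 ≤ n)
    {X V : Coord (2 * n - 1) →L[ℝ] Coord n} {u : Coord n} {B : Fin (n - 1) → Coord n}
    (hF : IsSphereFrame X V u (splitIndex hn) B) (hinj : ∀ v, X v = 0 → V v = 0 → v = 0)
    (I J : Fin (2 * n - 1)) :
    ricci (sphereMetric (chartMetric g e) X V u) 0 I J
      = α (unitVector e v₀ u.ofLp) / 4 * (1 : Matrix (Fin (2 * n - 1)) (Fin (2 * n - 1)) ℝ) I J
        + β (unitVector e v₀ u.ofLp) / 4
          * (((X (basisVec I)).ofLp ⬝ᵥ u.ofLp) * ((X (basisVec J)).ofLp ⬝ᵥ u.ofLp)) := by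
  have hy : X 0 ∈ e.target := by rwa [map_zero]
  have h1 := h.ricci_eq e he _ _ (isLocalParam_sphereParam (v₀ := v₀) he hF.unit hF.V_orth hinj)
    (fun y hy => by
      rw [sphereParam_coe he hF.unit hF.V_orth hy]
      exact e.map_target hy) 0 hy I J
  have hev : contactMetricComp g e (sphereParam g e X V u v₀) =ᶠ[𝓝 0]
      fun y => (1 / 4 : ℝ) • sphereMetric (chartMetric g e) X V u y := by
    filter_upwards [(e.open_target.preimage X.continuous).mem_nhds hy] with y hy
    exact contactMetricComp_sphereParam he hF.unit hF.V_orth hy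
  rw [ricci_congr hev, ricci_const_smul (by norm_num), hev.eq_of_nhds,
    contactFormComp_sphereParam he hF.unit hF.V_orth hy,
    contactFormComp_sphereParam he hF.unit hF.V_orth hy, map_zero, hN.eq_one, pairing_one,
    pairing_one, unitFibre_zero hN.eq_one _ _ hF.unit, sphereParam_zero, Matrix.smul_apply,
    (sphereMetric_hasJet hN hF I J).val, smul_eq_mul] at h1
  rw [h1]
  ring

/-- The consequences of the `η`-Einstein condition at a point, in a normal chart. -/
theorem IsEtaEinstein.exists_einsteinFactor (h : IsEtaEinstein g α β)
    (he : e ∈ IsManifold.maximalAtlas (𝓡 n) ∞ M) (h0 : (0 : Coord n) ∈ e.target)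
    (hN : IsNormalAt (chartMetric g e) 0) (hn : 2 ≤ n) (v₀ : UnitTangentBundle g) :
    ∃ lam : ℝ, (∀ j k, ricci (chartMetric g e) 0 j k = if j = k then lam else 0) ∧
      (n = 2 → lam ^ 2 = lam) ∧
      ∀ v : UnitTangentBundle g, v.1.1 = e.symm 0 →
        (3 * n - 2) * α v + β v = 4 * n * lam + 8 * (n - 1) * (n - 2) ∧
        (n + 1) * (α v + β v) = 8 * lam - 2 * lam ^ 2 + 4 * (n - 1) * (n - 2) := by
  set R := fun l i j k => riemann (chartMetric g e) l i j k 0 with hR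
  have hfib : ∀ u X : Fin n → ℝ, u ⬝ᵥ u = 1 → X ⬝ᵥ X = 1 → X ⬝ᵥ u = 0 →
      ∑ i, ∑ j, (X ⬝ᵥ tensorApply R i j u) ^ 2 = α (unitVector e v₀ u) - 4 * (n - 2) := by
    intro u X hu hX hXu
    -- The given vertical vector is made a member of the frame, so that a diagonal component of the
    -- Ricci tensor tests it.
    obtain ⟨B, ⟨a, rfl⟩, hBu, hB, hpar⟩ := exists_orthonormal_frame hn hu hX hXu
    obtain ⟨X, V, hF, hinj⟩ := exists_isSphereFrame hn (u := WithLp.toLp 2 u) hu hBu hB hpar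
    have h1 := h.ricci_sphereMetric (v₀ := v₀) he h0 hN hn hF hinj (splitIndex hn (.inr a))
      (splitIndex hn (.inr a))
    rw [ricci_sphereMetric_inr hN hF, hF.X_inr, Matrix.one_apply_eq] at h1
    have hc : ((n - 1 : ℕ) : ℝ) = n - 1 := by rw [Nat.cast_sub (by omega)]; simp
    simp only [Fintype.card_fin, hc, WithLp.ofLp_zero, zero_dotProduct, mul_zero, add_zero] at h1
    have h2 : ∑ i, ∑ j, (B a ⬝ᵥ tensorApply R i j u) ^ 2
        = ∑ i, ∑ j, (B a ⬝ᵥ curvatureApply (chartMetric g e) 0 i j u) ^ 2 := rfl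
    rw [h2]
    linarith
  have hbase : ∀ u : Fin n → ℝ, u ⬝ᵥ u = 1 → ∀ j k,
      ∑ i, R i i j k - (1 / 2 : ℝ) * ∑ i, tensorApply R j i u ⬝ᵥ tensorApply R k i u
        = α (unitVector e v₀ u) / 4 * (if j = k then 1 else 0)
          + β (unitVector e v₀ u) / 4 * (u j * u k) := by
    intro u hu j k
    obtain ⟨Y, hY, hYu⟩ := exists_unit_orthogonal_single hn u
    obtain ⟨B, -, hBu, hB, hpar⟩ := exists_orthonormal_frame hn hu hY hYu
    obtain ⟨X, V, hF, hinj⟩ := exists_isSphereFrame hn (u := WithLp.toLp 2 u) hu hBu hB hpar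
    have h1 := h.ricci_sphereMetric (v₀ := v₀) he h0 hN hn hF hinj (splitIndex hn (.inl j))
      (splitIndex hn (.inl k))
    rw [ricci_sphereMetric_inl hN hF, hF.X_inl, hF.X_inl, Matrix.one_apply] at h1
    simp only [EmbeddingLike.apply_eq_iff_eq, Sum.inl.injEq, PiLp.ofLp_single,
      single_one_dotProduct] at h1
    exact h1
  obtain ⟨lam, hl1, hl2, hl3⟩ := eta_einstein_algebra hn hN.isCurvatureTensor hfib hbase
  refine ⟨lam, hl1, hl2, fun v hv => ?_⟩
  have hs : v.1.1 ∈ e.source := hv ▸ e.map_target h0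
  have hv0 : e v.1.1 = 0 := by rw [hv]; exact e.right_inv h0
  obtain ⟨hu, huv⟩ := unitVector_bundleCoord (v₀ := v₀) he hN hs hv0
  have := hl3 _ hu
  rwa [huv] at this

/-- The Ricci tensor of the base in a chart `e` is determined by the one in a normal chart. -/
theorem ricci_chartMetric_of_normal {e' : OpenPartialHomeomorph M (Coord n)}
    (he : e ∈ IsManifold.maximalAtlas (𝓡 n) ∞ M) (he' : e' ∈ IsManifold.maximalAtlas (𝓡 n) ∞ M)
    (hN : IsNormalAt (chartMetric g e) 0) {lam : ℝ}
    (hlam : ∀ j k, ricci (chartMetric g e) 0 j k = if j = k then lam else 0) {y : Coord n}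
    (hy : y ∈ e'.target) (hye : e'.symm y ∈ e.source) (hy0 : e (e'.symm y) = 0) (j k : Fin n) :
    ricci (chartMetric g e') y j k = lam * chartMetric g e' y j k := by
  rw [ricci_chartMetric_transition g he he' hy hye, chartMetric_transition g he he' hy hye,
    pullbackMetric_apply, hy0, hN.eq_one]
  simp [hlam, Matrix.one_apply, Finset.mul_sum]

/-- The derivative is computed in a chart normal at the point, then carried to `e` by the transition
map. Schur's lemma covers n ≥ 3; the idempotency `hlam2` replaces it for surfaces. -/
theorem hasFDerivAt_einsteinFactor (hn : 2 ≤ n) {lam : M → ℝ}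
    (hlam : ∀ e ∈ IsManifold.maximalAtlas (𝓡 n) ∞ M, ∀ y ∈ e.target, ∀ j k,
      ricci (chartMetric g e) y j k = lam (e.symm y) * chartMetric g e y j k)
    (hlam2 : n = 2 → ∀ p, lam p ^ 2 = lam p) (he : e ∈ IsManifold.maximalAtlas (𝓡 n) ∞ M)
    {y : Coord n} (hy : y ∈ e.target) :
    HasFDerivAt (fun z => lam (e.symm z)) (0 : Coord n →L[ℝ] ℝ) y := by
  obtain ⟨e₁, he₁, hs, h0, hN⟩ := exists_normal_chart g (e.symm y)
  have ht : (0 : Coord n) ∈ e₁.target := h0 ▸ e₁.map_source hs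
  have hR : ∀ᶠ z in 𝓝 (0 : Coord n), ∀ j k, ricci (chartMetric g e₁) z j k
      = lam (e₁.symm z) * chartMetric g e₁ z j k := by
    filter_upwards [e₁.open_target.mem_nhds ht] with z hz using hlam e₁ he₁ z hz
  have h1 : HasFDerivAt (fun z => lam (e₁.symm z)) (0 : Coord n →L[ℝ] ℝ) 0 := by
    rcases hn.lt_or_eq with h3 | h2
    · exact hN.schur h3 hR
    · have hd := ((hN.contDiffAt_einsteinFactor (by omega) hR).differentiableAt
        (by simp)).hasFDerivAt
      set f := fun z => lam (e₁.symm z) with hf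
      have hsq : (fun z => f z * f z) = f := by
        ext z; rw [← sq]; exact hlam2 h2.symm _
      have hm := hd.mul hd
      have hu : f 0 • fderiv ℝ f 0 + f 0 • fderiv ℝ f 0 = fderiv ℝ f 0 := by
        refine HasFDerivAt.unique (f := f) (x := 0) ?_ hd
        exact hm.congr_of_eventuallyEq (Filter.Eventually.of_forall fun z => (congrFun hsq z).symm)
      -- Differentiate f² = f; the factor 2f - 1 cannot vanish because ½ is not idempotent.
      have hz : (2 * f 0 - 1) • fderiv ℝ f 0 = 0 := by
        rw [sub_smul, one_smul, two_mul, add_smul, hu, sub_self]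
      have hne : 2 * f 0 - 1 ≠ 0 := by
        intro hc
        have h4 : f 0 * f 0 = f 0 := congrFun hsq 0
        have h5 : f 0 = 1 / 2 := by linarith
        rw [h5] at h4
        norm_num at h4
      rw [← (smul_eq_zero.1 hz).resolve_left hne]
      exact hd
  have hφ := ((contDiffAt_transition he₁ he hy hs).differentiableAt (by simp)).hasFDerivAt
  have h2 := HasFDerivAt.comp (g := fun z => lam (e₁.symm z)) y (by rw [h0]; exact h1) hφ
  rw [ContinuousLinearMap.zero_comp] at h2
  refine h2.congr_of_eventuallyEq ?_
  filter_upwards [eventually_mem_source hy hs] with z hz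
  exact congrArg lam (e₁.left_inv hz.2).symm

theorem isLocallyConstant_of_hasFDerivAt {lam : M → ℝ}
    (h : ∀ e ∈ IsManifold.maximalAtlas (𝓡 n) ∞ M, ∀ y ∈ e.target,
      HasFDerivAt (fun z => lam (e.symm z)) (0 : Coord n →L[ℝ] ℝ) y) : IsLocallyConstant lam := by
  rw [IsLocallyConstant.iff_eventually_eq]
  intro p
  set e := chartAt (Coord n) p
  have he : e ∈ IsManifold.maximalAtlas (𝓡 n) ∞ M := IsManifold.chart_mem_maximalAtlas p
  have hp : p ∈ e.source := mem_chart_source _ p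
  obtain ⟨r, hr, hball⟩ := Metric.isOpen_iff.1 e.open_target (e p) (e.map_source hp)
  have hc : ∀ z ∈ Metric.ball (e p) r, lam (e.symm z) = lam (e.symm (e p)) := fun z hz =>
    Metric.isOpen_ball.is_const_of_fderiv_eq_zero (convex_ball _ _).isPreconnected
      (fun w hw => (h e he w (hball hw)).differentiableAt.differentiableWithinAt)
      (fun w hw => (h e he w (hball hw)).fderiv) hz (Metric.mem_ball_self hr)
  filter_upwards [(e.continuousAt hp).preimage_mem_nhds (Metric.ball_mem_nhds _ hr),
    e.open_source.mem_nhds hp] with q hq hqs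
  have := hc _ hq
  rwa [e.left_inv hqs, e.left_inv hp] at this

end Pointwise

end UnitTangent

end

/-! ### Conclusion -/

theorem theorem1 {n : ℕ} (hn : 2 ≤ n) {M : Type*} [TopologicalSpace M] [T2Space M]
    [SecondCountableTopology M] [ConnectedSpace M] [ChartedSpace (EuclideanSpace ℝ (Fin n)) M]
    [IsManifold (𝓡 n) ∞ M] (g : UnitTangent.RiemMetric n M)
    (α β : UnitTangent.UnitTangentBundle g → ℝ) (h : UnitTangent.IsEtaEinstein g α β) :
    (∃ a : ℝ, ∀ v, α v = a) ∧ (∃ b : ℝ, ∀ v, β v = b) := by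
  open UnitTangent in
  -- The unit vector `v₀` serves as default value of the parametrizations outside their domain and,
  -- at the end, as the reference point.
  rcases isEmpty_or_nonempty (UnitTangentBundle g) with hE | ⟨⟨v₀⟩⟩
  · exact ⟨⟨0, fun v => hE.elim v⟩, ⟨0, fun v => hE.elim v⟩⟩
  have hp : ∀ p : M, ∃ e ∈ IsManifold.maximalAtlas (𝓡 n) ∞ M, p ∈ e.source ∧ e p = 0 ∧
      IsNormalAt (chartMetric g e) 0 ∧
      ∃ lam : ℝ, (∀ j k, ricci (chartMetric g e) 0 j k = if j = k then lam else 0) ∧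
        (n = 2 → lam ^ 2 = lam) ∧ ∀ v : UnitTangentBundle g, v.1.1 = p →
          (3 * n - 2) * α v + β v = 4 * n * lam + 8 * (n - 1) * (n - 2) ∧
          (n + 1) * (α v + β v) = 8 * lam - 2 * lam ^ 2 + 4 * (n - 1) * (n - 2) := by
    intro p
    obtain ⟨e, he, hpe, he0, hN⟩ := exists_normal_chart g p
    have h0 : (0 : Coord n) ∈ e.target := he0 ▸ e.map_source hpe
    obtain ⟨lam, h1, h2, h3⟩ := h.exists_einsteinFactor he h0 hN hn v₀
    refine ⟨e, he, hpe, he0, hN, lam, h1, h2, fun v hv => h3 v ?_⟩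
    rw [hv, ← he0, e.left_inv hpe]
  choose E hE hEp hE0 hEN lam hlam1 hlam2 hlam3 using hp
  have hloc : IsLocallyConstant lam := by
    refine isLocallyConstant_of_hasFDerivAt fun e he y hy =>
      hasFDerivAt_einsteinFactor (g := g) hn ?_ (fun h2 p => hlam2 p h2) he hy
    intro e he y hy j k
    exact ricci_chartMetric_of_normal (hE _) he (hEN _) (hlam1 _) hy (hEp _) (hE0 _) j k
  have hconst : ∀ p, lam p = lam v₀.1.1 := fun p => hloc.apply_eq_of_preconnectedSpace p _
  have hn2 : (2 : ℝ) ≤ n := by exact_mod_cast hn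
  have key : ∀ v : UnitTangentBundle g, α v = α v₀ ∧ β v = β v₀ := by
    intro v
    obtain ⟨a1, b1⟩ := hlam3 _ v rfl
    obtain ⟨a2, b2⟩ := hlam3 _ v₀ rfl
    rw [hconst] at a1 b1
    -- With lam constant the right-hand sides at v and v₀ agree. The differences solve a homogeneous
    -- linear system, nondegenerate because n + 1 and 3n - 3 are nonzero.
    have h1 : (3 * (n : ℝ) - 2) * (α v - α v₀) + (β v - β v₀) = 0 := by linear_combination a1 - a2
    have h2 : (n + 1 : ℝ) * ((α v - α v₀) + (β v - β v₀)) = 0 := by linear_combination b1 - b2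
    have h3 : (α v - α v₀) + (β v - β v₀) = 0 := (mul_eq_zero.1 h2).resolve_left (by linarith)
    have h4 : (3 * (n : ℝ) - 3) * (α v - α v₀) = 0 := by linear_combination h1 - h3
    have h5 : α v - α v₀ = 0 := (mul_eq_zero.1 h4).resolve_left (by linarith)
    exact ⟨by linarith, by linarith⟩
  exact ⟨⟨α v₀, fun v => (key v).1⟩, ⟨β v₀, fun v => (key v).2⟩⟩
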